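/- Let $n\ge 2$ and let $Y=f+\xi$, where $f\in\mathbb R^n$ is an unknown vector and $\xi=(\xi_1,\dots,\xi_n)$ is a random vector with independent centered components such that, for known numbers $\sigma,c\ge 0$, $$\log \mathbb E\big[e^{\lambda\xi_i}\big]\le \frac{\lambda^2\sigma^2}{2(1-|\lambda|c)}\qquad\text{for all }\lambda\in(-1/c,1/c)\text{ and } i=1,\dots,n$$ (with $1/0=+\infty$; in particular these Laplace transforms are finite). Let $|\cdot|_2$ be the Euclidean norm on $\mathbb R^n$ and $|\cdot|$ the cardinality of a finite set. For a partition $m$ of $\{1,\dots,n\}$ into blocks of consecutive integers, let $S_m$ be the space of vectors of $\mathbb R^n$ whose coordinates are constant on each block of $m$, and let $\hat f_m=\Pi_{S_m}Y$ be the orthogonal projection of $Y$ onto $S_m$. Let $\mathfrak m$ be such a partition and let $\mathcal M$ be a nonempty collection of such partitions $m$ with $S_m\subset S_{\mathfrak m}$. Let $(\Delta_m)_{m\in\mathcal M}$ be nonnegative numbers, put $\Sigma=\sum_{m\in\mathcal M}e^{-\Delta_m}$ and $\kappa=18$. Let $a,b>0$ and assume that $$|I|\ge a^2\log^2 n\qquad\text{for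 all } I\in\mathfrak m .$$ Let $K>1$ and let $\mathrm{pen}:\mathcal M\to\mathbb R_+$ satisfy $$\mathrm{pen}(m)\ge K\kappa^2\Big(\sigma^2+2c\,\frac{(\sigma+c)(b+2)}{a\kappa}\Big)\big(|m|+\Delta_m\big)\qquad\text{for all } m\in\mathcal M .$$ Let $\hat m$ be any (measurable) random minimizer over $m\in\mathcal M$ of $\mathrm{crit}(m)=|Y-\hat f_m|_2^2+\mathrm{pen}(m)$. Then $|f-\hat f_{\hat m}|_2^2$ and all $|f-\hat f_m|_2^2$, $m\in\mathcal M$, are integrable and $$\mathbb E\big[|f-\hat f_{\hat m}|_2^2\big]\le C(K)\Big[\inf_{m\in\mathcal M}\Big(\mathbb E\big[|f-\hat f_m|_2^2\big]+\mathrm{pen}(m)\Big)+R\Big],$$ where $$C(K)=\frac{K(K^2+K-1)}{(K-1)^3},\qquad R=\kappa^2\Big(\sigma^2+2c\,\frac{(c+\sigma)(b+2)}{a\kappa}\Big)\Sigma+2\,\frac{(c+\sigma)^2(b+2)^2}{a^2n^b}.$$ -/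

import Mathlib

open MeasureTheory ProbabilityTheory

noncomputable section

namespace HistSel

/-- A partition of the index set all of whose blocks consist of consecutive integers. -/
def IsConsecutive {n : ℕ} (m : Finpartition (Finset.univ : Finset (Fin n))) : Prop :=
  ∀ I ∈ m.parts, (I : Set (Fin n)).OrdConnected

/-- The space `S_m` of the vectors of `ℝⁿ` whose coordinates are constant on each block of `m`. -/
def histSpace {n : ℕ} (m : Finpartition (Finset.univ : Finset (Fin n))) :
    Submodule ℝ (EuclideanSpace ℝ (Fin n)) where
  carrier := {x | ∀ I ∈ m.parts, ∀ i ∈ I, ∀ j ∈ I, x i = x j}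
  add_mem' := by
    intro x y hx hy I hI i hi j hj
    simp [hx I hI i hi j hj, hy I hI i hi j hj]
  zero_mem' := by
    intro I _ i _ j _
    simp
  smul_mem' := by
    intro r x hx I hI i hi j hj
    simp [hx I hI i hi j hj]

/-- The least-squares estimator: the orthogonal projection of the data `y` onto `S_m`. -/
def lsEst {n : ℕ} (m : Finpartition (Finset.univ : Finset (Fin n)))
    (y : EuclideanSpace ℝ (Fin n)) : EuclideanSpace ℝ (Fin n) :=
  (histSpace m).starProjection y

/-- The penalized least-squares criterion. -/
def crit {n : ℕ} (pen : Finpartition (Finset.univ : Finset (Fin n)) → ℝ)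
    (y : EuclideanSpace ℝ (Fin n)) (m : Finpartition (Finset.univ : Finset (Fin n))) : ℝ :=
  ‖y - lsEst m y‖ ^ 2 + pen m

/-- The observation `Y = f + ξ`. -/
def obs {Ω : Type*} {n : ℕ} (f : EuclideanSpace ℝ (Fin n)) (ξ : Fin n → Ω → ℝ) (ω : Ω) :
    EuclideanSpace ℝ (Fin n) :=
  f + WithLp.toLp 2 (fun i => ξ i ω)

/-- The Bernstein-type bound `log E[exp (t X)] ≤ t² σ² / (2 (1 - |t| c))` for all
`t ∈ (-1/c, 1/c)`, where `1/0 = +∞`; the Laplace transform is required to be finite there. -/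
def BernsteinBound {Ω : Type*} [MeasurableSpace Ω] (μ : Measure Ω) (X : Ω → ℝ)
    (σ c : ℝ) : Prop :=
  ∀ t : ℝ, |t| * c < 1 →
    Integrable (fun ω => Real.exp (t * X ω)) μ ∧
      Real.log (∫ ω, Real.exp (t * X ω) ∂μ) ≤ t ^ 2 * σ ^ 2 / (2 * (1 - |t| * c))

/-- The numerical constant `κ`. -/
def kappa : ℝ := 18

/-- The constant `C(K)`. -/
def CK (K : ℝ) : ℝ := K * (K ^ 2 + K - 1) / (K - 1) ^ 3

/-- The factor `κ² (σ² + 2 c (σ + c) (b + 2) / (a κ))`. -/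
def penFactor (σ c a b : ℝ) : ℝ :=
  kappa ^ 2 * (σ ^ 2 + 2 * c * ((σ + c) * (b + 2) / (a * kappa)))

end HistSel

end

/-! Write $r_m=\Pi_{S_{m_0}}f-\Pi_{S_m}f$ (`resid`). Since $S_m\subset S_{m_0}$, Pythagoras gives
$|f-\hat f_m|^2=|f-\Pi_{S_{m_0}}f|^2+|r_m|^2+|\Pi_{S_m}\xi|^2$, and up to terms free of $m$ the
criterion is $|r_m|^2+2\langle r_m,\xi\rangle-|\Pi_{S_m}\xi|^2+\mathrm{pen}(m)$. Comparing $\hat m$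
with $m$ and giving up a fraction $\theta$ of the loss leaves the `excess`
$(2-\theta)|\Pi_{S_m}\xi|^2-2\langle r_m,\xi\rangle-\theta|r_m|^2-\mathrm{pen}(m)$ at $\hat m$. By
`oracle_of_excess_le` it is enough to dominate all excesses by one variable of mean at most $R$,
with $C(K)(1-\theta)\ge1$. Put $u=(\sigma+c)(b+2)/a$ and $Q=9\sigma^2+cu$: the penalty is at least
$36KQ(|m|+\Delta_m)$, to be shared by the quadratic and the linear term.

Quadratic term (`exists_bound_norm_lsEst_sq`). Where the coordinates of $\Pi_{S_{m_0}}\xi$ are at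
most $5u$, a volume argument works: the exponential of the noise is integrated over a symmetric
convex body of $S_m$, and a large projection makes this integral large, because the body contains a
shrunken copy of itself near the direction of the projection. The complementary event has
probability of polynomial order in $1/n$, the blocks of $m_0$ being long
(`lintegral_largeEnergy_le`).

Linear term (`exists_bound_linear`). For $K\le15$ and $n\ge4$, the large coordinates of $r_m$ are
paid for by their own energy and a Chernoff bound with weights $e^{-\Delta_m}$ handles the rest.
That remainder grows with $K$, so for $K\ge15$ one takes $\theta=3.5/K$ and a majorant of mean at
most zero. It comes from a union bound over all intervals when $\log n\le32$ (also used for $n<4$),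
and otherwise from `CutSignal.exists_multiscale_bound`, whose constants do not depend on $n$:
intervals are sorted by energy, each contains one of a sparse set of anchors, and a maximal
inequality controls all intervals around an anchor at once. -/

noncomputable section

namespace HistSel

/-! ### Laplace transforms, an exponential maximal inequality, integration of tails. -/

section Prob

variable {Ω : Type*} [MeasurableSpace Ω] {μ : Measure Ω}

/-- A product bound for the Laplace transform of a weighted sum of independent variables. -/
lemma lintegral_exp_sum_le {ι : Type*} {ξ : ι → Ω → ℝ} (hm : ∀ i, Measurable (ξ i))
    (hi : iIndepFun ξ μ) (s : Finset ι) (t g : ι → ℝ)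
    (h : ∀ i ∈ s, ∫⁻ ω, ENNReal.ofReal (Real.exp (t i * ξ i ω)) ∂μ ≤
      ENNReal.ofReal (Real.exp (g i))) :
    ∫⁻ ω, ENNReal.ofReal (Real.exp (∑ i ∈ s, t i * ξ i ω)) ∂μ ≤
      ENNReal.ofReal (Real.exp (∑ i ∈ s, g i)) := by
  have hX : iIndepFun (fun i ω => ENNReal.ofReal (Real.exp (t i * ξ i ω))) μ :=
    hi.comp (fun i x => ENNReal.ofReal (Real.exp (t i * x))) (fun i => by fun_prop)
  have hX' : ∀ i, Measurable (fun ω => ENNReal.ofReal (Real.exp (t i * ξ i ω))) := by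
    intro i; have := hm i; fun_prop
  calc ∫⁻ ω, ENNReal.ofReal (Real.exp (∑ i ∈ s, t i * ξ i ω)) ∂μ
      = ∫⁻ ω, ∏ i ∈ s, ENNReal.ofReal (Real.exp (t i * ξ i ω)) ∂μ := by
        congr 1; ext ω
        rw [Real.exp_sum, ENNReal.ofReal_prod_of_nonneg]
        intros; positivity
    _ = ∏ i ∈ s, ∫⁻ ω, ENNReal.ofReal (Real.exp (t i * ξ i ω)) ∂μ :=
        lintegral_prod_eq_prod_lintegral_of_indepFun s _ hX hX'
    _ ≤ ∏ i ∈ s, ENNReal.ofReal (Real.exp (g i)) := Finset.prod_le_prod' h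
    _ = _ := by
        rw [Real.exp_sum, ENNReal.ofReal_prod_of_nonneg]
        intros; positivity

/-- Independent sums over disjoint finite index sets decouple in Lebesgue integrals. -/
lemma lintegral_mul_of_disjoint {ι : Type*} [DecidableEq ι] {ξ : ι → Ω → ℝ}
    (hm : ∀ i, Measurable (ξ i)) (hi : iIndepFun ξ μ) (S T : Finset ι) (hST : Disjoint S T)
    (F G : (ι → ℝ) → ENNReal) (hF : Measurable F) (hG : Measurable G)
    (hFS : ∀ x y : ι → ℝ, (∀ i ∈ S, x i = y i) → F x = F y)
    (hGT : ∀ x y : ι → ℝ, (∀ i ∈ T, x i = y i) → G x = G y) :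
    ∫⁻ ω, F (fun i => ξ i ω) * G (fun i => ξ i ω) ∂μ =
      (∫⁻ ω, F (fun i => ξ i ω) ∂μ) * ∫⁻ ω, G (fun i => ξ i ω) ∂μ := by
  have hind := hi.indepFun_finset S T hST hm
  -- Extension by zero turns `F` and `G` into functions of the coordinates in `S` and in `T` alone.
  let e (U : Finset ι) (x : U → ℝ) (i : ι) : ℝ := if h : i ∈ U then x ⟨i, h⟩ else 0
  have he : ∀ U, Measurable (e U) := by
    intro U
    refine measurable_pi_lambda _ fun i => ?_
    by_cases h : i ∈ U
    · simp only [e, h, dite_true]; fun_prop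
    · simp only [e, h, dite_false]; fun_prop
  have h2 := hind.comp (φ := F ∘ e S) (ψ := G ∘ e T) (hF.comp (he S)) (hG.comp (he T))
  have hFe : (F ∘ e S) ∘ (fun a (i : S) => ξ i a) = fun ω => F (fun i => ξ i ω) := by
    ext ω
    exact hFS _ _ fun i hi => by simp [e, hi]
  have hGe : (G ∘ e T) ∘ (fun a (i : T) => ξ i a) = fun ω => G (fun i => ξ i ω) := by
    ext ω
    exact hGT _ _ fun i hi => by simp [e, hi]
  rw [hFe, hGe] at h2
  have hmv : Measurable fun ω => (fun i => ξ i ω) := measurable_pi_lambda _ hm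
  exact lintegral_mul_eq_lintegral_mul_lintegral_of_indepFun'' (hF.comp hmv).aemeasurable
    (hG.comp hmv).aemeasurable h2

/-- The Laplace transform of a centered sum is at least one. -/
lemma one_le_lintegral_exp [IsProbabilityMeasure μ] {X : Ω → ℝ} (hX : Integrable X μ)
    (h0 : ∫ ω, X ω ∂μ = 0) : 1 ≤ ∫⁻ ω, ENNReal.ofReal (Real.exp (X ω)) ∂μ := by
  have h1 : ∫ ω, (1 + X ω) ∂μ = 1 := by
    rw [integral_add (by simp) hX, h0]; simp
  calc (1 : ENNReal) = ENNReal.ofReal (∫ ω, (1 + X ω) ∂μ) := by rw [h1]; simp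
    _ ≤ ∫⁻ ω, ENNReal.ofReal (1 + X ω) ∂μ := by
        have := integral_eq_lintegral_pos_part_sub_lintegral_neg_part
          (f := fun ω => 1 + X ω) (μ := μ) ((integrable_const _).add hX)
        rw [this]
        refine (ENNReal.ofReal_le_ofReal (sub_le_self _ ENNReal.toReal_nonneg)).trans ?_
        exact ENNReal.ofReal_toReal_le
    _ ≤ _ := by
        refine lintegral_mono fun ω => ENNReal.ofReal_le_ofReal ?_
        linarith [Real.add_one_le_exp (X ω)]

/-- Exponential maximal inequality for partial sums of independent centered variables. -/
lemma maximal_exp [IsProbabilityMeasure μ] {ι : Type*} [DecidableEq ι] {ξ : ι → Ω → ℝ}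
    (hm : ∀ i, Measurable (ξ i)) (hi : iIndepFun ξ μ) (hint : ∀ i, Integrable (ξ i) μ)
    (h0 : ∀ i, ∫ ω, ξ i ω ∂μ = 0) (N : ℕ) (k : ℕ → ι) (hk : Set.InjOn k (Set.Iio N))
    (v g : ℕ → ℝ)
    (h : ∀ j < N, ∫⁻ ω, ENNReal.ofReal (Real.exp (v j * ξ (k j) ω)) ∂μ ≤
      ENNReal.ofReal (Real.exp (g j))) (a : ℝ) :
    μ {ω | ∃ i ≤ N, a ≤ ∑ j ∈ Finset.range i, v j * ξ (k j) ω} ≤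
      ENNReal.ofReal (Real.exp (∑ j ∈ Finset.range N, g j - a)) := by
  let P (i : ℕ) (x : ι → ℝ) : ℝ := ∑ j ∈ Finset.range i, v j * x (k j)
  let R (i : ℕ) (x : ι → ℝ) : ℝ := ∑ j ∈ Finset.Ico i N, v j * x (k j)
  have hP : ∀ i, Measurable (P i) := fun i => by
    refine Finset.measurable_sum _ fun j _ => ?_
    exact (measurable_pi_apply (k j)).const_mul _
  have hR : ∀ i, Measurable (R i) := fun i => by
    refine Finset.measurable_sum _ fun j _ => ?_
    exact (measurable_pi_apply (k j)).const_mul _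
  have hPR : ∀ i ≤ N, ∀ x, P i x + R i x = P N x := fun i hiN x =>
    Finset.sum_range_add_sum_Ico _ hiN
  -- First passage decomposition: `A i` says that the partial sums reach `a` for the first time at
  -- `i`. It depends on the first `i` terms only, and the Laplace transform of the later increments
  -- is at least one, so multiplying by it only increases the bound: Doob's inequality for the
  -- exponential submartingale.
  let A (i : ℕ) : Set (ι → ℝ) := {x | a ≤ P i x ∧ ∀ i' < i, P i' x < a}
  have hA : ∀ i, MeasurableSet (A i) := fun i => by
    refine (measurableSet_le measurable_const (hP i)).inter ?_
    have : {x | ∀ i' < i, P i' x < a} = ⋂ i' ∈ Set.Iio i, {x | P i' x < a} := by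
      ext x; simp
    change MeasurableSet {x | ∀ i' < i, P i' x < a}
    rw [this]
    exact MeasurableSet.biInter (Set.to_countable _)
      fun i' _ => measurableSet_lt (hP i') measurable_const
  let Y : Ω → ι → ℝ := fun ω i => ξ i ω
  have hY : Measurable Y := measurable_pi_lambda _ hm
  have hsub : {ω | ∃ i ≤ N, a ≤ P i (Y ω)} ⊆ ⋃ i ∈ Finset.range (N + 1), Y ⁻¹' A i := by
    rintro ω ⟨i, hiN, hai⟩
    have hex : ∃ i, a ≤ P i (Y ω) := ⟨i, hai⟩
    classical
    refine Set.mem_biUnion (x := Nat.find hex) ?_ ⟨Nat.find_spec hex, fun i' hi' => ?_⟩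
    · simpa [Nat.lt_succ_iff] using (Nat.find_min' hex hai).trans hiN
    · simpa using Nat.find_min hex hi'
  have hdisj : ∀ x, ∑ i ∈ Finset.range (N + 1), (A i).indicator (fun _ => (1 : ENNReal)) x ≤ 1 := by
    intro x
    by_cases hx : ∃ i ∈ Finset.range (N + 1), x ∈ A i
    · obtain ⟨i, hi1, hi2⟩ := hx
      rw [Finset.sum_eq_single_of_mem i hi1]
      · simp [hi2]
      · intro j _ hji
        refine Set.indicator_of_notMem (fun hj => ?_) _
        rcases lt_or_gt_of_ne hji with h | h
        · exact absurd hj.1 (not_le.2 (hi2.2 j h))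
        · exact absurd hi2.1 (not_le.2 (hj.2 i h))
    · push Not at hx
      rw [Finset.sum_eq_zero fun i hi => Set.indicator_of_notMem (hx i hi) _]
      exact zero_le
  have hstep : ∀ i ∈ Finset.range (N + 1), μ (Y ⁻¹' A i) ≤ ENNReal.ofReal (Real.exp (-a)) *
      ∫⁻ ω, (A i).indicator (fun _ => (1 : ENNReal)) (Y ω) *
        ENNReal.ofReal (Real.exp (P N (Y ω))) ∂μ := by
    intro i hiN
    have hiN' : i ≤ N := by simpa [Nat.lt_succ_iff] using hiN
    let F : (ι → ℝ) → ENNReal := fun x =>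
      (A i).indicator (fun _ => (1 : ENNReal)) x * ENNReal.ofReal (Real.exp (P i x))
    let G : (ι → ℝ) → ENNReal := fun x => ENNReal.ofReal (Real.exp (R i x))
    have hF : Measurable F := ((measurable_const.indicator (hA i))).mul
      ((Real.measurable_exp.comp (hP i)).ennreal_ofReal)
    have hG : Measurable G := (Real.measurable_exp.comp (hR i)).ennreal_ofReal
    have hS : Disjoint ((Finset.range i).image k) ((Finset.Ico i N).image k) := by
      rw [Finset.disjoint_left]
      intro y hy hy'
      simp only [Finset.mem_image, Finset.mem_range, Finset.mem_Ico] at hy hy'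
      obtain ⟨p, hp, rfl⟩ := hy
      obtain ⟨q, hq, hqp⟩ := hy'
      have := hk (x₁ := q) (x₂ := p) (by simp; omega) (by simp; omega) hqp
      omega
    have hPc : ∀ i' ≤ i, ∀ x y : ι → ℝ, (∀ z ∈ (Finset.range i).image k, x z = y z) →
        P i' x = P i' y := by
      intro i' hi' x y hxy
      refine Finset.sum_congr rfl fun j hj => ?_
      rw [hxy (k j) (Finset.mem_image_of_mem k ?_)]
      simp at hj ⊢; omega
    have key := lintegral_mul_of_disjoint hm hi _ _ hS F G hF hG
      (fun x y hxy => by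
        have hAxy : x ∈ A i ↔ y ∈ A i := by
          simp only [A, Set.mem_ofPred_eq]
          rw [hPc i le_rfl x y hxy]
          refine and_congr_right fun _ => forall₂_congr fun i' hi' => ?_
          rw [hPc i' hi'.le x y hxy]
        simp only [F]
        rw [hPc i le_rfl x y hxy]
        congr 1
        by_cases hx : x ∈ A i
        · rw [Set.indicator_of_mem hx, Set.indicator_of_mem (hAxy.1 hx)]
        · rw [Set.indicator_of_notMem hx, Set.indicator_of_notMem fun h => hx (hAxy.2 h)])
      (fun x y hxy => by
        simp only [G, R]
        congr 2
        refine Finset.sum_congr rfl fun j hj => ?_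
        rw [hxy (k j) (Finset.mem_image_of_mem k hj)])
    have hG1 : 1 ≤ ∫⁻ ω, G (Y ω) ∂μ := by
      refine one_le_lintegral_exp (X := fun ω => R i (Y ω)) ?_ ?_
      · exact integrable_finsetSum _ fun j _ => (hint (k j)).const_mul _
      · simp only [R, Y]
        rw [integral_finsetSum _ fun j _ => (hint (k j)).const_mul _]
        exact Finset.sum_eq_zero fun j _ => by rw [integral_const_mul, h0, mul_zero]
    have hFG : ∀ ω, F (Y ω) * G (Y ω) = (A i).indicator (fun _ => (1 : ENNReal)) (Y ω) *
        ENNReal.ofReal (Real.exp (P N (Y ω))) := by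
      intro ω
      simp only [F, G]
      rw [mul_assoc, ← ENNReal.ofReal_mul (by positivity), ← Real.exp_add, hPR i hiN']
    calc μ (Y ⁻¹' A i) = ∫⁻ ω, (Y ⁻¹' A i).indicator (fun _ => (1 : ENNReal)) ω ∂μ := by
          rw [lintegral_indicator (hY (hA i))]; simp
      _ ≤ ∫⁻ ω, ENNReal.ofReal (Real.exp (-a)) * F (Y ω) ∂μ := by
          refine lintegral_mono fun ω => ?_
          by_cases hω : Y ω ∈ A i
          · have h1 : a ≤ P i (Y ω) := hω.1
            simp only [Set.indicator, Set.mem_preimage, hω, if_true, F, one_mul]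
            rw [← ENNReal.ofReal_mul (by positivity), ← Real.exp_add, ENNReal.one_le_ofReal]
            exact Real.one_le_exp (by linarith)
          · simp [Set.indicator, hω]
      _ = ENNReal.ofReal (Real.exp (-a)) * ∫⁻ ω, F (Y ω) ∂μ :=
          lintegral_const_mul _ (hF.comp hY)
      _ ≤ ENNReal.ofReal (Real.exp (-a)) * ((∫⁻ ω, F (Y ω) ∂μ) * ∫⁻ ω, G (Y ω) ∂μ) := by
          gcongr
          exact le_mul_of_one_le_right (zero_le) hG1
      _ = ENNReal.ofReal (Real.exp (-a)) * ∫⁻ ω, F (Y ω) * G (Y ω) ∂μ := by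
          rw [← key]
      _ = _ := by simp_rw [hFG]
  calc μ {ω | ∃ i ≤ N, a ≤ P i (Y ω)}
      ≤ ∑ i ∈ Finset.range (N + 1), μ (Y ⁻¹' A i) :=
        (measure_mono hsub).trans (measure_biUnion_finset_le _ _)
    _ ≤ ∑ i ∈ Finset.range (N + 1), ENNReal.ofReal (Real.exp (-a)) *
        ∫⁻ ω, (A i).indicator (fun _ => (1 : ENNReal)) (Y ω) *
          ENNReal.ofReal (Real.exp (P N (Y ω))) ∂μ := Finset.sum_le_sum hstep
    _ = ENNReal.ofReal (Real.exp (-a)) * ∫⁻ ω, ∑ i ∈ Finset.range (N + 1),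
        (A i).indicator (fun _ => (1 : ENNReal)) (Y ω) *
          ENNReal.ofReal (Real.exp (P N (Y ω))) ∂μ := by
        rw [lintegral_finsetSum, Finset.mul_sum]
        intro i _
        exact ((measurable_const.indicator (hA i)).comp hY).mul
          ((Real.measurable_exp.comp ((hP N).comp hY)).ennreal_ofReal)
    _ ≤ ENNReal.ofReal (Real.exp (-a)) * ∫⁻ ω, ENNReal.ofReal (Real.exp (P N (Y ω))) ∂μ := by
        gcongr with ω
        rw [← Finset.sum_mul]
        exact mul_le_of_le_one_left (zero_le) (hdisj _)
    _ ≤ ENNReal.ofReal (Real.exp (-a)) *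
        ENNReal.ofReal (Real.exp (∑ j ∈ Finset.range N, g j)) := by
        gcongr
        have hkN : Set.InjOn k (Finset.range N : Set ℕ) := by simpa using hk
        -- `lintegral_exp_sum_le` is indexed by `ι`, so the weights are carried over by an inverse
        -- of `k`.
        let kinv : ι → ℕ := Function.invFunOn k (Finset.range N : Set ℕ)
        have hkinv : ∀ j ∈ Finset.range N, kinv (k j) = j := fun j hj =>
          hkN.leftInvOn_invFunOn hj
        have := lintegral_exp_sum_le hm hi ((Finset.range N).image k) (fun z => v (kinv z))
          (fun z => g (kinv z)) (by
            intro z hz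
            obtain ⟨j, hj, rfl⟩ := Finset.mem_image.1 hz
            rw [hkinv j hj]
            exact h j (Finset.mem_range.1 hj))
        rw [Finset.sum_image hkN] at this
        simp_rw [Finset.sum_image hkN] at this
        rw [Finset.sum_congr rfl fun j hj => by rw [hkinv j hj]] at this
        refine le_of_eq_of_le ?_ this
        congr 1; ext ω
        congr 2
        exact Finset.sum_congr rfl fun j hj => by rw [hkinv j hj]
    _ = _ := by
        rw [← ENNReal.ofReal_mul (by positivity), ← Real.exp_add]
        congr 2; ring

/-- A tail bound with exponential decay bounds the mean of the positive part. -/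
lemma lintegral_ofReal_le_of_tail {W : Ω → ℝ} (hW : Measurable W) {C κ : ℝ} (hC : 0 ≤ C)
    (hκ : 0 < κ) (h : ∀ t : ℝ, 0 < t → μ {ω | t ≤ W ω} ≤ ENNReal.ofReal (C * Real.exp (-(t / κ)))) :
    ∫⁻ ω, ENNReal.ofReal (W ω) ∂μ ≤ ENNReal.ofReal (C * κ) := by
  have e1 : ∀ ω, ENNReal.ofReal (W ω) = ENNReal.ofReal (max (W ω) 0) := fun ω => by
    simp [ENNReal.ofReal_max]
  simp_rw [e1]
  rw [lintegral_eq_lintegral_meas_le μ (f := fun ω => max (W ω) 0)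
    (Filter.Eventually.of_forall fun ω => le_max_right _ _)
    (hW.max measurable_const).aemeasurable]
  have hint : IntegrableOn (fun t : ℝ => C * Real.exp (-(t / κ))) (Set.Ioi 0) := by
    have := (exp_neg_integrableOn_Ioi 0 (inv_pos.2 hκ)).const_mul C
    refine IntegrableOn.congr_fun this (fun t _ => ?_) measurableSet_Ioi
    rw [show -κ⁻¹ * t = -(t / κ) by field_simp]
  have hval : ∫ t in Set.Ioi (0 : ℝ), C * Real.exp (-(t / κ)) = C * κ := by
    rw [integral_const_mul]
    have h1 := integral_exp_mul_Ioi (a := -κ⁻¹) (by simpa using hκ) 0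
    have h2 : (fun t : ℝ => Real.exp (-(t / κ))) = fun t => Real.exp (-κ⁻¹ * t) := by
      ext t; congr 1; field_simp
    rw [h2, h1]; simp
  calc ∫⁻ t in Set.Ioi 0, μ {ω | t ≤ max (W ω) 0}
      ≤ ∫⁻ t in Set.Ioi 0, ENNReal.ofReal (C * Real.exp (-(t / κ))) := by
        refine setLIntegral_mono (by fun_prop) fun t ht => ?_
        refine le_trans (measure_mono fun ω hω => ?_) (h t ht)
        rcases le_max_iff.1 (show t ≤ max (W ω) 0 from hω) with h | h
        · exact h
        · exact absurd (lt_of_lt_of_le ht h) (lt_irrefl _)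
    _ = ENNReal.ofReal (∫ t in Set.Ioi (0 : ℝ), C * Real.exp (-(t / κ))) := by
        rw [ofReal_integral_eq_lintegral_ofReal hint]
        exact Filter.Eventually.of_forall fun t => by positivity
    _ = _ := by rw [hval]

/-- From a bound on a Lebesgue integral to integrability and a bound on the Bochner integral. -/
lemma integrable_and_integral_le {Z : Ω → ℝ} (hZ : Measurable Z) (h0 : ∀ ω, 0 ≤ Z ω) {C : ℝ}
    (hC : 0 ≤ C) (h : ∫⁻ ω, ENNReal.ofReal (Z ω) ∂μ ≤ ENNReal.ofReal C) :
    Integrable Z μ ∧ ∫ ω, Z ω ∂μ ≤ C := by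
  refine ⟨⟨hZ.aestronglyMeasurable, ?_⟩, ?_⟩
  · rw [hasFiniteIntegral_iff_ofReal (Filter.Eventually.of_forall h0)]
    exact h.trans_lt ENNReal.ofReal_lt_top
  · rw [integral_eq_lintegral_of_nonneg_ae (Filter.Eventually.of_forall h0)
      hZ.aestronglyMeasurable]
    exact ENNReal.toReal_le_of_le_ofReal hC h

end Prob

/-! ### Consequences of the Bernstein bound: moments, the degenerate case, linear forms. -/

section Bernstein

variable {Ω : Type*} [MeasurableSpace Ω] {μ : Measure Ω} [IsProbabilityMeasure μ]
  {X : Ω → ℝ} {σ c : ℝ}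

lemma BernsteinBound.lintegral_le (h : BernsteinBound μ X σ c) {t : ℝ} (ht : |t| * c < 1) :
    ∫⁻ ω, ENNReal.ofReal (Real.exp (t * X ω)) ∂μ ≤
      ENNReal.ofReal (Real.exp (t ^ 2 * σ ^ 2 / (2 * (1 - |t| * c)))) := by
  obtain ⟨h1, h2⟩ := h t ht
  rw [← ofReal_integral_eq_lintegral_ofReal h1
    (Filter.Eventually.of_forall fun ω => (Real.exp_pos _).le)]
  refine ENNReal.ofReal_le_ofReal ?_
  have hpos : 0 < ∫ ω, Real.exp (t * X ω) ∂μ := integral_exp_pos h1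
  rwa [← Real.log_le_iff_le_exp hpos]

lemma exists_pos_mul_lt_one (hc : 0 ≤ c) : ∃ t : ℝ, 0 < t ∧ t * c < 1 := by
  refine ⟨1 / (c + 1), by positivity, ?_⟩
  rw [div_mul_eq_mul_div, div_lt_one (by positivity)]
  linarith

/-- A single admissible `t > 0` is enough: this function dominates multiples of `|X|` and of `X ^
2`. -/
lemma BernsteinBound.integrable_exp_add (h : BernsteinBound μ X σ c) {t : ℝ} (ht0 : 0 < t)
    (ht : t * c < 1) :
    Integrable (fun ω => Real.exp (t * X ω) + Real.exp (-t * X ω)) μ := by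
  refine (h t ?_).1.add (h (-t) ?_).1
  · rwa [abs_of_pos ht0]
  · rwa [abs_neg, abs_of_pos ht0]

lemma abs_le_exp_add (x : ℝ) : |x| ≤ Real.exp x + Real.exp (-x) := by
  rcases abs_cases x with ⟨h, _⟩ | ⟨h, _⟩ <;> rw [h]
  · linarith [Real.add_one_le_exp x, Real.exp_pos (-x)]
  · linarith [Real.add_one_le_exp (-x), Real.exp_pos x]

lemma sq_le_exp_add (x : ℝ) : x ^ 2 ≤ 2 * (Real.exp x + Real.exp (-x)) := by
  have h := Real.quadratic_le_exp_of_nonneg (abs_nonneg x)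
  have h2 : Real.exp |x| ≤ Real.exp x + Real.exp (-x) := by
    rcases abs_cases x with ⟨h, _⟩ | ⟨h, _⟩ <;> rw [h] <;>
      linarith [Real.exp_pos x, Real.exp_pos (-x)]
  rw [sq_abs] at h
  nlinarith [abs_nonneg x]

lemma BernsteinBound.integrable (h : BernsteinBound μ X σ c) (hX : Measurable X) (hc : 0 ≤ c) :
    Integrable X μ := by
  obtain ⟨t, ht0, ht⟩ := exists_pos_mul_lt_one hc
  refine ((h.integrable_exp_add ht0 ht).const_mul t⁻¹).mono hX.aestronglyMeasurable ?_
  refine Filter.Eventually.of_forall fun ω => ?_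
  have h1 := abs_le_exp_add (t * X ω)
  rw [abs_mul, abs_of_pos ht0] at h1
  rw [Real.norm_eq_abs, Real.norm_of_nonneg (by positivity), inv_mul_eq_div, le_div_iff₀ ht0]
  rw [neg_mul]
  linarith

lemma BernsteinBound.integrable_sq (h : BernsteinBound μ X σ c) (hX : Measurable X)
    (hc : 0 ≤ c) : Integrable (fun ω => X ω ^ 2) μ := by
  obtain ⟨t, ht0, ht⟩ := exists_pos_mul_lt_one hc
  refine ((h.integrable_exp_add ht0 ht).const_mul (2 / t ^ 2)).mono
    (hX.pow_const 2).aestronglyMeasurable ?_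
  refine Filter.Eventually.of_forall fun ω => ?_
  have h1 := sq_le_exp_add (t * X ω)
  rw [mul_pow] at h1
  rw [Real.norm_of_nonneg (by positivity), Real.norm_of_nonneg (by positivity),
    div_mul_eq_mul_div, le_div_iff₀ (by positivity), neg_mul]
  linarith

/-- A centered variable satisfying the Bernstein bound with `σ = 0` vanishes almost surely. -/
lemma BernsteinBound.ae_eq_zero (h : BernsteinBound μ X 0 c) (hX : Measurable X)
    (hc : 0 ≤ c) (h0 : ∫ ω, X ω ∂μ = 0) : ∀ᵐ ω ∂μ, X ω = 0 := by
  obtain ⟨t, ht0, ht⟩ := exists_pos_mul_lt_one hc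
  obtain ⟨h1, h2⟩ := h t (by rwa [abs_of_pos ht0])
  have hXi := h.integrable hX hc
  -- With `σ = 0` the Laplace transform is at most one, so the nonnegative variable `exp (t X) - t X
  -- - 1` has mean at most zero and vanishes almost surely; it is zero only where `X = 0`.
  have hi : Integrable (fun ω => Real.exp (t * X ω) - (t * X ω + 1)) μ :=
    h1.sub ((hXi.const_mul t).add (integrable_const _))
  have hle : ∫ ω, (Real.exp (t * X ω) - (t * X ω + 1)) ∂μ ≤ 0 := by
    have hX1 : Integrable (fun ω => t * X ω + 1) μ := (hXi.const_mul t).add (integrable_const _)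
    rw [integral_sub h1 hX1, integral_add (hXi.const_mul t) (integrable_const _),
      integral_const_mul, h0]
    have hpos : 0 < ∫ ω, Real.exp (t * X ω) ∂μ := integral_exp_pos h1
    rw [Real.log_le_iff_le_exp hpos] at h2
    simp at h2 ⊢
    linarith
  have hnn : ∀ ω, 0 ≤ Real.exp (t * X ω) - (t * X ω + 1) := fun ω => by
    linarith [Real.add_one_le_exp (t * X ω)]
  have hz := (integral_eq_zero_iff_of_nonneg hnn hi).1
    (le_antisymm hle (integral_nonneg hnn))
  filter_upwards [hz] with ω hω
  by_contra hne
  have := Real.add_one_lt_exp (mul_ne_zero ht0.ne' hne)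
  simp only [Pi.zero_apply] at hω
  linarith

/-- The Laplace transform of a linear form in independent Bernstein variables. -/
lemma lintegral_exp_linear_le {ι : Type*} {ξ : ι → Ω → ℝ} (hm : ∀ i, Measurable (ξ i))
    (hi : iIndepFun ξ μ) (hc : 0 ≤ c) (hb : ∀ i, BernsteinBound μ (ξ i) σ c) (s : Finset ι)
    (t : ι → ℝ) {τ : ℝ} (ht : ∀ i ∈ s, |t i| ≤ τ) (hτ : τ * c < 1) :
    ∫⁻ ω, ENNReal.ofReal (Real.exp (∑ i ∈ s, t i * ξ i ω)) ∂μ ≤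
      ENNReal.ofReal (Real.exp (σ ^ 2 * (∑ i ∈ s, t i ^ 2) / (2 * (1 - τ * c)))) := by
  have h := lintegral_exp_sum_le hm hi s t (fun i => t i ^ 2 * σ ^ 2 / (2 * (1 - τ * c))) (by
    intro i his
    have h1 : |t i| * c ≤ τ * c := mul_le_mul_of_nonneg_right (ht i his) hc
    refine ((hb i).lintegral_le (h1.trans_lt hτ)).trans ?_
    refine ENNReal.ofReal_le_ofReal (Real.exp_le_exp.2 ?_)
    have : 0 < 1 - τ * c := by linarith
    gcongr)
  refine h.trans_eq ?_
  rw [← Finset.sum_div, ← Finset.sum_mul, mul_comm]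

end Bernstein

/-! ### Projections on histogram spaces and the decomposition of the criterion. -/

section Geometry

open scoped InnerProductSpace

variable {n : ℕ}

lemma lsEst_mem (m : Finpartition (Finset.univ : Finset (Fin n)))
    (y : EuclideanSpace ℝ (Fin n)) : lsEst m y ∈ histSpace m :=
  Submodule.coe_mem _

lemma inner_sub_lsEst (m : Finpartition (Finset.univ : Finset (Fin n)))
    (y : EuclideanSpace ℝ (Fin n)) {t : EuclideanSpace ℝ (Fin n)} (ht : t ∈ histSpace m) :
    ⟪y - lsEst m y, t⟫_ℝ = 0 :=
  Submodule.starProjection_inner_eq_zero y t ht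

lemma lsEst_add (m : Finpartition (Finset.univ : Finset (Fin n)))
    (x y : EuclideanSpace ℝ (Fin n)) : lsEst m (x + y) = lsEst m x + lsEst m y :=
  map_add _ _ _

lemma lsEst_lsEst_of_le {m m₀ : Finpartition (Finset.univ : Finset (Fin n))}
    (h : histSpace m ≤ histSpace m₀) (y : EuclideanSpace ℝ (Fin n)) :
    lsEst m (lsEst m₀ y) = lsEst m y := by
  refine Submodule.eq_starProjection_of_mem_of_inner_eq_zero (lsEst_mem m y) fun w hw => ?_
  have h1 := inner_sub_lsEst m y hw
  have h2 := inner_sub_lsEst m₀ y (h hw)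
  rw [inner_sub_left] at *
  linarith

lemma norm_lsEst_le (m : Finpartition (Finset.univ : Finset (Fin n)))
    (y : EuclideanSpace ℝ (Fin n)) : ‖lsEst m y‖ ≤ ‖y‖ :=
  Submodule.norm_starProjection_apply_le _ _

lemma continuous_lsEst (m : Finpartition (Finset.univ : Finset (Fin n))) :
    Continuous (lsEst m) :=
  ContinuousLinearMap.continuous _

/-- Orthogonality of the residual to the indicator of a block identifies the projection with the
block average. -/
lemma lsEst_apply (m : Finpartition (Finset.univ : Finset (Fin n)))
    (y : EuclideanSpace ℝ (Fin n)) {I : Finset (Fin n)} (hI : I ∈ m.parts) {i : Fin n}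
    (hi : i ∈ I) : lsEst m y i = (∑ j ∈ I, y j) / I.card := by
  have hcard : (0 : ℝ) < I.card := by exact_mod_cast Finset.card_pos.2 ⟨i, hi⟩
  let t : EuclideanSpace ℝ (Fin n) := WithLp.toLp 2 fun j => if j ∈ I then 1 else 0
  have ht : t ∈ histSpace m := by
    intro J hJ a ha b hb
    by_cases hJI : J = I
    · subst hJI; simp [t, ha, hb]
    · have hd : Disjoint J I := m.disjoint hJ hI hJI
      simp [t, Finset.disjoint_left.1 hd ha, Finset.disjoint_left.1 hd hb]
  have h := inner_sub_lsEst m y ht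
  have hconst : ∀ j ∈ I, lsEst m y j = lsEst m y i := fun j hj => lsEst_mem m y I hI j hj i hi
  rw [PiLp.inner_apply] at h
  simp only [t, PiLp.sub_apply, RCLike.inner_apply, conj_trivial, ite_mul, one_mul, zero_mul,
    Finset.sum_ite_mem, Finset.univ_inter, Finset.sum_sub_distrib] at h
  rw [Finset.sum_congr rfl hconst, Finset.sum_const, nsmul_eq_mul] at h
  field_simp
  linarith

lemma sum_parts (m : Finpartition (Finset.univ : Finset (Fin n))) (F : Fin n → ℝ) :
    ∑ I ∈ m.parts, ∑ i ∈ I, F i = ∑ i, F i := by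
  rw [← Finset.sum_biUnion]
  · rw [show m.parts.biUnion (fun I => I) = Finset.univ from m.biUnion_parts]
  · exact fun I hI J hJ h => m.disjoint hI hJ h

/-- The residual of the mean signal after projection on a coarser histogram space. -/
def resid (m₀ m : Finpartition (Finset.univ : Finset (Fin n)))
    (f : EuclideanSpace ℝ (Fin n)) : EuclideanSpace ℝ (Fin n) :=
  lsEst m₀ f - lsEst m f

lemma resid_mem {m₀ m : Finpartition (Finset.univ : Finset (Fin n))}
    (h : histSpace m ≤ histSpace m₀) (f : EuclideanSpace ℝ (Fin n)) :
    resid m₀ m f ∈ histSpace m₀ :=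
  Submodule.sub_mem _ (lsEst_mem m₀ f) (h (lsEst_mem m f))

lemma inner_resid {m₀ m : Finpartition (Finset.univ : Finset (Fin n))}
    (h : histSpace m ≤ histSpace m₀) (f : EuclideanSpace ℝ (Fin n))
    {t : EuclideanSpace ℝ (Fin n)} (ht : t ∈ histSpace m) : ⟪resid m₀ m f, t⟫_ℝ = 0 := by
  have := inner_sub_lsEst m (lsEst m₀ f) ht
  rwa [lsEst_lsEst_of_le h] at this

/-- The three pieces are pairwise orthogonal: the first is orthogonal to `histSpace m₀`, which
contains the other two, and `resid` is orthogonal to `histSpace m`. -/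
lemma norm_sq_sub_lsEst_add {m₀ m : Finpartition (Finset.univ : Finset (Fin n))}
    (h : histSpace m ≤ histSpace m₀) (f x : EuclideanSpace ℝ (Fin n)) :
    ‖f - lsEst m (f + x)‖ ^ 2 =
      ‖f - lsEst m₀ f‖ ^ 2 + ‖resid m₀ m f‖ ^ 2 + ‖lsEst m x‖ ^ 2 := by
  have e : f - lsEst m (f + x) = (f - lsEst m₀ f) + resid m₀ m f - lsEst m x := by
    rw [lsEst_add, resid]; abel
  have h1 := inner_sub_lsEst m₀ f (resid_mem h f)
  have h2 := inner_sub_lsEst m₀ f (h (lsEst_mem m x))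
  have h3 := inner_resid h f (lsEst_mem m x)
  rw [e, norm_sub_sq_real, norm_add_sq_real, inner_add_left, h1, h2, h3]
  ring

/-- Whatever stands outside the parentheses is free of `m` and cancels when two values of the
criterion are compared. -/
lemma crit_add {m₀ m : Finpartition (Finset.univ : Finset (Fin n))}
    (h : histSpace m ≤ histSpace m₀)
    (pen : Finpartition (Finset.univ : Finset (Fin n)) → ℝ) (f x : EuclideanSpace ℝ (Fin n)) :
    crit pen (f + x) m = ‖f - lsEst m₀ f‖ ^ 2 + 2 * ⟪f - lsEst m₀ f, x⟫_ℝ + ‖x‖ ^ 2 +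
      (‖resid m₀ m f‖ ^ 2 + 2 * ⟪resid m₀ m f, x⟫_ℝ - ‖lsEst m x‖ ^ 2 + pen m) := by
  have e : f + x - lsEst m (f + x) = (f - lsEst m₀ f) + resid m₀ m f + (x - lsEst m x) := by
    rw [lsEst_add, resid]; abel
  have h1 := inner_sub_lsEst m₀ f (resid_mem h f)
  have h2 := inner_sub_lsEst m₀ f (h (lsEst_mem m x))
  have h3 := inner_resid h f (lsEst_mem m x)
  have h4 := inner_sub_lsEst m x (lsEst_mem m x)
  rw [inner_sub_left, real_inner_self_eq_norm_sq] at h4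
  rw [crit, e, norm_add_sq_real, norm_add_sq_real, norm_sub_sq_real x (lsEst m x),
    inner_add_left, inner_sub_right, inner_sub_right, h1, h2, h3]
  linarith

/-- The excess controlled by the penalty. -/
def excess (m₀ : Finpartition (Finset.univ : Finset (Fin n)))
    (pen : Finpartition (Finset.univ : Finset (Fin n)) → ℝ) (f : EuclideanSpace ℝ (Fin n))
    (θ : ℝ) (x : EuclideanSpace ℝ (Fin n)) (m : Finpartition (Finset.univ : Finset (Fin n))) : ℝ :=
  (2 - θ) * ‖lsEst m x‖ ^ 2 - 2 * ⟪resid m₀ m f, x⟫_ℝ - θ * ‖resid m₀ m f‖ ^ 2 - pen m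

/-- The criterion controls `|r|² + 2⟨r, x⟩ - |χ|² + pen`, where `χ` is the projected noise. Passing
to the loss `|r|² + |χ|²` at `m'` costs `2|χ|² - 2⟨r, x⟩ - pen`; giving up the fraction `θ` of the
loss lowers this cost to `excess`. -/
lemma loss_le_of_crit_le {m₀ m m' : Finpartition (Finset.univ : Finset (Fin n))}
    (h : histSpace m ≤ histSpace m₀) (h' : histSpace m' ≤ histSpace m₀)
    (pen : Finpartition (Finset.univ : Finset (Fin n)) → ℝ) (f x : EuclideanSpace ℝ (Fin n))
    (hcrit : crit pen (f + x) m' ≤ crit pen (f + x) m) (θ : ℝ) :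
    (1 - θ) * (‖resid m₀ m' f‖ ^ 2 + ‖lsEst m' x‖ ^ 2) ≤
      ‖resid m₀ m f‖ ^ 2 + 2 * ⟪resid m₀ m f, x⟫_ℝ - ‖lsEst m x‖ ^ 2 + pen m +
        excess m₀ pen f θ x m' := by
  rw [crit_add h, crit_add h'] at hcrit
  rw [excess]
  linarith

end Geometry

/-! ### Reduction of the oracle inequality to a uniform bound on the excesses. -/

section Oracle

open scoped InnerProductSpace

variable {Ω : Type*} [MeasurableSpace Ω] {μ : Measure Ω} [IsProbabilityMeasure μ] {n : ℕ}

/-- The noise vector. -/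
def noise (ξ : Fin n → Ω → ℝ) (ω : Ω) : EuclideanSpace ℝ (Fin n) :=
  WithLp.toLp 2 fun i => ξ i ω

lemma measurable_noise {ξ : Fin n → Ω → ℝ} (hm : ∀ i, Measurable (ξ i)) :
    Measurable (noise ξ) :=
  (WithLp.measurable_toLp 2 _).comp (measurable_pi_lambda _ hm)

lemma norm_sq_noise (ξ : Fin n → Ω → ℝ) (ω : Ω) : ‖noise ξ ω‖ ^ 2 = ∑ i, ξ i ω ^ 2 := by
  rw [EuclideanSpace.norm_sq_eq]
  simp [noise]

lemma inner_noise (ξ : Fin n → Ω → ℝ) (ω : Ω) (t : EuclideanSpace ℝ (Fin n)) :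
    ⟪t, noise ξ ω⟫_ℝ = ∑ i, t i * ξ i ω := by
  rw [PiLp.inner_apply]
  simp [noise, mul_comm]

lemma integrable_norm_lsEst_noise_sq {ξ : Fin n → Ω → ℝ} (hm : ∀ i, Measurable (ξ i))
    (h2 : ∀ i, Integrable (fun ω => ξ i ω ^ 2) μ)
    (m : Finpartition (Finset.univ : Finset (Fin n))) :
    Integrable (fun ω => ‖lsEst m (noise ξ ω)‖ ^ 2) μ := by
  have hi : Integrable (fun ω => ‖noise ξ ω‖ ^ 2) μ := by
    simp_rw [norm_sq_noise]
    exact integrable_finsetSum _ fun i _ => h2 i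
  refine hi.mono ?_ (Filter.Eventually.of_forall fun ω => ?_)
  · exact (((continuous_lsEst m).measurable.comp (measurable_noise hm)).norm.pow_const
      2).aestronglyMeasurable
  · rw [Real.norm_of_nonneg (by positivity), Real.norm_of_nonneg (by positivity)]
    have := norm_lsEst_le m (noise ξ ω)
    gcongr

/-- The oracle inequality follows from a bound on the mean of the largest excess. -/
theorem oracle_of_excess_le (f : EuclideanSpace ℝ (Fin n)) {ξ : Fin n → Ω → ℝ}
    (hm : ∀ i, Measurable (ξ i)) (h1 : ∀ i, Integrable (ξ i) μ) (h0 : ∀ i, ∫ ω, ξ i ω ∂μ = 0)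
    (h2 : ∀ i, Integrable (fun ω => ξ i ω ^ 2) μ)
    (m₀ : Finpartition (Finset.univ : Finset (Fin n)))
    (M : Finset (Finpartition (Finset.univ : Finset (Fin n)))) (hM : M.Nonempty)
    (hM_sub : ∀ m ∈ M, histSpace m ≤ histSpace m₀)
    (pen : Finpartition (Finset.univ : Finset (Fin n)) → ℝ) (hpen : ∀ m ∈ M, 0 ≤ pen m)
    (mhat : Ω → Finpartition (Finset.univ : Finset (Fin n)))
    (hmeas : ∀ m, MeasurableSet {ω | mhat ω = m}) (hmem : ∀ ω, mhat ω ∈ M)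
    (hmin : ∀ ω, ∀ m ∈ M, crit pen (obs f ξ ω) (mhat ω) ≤ crit pen (obs f ξ ω) m)
    {θ C R : ℝ} (hθ : θ < 1) (hC : 1 ≤ C * (1 - θ)) (hC1 : 1 ≤ C) (hR : 0 ≤ R) (Z : Ω → ℝ)
    (hZ : Integrable Z μ) (hZR : ∫ ω, Z ω ∂μ ≤ R)
    (hex : ∀ m ∈ M, ∀ᵐ ω ∂μ, excess m₀ pen f θ (noise ξ ω) m ≤ Z ω) :
    (∀ m ∈ M, Integrable (fun ω => ‖f - lsEst m (obs f ξ ω)‖ ^ 2) μ) ∧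
    Integrable (fun ω => ‖f - lsEst (mhat ω) (obs f ξ ω)‖ ^ 2) μ ∧
    (∫ ω, ‖f - lsEst (mhat ω) (obs f ξ ω)‖ ^ 2 ∂μ) ≤
      C * (M.inf' hM (fun m => (∫ ω, ‖f - lsEst m (obs f ξ ω)‖ ^ 2 ∂μ) + pen m) + R) := by
  have hobs : ∀ ω, obs f ξ ω = f + noise ξ ω := fun ω => rfl
  have hχ := integrable_norm_lsEst_noise_sq (μ := μ) hm h2
  have hloss : ∀ m ∈ M, ∀ ω, ‖f - lsEst m (obs f ξ ω)‖ ^ 2 =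
      ‖f - lsEst m₀ f‖ ^ 2 + ‖resid m₀ m f‖ ^ 2 + ‖lsEst m (noise ξ ω)‖ ^ 2 :=
    fun m hm ω => by rw [hobs, norm_sq_sub_lsEst_add (hM_sub m hm)]
  have hI1 : ∀ m ∈ M, Integrable (fun ω => ‖f - lsEst m (obs f ξ ω)‖ ^ 2) μ := by
    intro m hmM
    simp_rw [hloss m hmM]
    exact (integrable_const _).add (hχ m)
  -- The selected partition takes finitely many values, so any quantity evaluated at it is a finite
  -- sum of indicators.
  have hsel : ∀ (G : Finpartition (Finset.univ : Finset (Fin n)) → Ω → ℝ) (ω : Ω),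
      G (mhat ω) ω = ∑ m ∈ M, {ω | mhat ω = m}.indicator (G m) ω := by
    intro G ω
    rw [Finset.sum_eq_single_of_mem (mhat ω) (hmem ω)]
    · rw [Set.indicator_of_mem]; rfl
    · intro m _ hne
      exact Set.indicator_of_notMem (fun h => hne h.symm) _
  have hI2 : Integrable (fun ω => ‖f - lsEst (mhat ω) (obs f ξ ω)‖ ^ 2) μ := by
    have := fun ω => hsel (fun m ω => ‖f - lsEst m (obs f ξ ω)‖ ^ 2) ω
    simp_rw [this]
    exact integrable_finsetSum _ fun m hmM => (hI1 m hmM).indicator (hmeas m)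
  refine ⟨hI1, hI2, ?_⟩
  have hCpos : 0 ≤ C := by linarith
  obtain ⟨m, hmM, hmin'⟩ := M.exists_mem_eq_inf' hM
    (fun m => (∫ ω, ‖f - lsEst m (obs f ξ ω)‖ ^ 2 ∂μ) + pen m)
  rw [hmin']
  -- The bias `d` of `m₀` is part of every loss. It is removed before dividing by `1 - θ` and
  -- restored at the end thanks to `1 ≤ C`.
  set d : ℝ := ‖f - lsEst m₀ f‖ ^ 2 with hd
  have hd0 : 0 ≤ d := by positivity
  have hEloss : ∫ ω, ‖f - lsEst m (obs f ξ ω)‖ ^ 2 ∂μ =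
      d + ‖resid m₀ m f‖ ^ 2 + ∫ ω, ‖lsEst m (noise ξ ω)‖ ^ 2 ∂μ := by
    simp_rw [hloss m hmM]
    rw [integral_add (integrable_const _) (hχ m)]
    simp [hd]
  have hlin : Integrable (fun ω => ⟪resid m₀ m f, noise ξ ω⟫_ℝ) μ := by
    simp_rw [inner_noise]
    exact integrable_finsetSum _ fun i _ => (h1 i).const_mul _
  have hlin0 : ∫ ω, ⟪resid m₀ m f, noise ξ ω⟫_ℝ ∂μ = 0 := by
    simp_rw [inner_noise]
    rw [integral_finsetSum _ fun i _ => (h1 i).const_mul _]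
    exact Finset.sum_eq_zero fun i _ => by rw [integral_const_mul, h0, mul_zero]
  have hle : ∀ᵐ ω ∂μ, (1 - θ) * (‖f - lsEst (mhat ω) (obs f ξ ω)‖ ^ 2 - d) ≤
      (‖resid m₀ m f‖ ^ 2 + pen m) + 2 * ⟪resid m₀ m f, noise ξ ω⟫_ℝ + Z ω := by
    have hex' : ∀ᵐ ω ∂μ, ∀ m ∈ M, excess m₀ pen f θ (noise ξ ω) m ≤ Z ω :=
      (Filter.eventually_all_finset M).2 hex
    filter_upwards [hex'] with ω hω
    have h3 := loss_le_of_crit_le (hM_sub m hmM) (hM_sub _ (hmem ω)) pen f (noise ξ ω)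
      (hmin ω m hmM) θ
    have h4 := hω _ (hmem ω)
    rw [hloss _ (hmem ω)]
    have h5 : 0 ≤ ‖lsEst m (noise ξ ω)‖ ^ 2 := by positivity
    have h6 : d + ‖resid m₀ (mhat ω) f‖ ^ 2 + ‖lsEst (mhat ω) (noise ξ ω)‖ ^ 2 - d =
      ‖resid m₀ (mhat ω) f‖ ^ 2 + ‖lsEst (mhat ω) (noise ξ ω)‖ ^ 2 := by ring
    rw [h6]
    linarith
  have hE := integral_mono_ae ((hI2.sub (integrable_const d)).const_mul (1 - θ))
    (((integrable_const (‖resid m₀ m f‖ ^ 2 + pen m)).add (hlin.const_mul 2)).add hZ) hle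
  have e1 : ∫ ω, (1 - θ) * (‖f - lsEst (mhat ω) (obs f ξ ω)‖ ^ 2 - d) ∂μ =
      (1 - θ) * ((∫ ω, ‖f - lsEst (mhat ω) (obs f ξ ω)‖ ^ 2 ∂μ) - d) := by
    rw [integral_const_mul, integral_sub hI2 (integrable_const _)]
    simp
  have e2 : ∫ ω, ((‖resid m₀ m f‖ ^ 2 + pen m) + 2 * ⟪resid m₀ m f, noise ξ ω⟫_ℝ + Z ω) ∂μ =
      (‖resid m₀ m f‖ ^ 2 + pen m) + ∫ ω, Z ω ∂μ := by
    have hAB : Integrable (fun ω => (‖resid m₀ m f‖ ^ 2 + pen m) +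
        2 * ⟪resid m₀ m f, noise ξ ω⟫_ℝ) μ := (integrable_const _).add (hlin.const_mul 2)
    rw [integral_add hAB hZ,
      integral_add (integrable_const _) (hlin.const_mul 2), integral_const_mul, hlin0]
    simp
  have hE' : (1 - θ) * ((∫ ω, ‖f - lsEst (mhat ω) (obs f ξ ω)‖ ^ 2 ∂μ) - d) ≤
      (‖resid m₀ m f‖ ^ 2 + pen m) + ∫ ω, Z ω ∂μ := by
    rw [← e1, ← e2]; exact hE
  have hχ0 : 0 ≤ ∫ ω, ‖lsEst m (noise ξ ω)‖ ^ 2 ∂μ := integral_nonneg fun ω => by positivity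
  have hA : 0 ≤ ‖resid m₀ m f‖ ^ 2 + pen m + R := by
    have := hpen m hmM
    positivity
  set N := ∫ ω, ‖f - lsEst (mhat ω) (obs f ξ ω)‖ ^ 2 ∂μ
  rw [hEloss]
  have hfin : N - d ≤ C * (‖resid m₀ m f‖ ^ 2 + pen m + R) := by
    have h7 : (1 - θ) * (N - d) ≤ ‖resid m₀ m f‖ ^ 2 + pen m + R := by linarith
    have h8 : N - d ≤ (‖resid m₀ m f‖ ^ 2 + pen m + R) / (1 - θ) := by
      rw [le_div_iff₀ (by linarith)]; linarith
    refine h8.trans ?_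
    rw [div_le_iff₀ (by linarith)]
    nlinarith
  nlinarith [mul_nonneg hCpos hχ0]

end Oracle

/-! ### Exponential integrals over symmetric convex bodies. -/

section Volume

variable {V : Type*} [NormedAddCommGroup V] [NormedSpace ℝ V] [FiniteDimensional ℝ V]
  [MeasurableSpace V] [BorelSpace V] (ν : Measure V) [ν.IsAddHaarMeasure]

/-- The mean of an exponential over a symmetric set is at least one. -/
lemma measure_le_lintegral_exp_of_symm {A : Set V} (hA : MeasurableSet A)
    (hsymm : ∀ t ∈ A, -t ∈ A) (L : V →L[ℝ] ℝ) :
    ν A ≤ ∫⁻ t, A.indicator (fun t => ENNReal.ofReal (Real.exp (L t))) t ∂ν := by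
  have hmeas : Measurable (fun t => A.indicator (fun t => ENNReal.ofReal (Real.exp (L t))) t) :=
    (by fun_prop : Measurable fun t => ENNReal.ofReal (Real.exp (L t))).indicator hA
  set J := ∫⁻ t, A.indicator (fun t => ENNReal.ofReal (Real.exp (L t))) t ∂ν with hJ
  -- Averaging over `t` and `-t` replaces the exponential by its even part, which is at least one.
  have h1 : ∫⁻ t, A.indicator (fun t => ENNReal.ofReal (Real.exp (L t))) (-t) ∂ν = J :=
    lintegral_neg_eq_self (μ := ν) _
  have h2 : 2 * ν A ≤ 2 * J := by
    calc 2 * ν A = ∫⁻ t, A.indicator (fun _ => (2 : ENNReal)) t ∂ν := by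
          rw [lintegral_indicator hA]; simp
      _ ≤ ∫⁻ t, (A.indicator (fun t => ENNReal.ofReal (Real.exp (L t))) t +
          A.indicator (fun t => ENNReal.ofReal (Real.exp (L t))) (-t)) ∂ν := by
          refine lintegral_mono fun t => ?_
          by_cases ht : t ∈ A
          · simp only [Set.indicator_of_mem ht, Set.indicator_of_mem (hsymm t ht), map_neg]
            rw [← ENNReal.ofReal_add (by positivity) (by positivity),
              show (2 : ENNReal) = ENNReal.ofReal 2 by simp]
            refine ENNReal.ofReal_le_ofReal ?_
            linarith [Real.add_one_le_exp (L t), Real.add_one_le_exp (-L t)]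
          · simp [Set.indicator_of_notMem ht]
      _ = 2 * J := by rw [lintegral_add_left hmeas, h1, two_mul]
  exact (ENNReal.mul_le_mul_iff_right (by simp) (by simp)).1 h2

/-- The Laplace transform of a symmetric convex body is large in the directions of its points. -/
lemma measure_mul_exp_le_lintegral_exp {A : Set V} (hA : MeasurableSet A) (hconv : Convex ℝ A)
    (hsymm : ∀ t ∈ A, -t ∈ A) (L : V →L[ℝ] ℝ) {v : V} (hv : v ∈ A) {ε : ℝ} (hε : 0 < ε)
    (hε1 : ε ≤ 1) :
    ENNReal.ofReal (ε ^ Module.finrank ℝ V * Real.exp ((1 - ε) * L v)) * ν A ≤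
      ∫⁻ t, A.indicator (fun t => ENNReal.ofReal (Real.exp (L t))) t ∂ν := by
  set h : V → ENNReal := fun t => A.indicator (fun t => ENNReal.ofReal (Real.exp (L t))) t
    with hh
  have hmeas : Measurable h :=
    (by fun_prop : Measurable fun t => ENNReal.ofReal (Real.exp (L t))).indicator hA
  set D := Module.finrank ℝ V
  -- By convexity `A` contains `p + ε A`, whose volume is `ε ^ D` times that of `A`. On this copy
  -- `L` equals `(1 - ε) L v` plus the values of `ε L` on a symmetric set.
  set p := (1 - ε) • v
  have hpow : 0 < ε ^ D := by positivity
  have h1 : ∫⁻ t, h (p + ε • t) ∂ν = ENNReal.ofReal ((ε ^ D)⁻¹) * ∫⁻ t, h t ∂ν := by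
    have e1 : ∫⁻ t, h (p + ε • t) ∂ν = ∫⁻ t, h (p + t) ∂(Measure.map (ε • ·) ν) := by
      exact (lintegral_map (f := fun t => h (p + t)) (hmeas.comp (measurable_const_add p))
        (measurable_const_smul ε)).symm
    rw [e1, Measure.map_addHaar_smul ν hε.ne', lintegral_smul_measure,
      lintegral_add_left_eq_self, abs_of_pos (by positivity), smul_eq_mul]
  have h2 : ENNReal.ofReal (Real.exp ((1 - ε) * L v)) * ν A ≤ ∫⁻ t, h (p + ε • t) ∂ν := by
    refine (mul_le_mul_right (measure_le_lintegral_exp_of_symm ν hA hsymm (ε • L)) _).trans ?_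
    rw [← lintegral_const_mul']
    swap
    · simp
    refine lintegral_mono fun t => ?_
    by_cases ht : t ∈ A
    · have hm : p + ε • t ∈ A := hconv hv ht (by linarith) hε.le (by ring)
      simp only [hh, Set.indicator_of_mem ht, Set.indicator_of_mem hm]
      rw [← ENNReal.ofReal_mul (by positivity), ← Real.exp_add]
      simp [p]
    · simp [Set.indicator_of_notMem ht]
  rw [h1] at h2
  rw [ENNReal.ofReal_mul hpow.le, mul_assoc]
  calc ENNReal.ofReal (ε ^ D) * (ENNReal.ofReal (Real.exp ((1 - ε) * L v)) * ν A)
      ≤ ENNReal.ofReal (ε ^ D) * (ENNReal.ofReal ((ε ^ D)⁻¹) * ∫⁻ t, h t ∂ν) := by gcongr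
    _ = ∫⁻ t, h t ∂ν := by
        rw [← mul_assoc, ← ENNReal.ofReal_mul hpow.le, mul_inv_cancel₀ hpow.ne']; simp

end Volume

/-! ### Deviations of the norm of the projected noise. -/

section ChiSquare

open scoped InnerProductSpace

variable {Ω : Type*} [MeasurableSpace Ω] {μ : Measure Ω} [IsProbabilityMeasure μ] {n : ℕ}

/-- A vector of the space is determined by its value at one chosen point of each block. -/
lemma finrank_histSpace_le (m : Finpartition (Finset.univ : Finset (Fin n))) :
    Module.finrank ℝ (histSpace m) ≤ m.parts.card := by
  let e : histSpace m →ₗ[ℝ] (m.parts → ℝ) :=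
    { toFun := fun x I => x.1 (m.nonempty_of_mem_parts I.2).choose
      map_add' := fun x y => by ext I; simp
      map_smul' := fun r x => by ext I; simp }
  have he : Function.Injective e := by
    rw [← LinearMap.ker_eq_bot, LinearMap.ker_eq_bot']
    intro x hx
    ext i
    have hI := m.part_mem.2 (Finset.mem_univ i)
    have h1 := congrFun hx ⟨_, hI⟩
    have h2 := x.2 _ hI i (m.mem_part (Finset.mem_univ i)) _
      (m.nonempty_of_mem_parts hI).choose_spec
    rw [h2]
    exact h1
  have := LinearMap.finrank_le_finrank_of_injective he
  simpa using this

/-- Deviations of the norm of a projection of the noise on the event where its coordinates are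
bounded. -/
lemma measure_norm_lsEst_ge_le {ξ : Fin n → Ω → ℝ} (hm : ∀ i, Measurable (ξ i))
    (hi : iIndepFun ξ μ) {σ c : ℝ} (hσ : 0 < σ) (hc : 0 ≤ c)
    (hb : ∀ i, BernsteinBound μ (ξ i) σ c) (m : Finpartition (Finset.univ : Finset (Fin n)))
    {u y z : ℝ} (hu : 0 < u) (hy : 0 < y) (hz : 0 < z)
    (hzy : 18 * (9 * σ ^ 2 + c * u) * y ≤ z ^ 2) :
    μ {ω | z ≤ ‖lsEst m (noise ξ ω)‖ ∧ ∀ i, |lsEst m (noise ξ ω) i| ≤ 5 * u} ≤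
      ENNReal.ofReal (Real.exp (1.4 * m.parts.card - 2 * y)) := by
  set Q := 9 * σ ^ 2 + c * u with hQ
  have hQ0 : 0 < Q := by positivity
  -- `R` is chosen so that the linear form is at least `R z = 3 y` at the point `v` below, and `ρ`
  -- bounds the coordinates of that `v` when those of the projection are at most `5 u`.
  set R := 3 * y / z with hR
  set ρ := 5 * u * R / z with hρ
  have hR0 : 0 < R := by positivity
  have hρ0 : 0 < ρ := by positivity
  set V := histSpace m
  set D := Module.finrank ℝ V with hD
  -- The uniform law on this body acts as a prior. The constraint on coordinates forces `ρ c ≤ 5 /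
  -- 6`, which keeps the Laplace transforms of the noise under control.
  let A : Set V := {t | ‖t‖ ≤ R ∧ ∀ i, |t.1 i| ≤ ρ}
  have hcoord : ∀ i, Continuous fun t : V => t.1 i := fun i =>
    ((PiLp.continuous_apply 2 _ i).comp continuous_subtype_val)
  have hAclosed : IsClosed A := by
    have : A = {t : V | ‖t‖ ≤ R} ∩ ⋂ i, {t : V | |t.1 i| ≤ ρ} := by ext t; simp [A]
    rw [this]
    exact (isClosed_le continuous_norm continuous_const).inter
      (isClosed_iInter fun i => isClosed_le (hcoord i).abs continuous_const)
  have hAm : MeasurableSet A := hAclosed.measurableSet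
  have hAconv : Convex ℝ A := by
    intro x hx y hy p q hp hq hpq
    refine ⟨?_, fun i => ?_⟩
    · calc ‖p • x + q • y‖ ≤ p * ‖x‖ + q * ‖y‖ := by
            refine (norm_add_le _ _).trans (le_of_eq ?_)
            rw [norm_smul, norm_smul, Real.norm_of_nonneg hp, Real.norm_of_nonneg hq]
        _ ≤ p * R + q * R := by gcongr; exacts [hx.1, hy.1]
        _ = R := by rw [← add_mul, hpq, one_mul]
    · calc |(p • x + q • y).1 i| = |p * x.1 i + q * y.1 i| := by simp
        _ ≤ p * |x.1 i| + q * |y.1 i| := by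
            refine (abs_add_le _ _).trans (le_of_eq ?_)
            rw [abs_mul, abs_mul, abs_of_nonneg hp, abs_of_nonneg hq]
        _ ≤ p * ρ + q * ρ := by gcongr; exacts [hx.2 i, hy.2 i]
        _ = ρ := by rw [← add_mul, hpq, one_mul]
  have hAsymm : ∀ t ∈ A, -t ∈ A := fun t ht => ⟨by simpa using ht.1, fun i => by
    simpa using ht.2 i⟩
  have hApos : 0 < (volume : Measure V) A := by
    refine lt_of_lt_of_le (Metric.measure_ball_pos volume (0 : V) (lt_min hR0 hρ0))
      (measure_mono fun t ht => ?_)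
    have h1 : ‖t‖ < min R ρ := by simpa using ht
    refine ⟨(h1.trans_le (min_le_left _ _)).le, fun i => ?_⟩
    refine le_trans ?_ (h1.trans_le (min_le_right _ _)).le
    simpa using PiLp.norm_apply_le (p := 2) t.1 i
  have hAfin : (volume : Measure V) A < ⊤ := by
    refine lt_of_le_of_lt (measure_mono (t := Metric.closedBall (0 : V) R) fun t ht => ?_)
      measure_closedBall_lt_top
    simpa using ht.1
  let L (ω : Ω) : V →L[ℝ] ℝ := (innerSL ℝ (noise ξ ω)).comp V.subtypeL
  have hL : ∀ ω (t : V), L ω t = ∑ i, t.1 i * ξ i ω := fun ω t => by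
    rw [← inner_noise, real_inner_comm]; rfl
  have hmul : 15 * (c * u) * y ≤ (5 / 6) * z ^ 2 := by
    have : 15 * (c * u) * y ≤ 15 * Q * y := by
      have : c * u ≤ Q := by rw [hQ]; nlinarith [sq_nonneg σ]
      gcongr
    linarith
  have hρc : ρ * c = 15 * (c * u) * y / z ^ 2 := by rw [hρ, hR]; field_simp; ring
  have hρc' : ρ * c ≤ 5 / 6 := by
    rw [hρc, div_le_iff₀ (by positivity)]; exact hmul
  -- The exponent is `σ² R² / (2 (1 - ρ c))`; inserting `z² ≥ 18 (9 σ² + c u) y` makes it at most `y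
  -- / 36`.
  have hbound : ∀ t ∈ A, ∫⁻ ω, ENNReal.ofReal (Real.exp (L ω t)) ∂μ ≤
      ENNReal.ofReal (Real.exp (y / 36)) := by
    intro t ht
    simp_rw [hL]
    refine (lintegral_exp_linear_le hm hi hc hb Finset.univ (fun i => t.1 i)
      (fun i _ => ht.2 i) (by linarith)).trans (ENNReal.ofReal_le_ofReal (Real.exp_le_exp.2 ?_))
    have e1 : ∑ i, t.1 i ^ 2 ≤ R ^ 2 := by
      have h1 : ‖t‖ ^ 2 = ∑ i, t.1 i ^ 2 := by
        rw [Submodule.norm_coe t |>.symm, EuclideanSpace.norm_sq_eq]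
        simp
      rw [← h1]
      have := ht.1
      gcongr
    have hz2 : 0 < z ^ 2 := by positivity
    rw [div_le_iff₀ (by linarith)]
    calc σ ^ 2 * ∑ i, t.1 i ^ 2 ≤ σ ^ 2 * R ^ 2 := by gcongr
      _ ≤ y / 36 * (2 * (1 - ρ * c)) := by
        have e2 : σ ^ 2 * R ^ 2 = 9 * σ ^ 2 * y ^ 2 / z ^ 2 := by
          rw [hR]; field_simp; norm_num
        have e3 : y / 36 * (2 * (1 - ρ * c)) =
            y / 18 * (z ^ 2 - 15 * (c * u) * y) / z ^ 2 := by
          rw [hρc]; field_simp; ring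
        rw [e2, e3]
        refine div_le_div_of_nonneg_right ?_ hz2.le
        have e4 : 0 ≤ y * (z ^ 2 - 18 * Q * y) := mul_nonneg hy.le (by linarith)
        have e5 : 0 ≤ c * u * y ^ 2 := by positivity
        rw [hQ] at e4
        nlinarith
  have hmeasI : Measurable fun p : Ω × V =>
      A.indicator (fun t => ENNReal.ofReal (Real.exp (L p.1 t))) p.2 := by
    have e : (fun p : Ω × V => A.indicator (fun t => ENNReal.ofReal (Real.exp (L p.1 t))) p.2) =
        (Prod.snd ⁻¹' A).indicator
          (fun p : Ω × V => ENNReal.ofReal (Real.exp (∑ i, p.2.1 i * ξ i p.1))) := by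
      ext p
      simp only [Set.indicator, Set.mem_preimage, hL]
    rw [e]
    refine Measurable.indicator ?_ (measurable_snd hAm)
    refine (Real.measurable_exp.comp (Finset.measurable_sum _ fun i _ => ?_)).ennreal_ofReal
    exact ((hcoord i).measurable.comp measurable_snd).mul ((hm i).comp measurable_fst)
  have hE : ∫⁻ ω, ∫⁻ t, A.indicator (fun t => ENNReal.ofReal (Real.exp (L ω t))) t ∂volume ∂μ ≤
      ENNReal.ofReal (Real.exp (y / 36)) * (volume : Measure V) A := by
    rw [lintegral_lintegral_swap hmeasI.aemeasurable]
    calc ∫⁻ t, ∫⁻ ω, A.indicator (fun t => ENNReal.ofReal (Real.exp (L ω t))) t ∂μ ∂volume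
        ≤ ∫⁻ t, A.indicator (fun _ => ENNReal.ofReal (Real.exp (y / 36))) t ∂volume := by
          refine lintegral_mono fun t => ?_
          by_cases ht : t ∈ A
          · simpa only [Set.indicator_of_mem ht] using hbound t ht
          · simp [Set.indicator_of_notMem ht]
      _ = _ := by rw [lintegral_indicator hAm]; simp
  -- This is `ε = 1 / 4`: a factor `(1 / 4) ^ D` and an exponent `(3 / 4) * 3 y`. Markov's
  -- inequality then gives the claim, as `4 ≤ exp 1.4` and `9 / 4 - 1 / 36 ≥ 2`.
  set k : ℝ := (1 / 4) ^ D * Real.exp (9 / 4 * y) with hk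
  have hk0 : 0 < k := by positivity
  have hsub : {ω | z ≤ ‖lsEst m (noise ξ ω)‖ ∧ ∀ i, |lsEst m (noise ξ ω) i| ≤ 5 * u} ⊆
      {ω | ENNReal.ofReal k * (volume : Measure V) A ≤
        ∫⁻ t, A.indicator (fun t => ENNReal.ofReal (Real.exp (L ω t))) t ∂volume} := by
    rintro ω ⟨h1, h2⟩
    set χ := lsEst m (noise ξ ω)
    have hχ0 : 0 < ‖χ‖ := hz.trans_le h1
    let v : V := ⟨(R / ‖χ‖) • χ, V.smul_mem _ (lsEst_mem m _)⟩
    have hv : v ∈ A := by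
      refine ⟨?_, fun i => ?_⟩
      · rw [← Submodule.norm_coe, norm_smul, Real.norm_of_nonneg (by positivity),
          div_mul_cancel₀ _ hχ0.ne']
      · have : v.1 i = R / ‖χ‖ * χ i := by simp [v]
        rw [this, abs_mul, abs_of_nonneg (by positivity)]
        calc R / ‖χ‖ * |χ i| ≤ R / z * (5 * u) := by gcongr; exact h2 i
          _ = ρ := by rw [hρ]; ring
    have hLv : 3 * y ≤ L ω v := by
      have e1 : L ω v = R / ‖χ‖ * ⟪noise ξ ω, χ⟫_ℝ := by
        simp [L, v]
      have e2 : ⟪noise ξ ω, χ⟫_ℝ = ‖χ‖ ^ 2 := by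
        have := inner_sub_lsEst m (noise ξ ω) (lsEst_mem m (noise ξ ω))
        rw [inner_sub_left, real_inner_self_eq_norm_sq] at this
        linarith
      rw [e1, e2]
      calc 3 * y = R * z := by rw [hR]; field_simp
        _ ≤ R * ‖χ‖ := by gcongr
        _ = _ := by field_simp
    have h3 := measure_mul_exp_le_lintegral_exp (volume : Measure V) hAm hAconv hAsymm (L ω) hv
      (ε := 1 / 4) (by norm_num) (by norm_num)
    refine le_trans ?_ h3
    gcongr
    have h6 : 9 / 4 * y ≤ (1 - 1 / 4) * L ω v := by linarith
    rw [hk]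
    gcongr
  have hmark := meas_ge_le_lintegral_div (μ := μ)
    (f := fun ω => ∫⁻ t, A.indicator (fun t => ENNReal.ofReal (Real.exp (L ω t))) t ∂volume)
    (hmeasI.lintegral_prod_right').aemeasurable
    (ε := ENNReal.ofReal k * (volume : Measure V) A)
    (mul_ne_zero (by simpa using hk0) hApos.ne')
    (ENNReal.mul_lt_top ENNReal.ofReal_lt_top hAfin).ne
  refine (measure_mono hsub).trans (hmark.trans ?_)
  refine (ENNReal.div_le_div_right hE _).trans ?_
  rw [ENNReal.mul_div_mul_right _ _ hApos.ne' hAfin.ne, ← ENNReal.ofReal_div_of_pos hk0]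
  refine ENNReal.ofReal_le_ofReal ?_
  rw [div_le_iff₀ hk0, hk]
  have h4 : Real.exp (-(1.4 * D)) ≤ (1 / 4 : ℝ) ^ D := by
    have h5 : Real.exp (-1.4) ≤ 1 / 4 := by
      have h6 : Real.exp (-1.4) = (Real.exp (-0.7)) ^ 2 := by
        rw [← Real.exp_nat_mul]; norm_num
      have h7 : Real.exp (-0.7) ≤ 1 / 2 := by
        rw [← Real.le_log_iff_exp_le (by norm_num), one_div, Real.log_inv]
        linarith [Real.log_two_lt_d9]
      rw [h6]
      calc Real.exp (-0.7) ^ 2 ≤ (1 / 2) ^ 2 := by gcongr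
        _ = 1 / 4 := by norm_num
    calc Real.exp (-(1.4 * D)) = Real.exp (-1.4) ^ D := by rw [← Real.exp_nat_mul]; ring_nf
      _ ≤ _ := by gcongr
  have hDm : (D : ℝ) ≤ m.parts.card := by exact_mod_cast finrank_histSpace_le m
  calc Real.exp (y / 36) ≤ Real.exp (1.4 * m.parts.card - 2 * y) *
        (Real.exp (-(1.4 * D)) * Real.exp (9 / 4 * y)) := by
        rw [← Real.exp_add, ← Real.exp_add]
        refine Real.exp_le_exp.2 ?_
        linarith
    _ ≤ _ := by gcongr

end ChiSquare

/-! ### Block averages of the noise, and uniform control of the quadratic term. -/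

section Block

variable {Ω : Type*} [MeasurableSpace Ω] {μ : Measure Ω} [IsProbabilityMeasure μ] {n : ℕ}

lemma measurable_lsEst_noise {ξ : Fin n → Ω → ℝ} (hm : ∀ i, Measurable (ξ i))
    (m : Finpartition (Finset.univ : Finset (Fin n))) :
    Measurable fun ω => lsEst m (noise ξ ω) :=
  (continuous_lsEst m).measurable.comp (measurable_noise hm)

lemma measurable_lsEst_noise_apply {ξ : Fin n → Ω → ℝ} (hm : ∀ i, Measurable (ξ i))
    (m : Finpartition (Finset.univ : Finset (Fin n))) (i : Fin n) :
    Measurable fun ω => lsEst m (noise ξ ω) i :=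
  (PiLp.continuous_apply 2 _ i).measurable.comp (measurable_lsEst_noise hm m)

/-- Coordinates of a coarser projection are bounded by those of a finer one. -/
lemma abs_lsEst_apply_le {m m₀ : Finpartition (Finset.univ : Finset (Fin n))}
    (h : histSpace m ≤ histSpace m₀) (x : EuclideanSpace ℝ (Fin n)) {C : ℝ}
    (hC : ∀ i, |lsEst m₀ x i| ≤ C) (i : Fin n) : |lsEst m x i| ≤ C := by
  have hI := m.part_mem.2 (Finset.mem_univ i)
  have hi := m.mem_part (Finset.mem_univ i)
  have hcard : (0 : ℝ) < (m.part i).card := by exact_mod_cast Finset.card_pos.2 ⟨i, hi⟩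
  rw [← lsEst_lsEst_of_le h, lsEst_apply m _ hI hi, abs_div, abs_of_pos hcard, div_le_iff₀ hcard]
  calc |∑ j ∈ m.part i, lsEst m₀ x j| ≤ ∑ j ∈ m.part i, |lsEst m₀ x j| :=
        Finset.abs_sum_le_sum_abs _ _
    _ ≤ ∑ _j ∈ m.part i, C := Finset.sum_le_sum fun j _ => hC j
    _ = C * (m.part i).card := by rw [Finset.sum_const, nsmul_eq_mul, mul_comm]

/-- Laplace transform of a block average of the noise. -/
lemma lintegral_exp_lsEst_apply_le {ξ : Fin n → Ω → ℝ} (hm : ∀ i, Measurable (ξ i))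
    (hi : iIndepFun ξ μ) {σ c : ℝ} (hc : 0 ≤ c)
    (hb : ∀ i, BernsteinBound μ (ξ i) σ c) (m : Finpartition (Finset.univ : Finset (Fin n)))
    (i : Fin n) {γ : ℝ} (hγ : |γ| * c < (m.part i).card) :
    ∫⁻ ω, ENNReal.ofReal (Real.exp (γ * lsEst m (noise ξ ω) i)) ∂μ ≤
      ENNReal.ofReal (Real.exp (σ ^ 2 * γ ^ 2 / (2 * ((m.part i).card - |γ| * c)))) := by
  have hI := m.part_mem.2 (Finset.mem_univ i)
  have hmem := m.mem_part (Finset.mem_univ i)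
  set p : ℝ := ((m.part i).card : ℝ) with hp
  have hp0 : 0 < p := by
    rw [hp]; exact_mod_cast Finset.card_pos.2 ⟨i, hmem⟩
  have h := lintegral_exp_linear_le hm hi hc hb (m.part i) (fun _ => γ / p) (τ := |γ| / p)
    (fun j _ => by rw [abs_div, abs_of_pos hp0]) (by rw [div_mul_eq_mul_div, div_lt_one hp0]; exact hγ)
  refine (le_of_eq ?_).trans (h.trans (le_of_eq ?_))
  · congr 1; ext ω
    rw [lsEst_apply m _ hI hmem, ← Finset.mul_sum]
    congr 2
    simp only [noise]
    ring
  · congr 2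
    rw [Finset.sum_const, nsmul_eq_mul, ← hp]
    have : p - |γ| * c ≠ 0 := by linarith
    have : 1 - |γ| / p * c ≠ 0 := by
      rw [show 1 - |γ| / p * c = (p - |γ| * c) / p by field_simp]
      exact div_ne_zero this hp0.ne'
    field_simp

/-- With `s = |z| / τ ≥ 1`, squaring `s ≤ exp (s - 1)` gives `s² ≤ exp (2 (s - 1))`, and `γ τ ≥ 2`
turns this exponent into `γ |z| - γ τ`. -/
lemma sq_le_of_le_abs {τ γ z : ℝ} (hτ : 0 < τ) (hγ : 2 ≤ γ * τ) (hz : τ ≤ |z|) :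
    z ^ 2 ≤ τ ^ 2 * Real.exp (-(γ * τ)) * (Real.exp (γ * z) + Real.exp (-(γ * z))) := by
  have h1 : |z| / τ ≤ Real.exp (|z| / τ - 1) := by
    linarith [Real.add_one_le_exp (|z| / τ - 1)]
  have h2 : (|z| / τ) ^ 2 ≤ Real.exp (2 * (|z| / τ - 1)) := by
    calc (|z| / τ) ^ 2 ≤ Real.exp (|z| / τ - 1) ^ 2 := by gcongr
      _ = _ := by rw [← Real.exp_nat_mul]; norm_num
  have h3 : 2 * (|z| / τ - 1) ≤ γ * |z| - γ * τ := by
    have e : |z| / τ - 1 = (|z| - τ) / τ := by field_simp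
    rw [e, ← mul_sub, mul_div_assoc', div_le_iff₀ hτ]
    nlinarith
  have h4 : Real.exp (γ * |z|) ≤ Real.exp (γ * z) + Real.exp (-(γ * z)) := by
    rcases abs_cases z with ⟨h, _⟩ | ⟨h, _⟩ <;> rw [h]
    · linarith [Real.exp_pos (-(γ * z))]
    · rw [mul_neg]; linarith [Real.exp_pos (γ * z)]
  have h5 : (|z| / τ) ^ 2 ≤ Real.exp (-(γ * τ)) * (Real.exp (γ * z) + Real.exp (-(γ * z))) := by
    calc (|z| / τ) ^ 2 ≤ Real.exp (-(γ * τ) + γ * |z|) :=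
          h2.trans (Real.exp_le_exp.2 (by linarith))
      _ = Real.exp (-(γ * τ)) * Real.exp (γ * |z|) := Real.exp_add _ _
      _ ≤ _ := by gcongr
  rw [div_pow, sq_abs, div_le_iff₀ (by positivity)] at h5
  linarith

/-- The energy carried by the projected noise when one of its coordinates exceeds `T`. -/
def largeEnergy (m₀ : Finpartition (Finset.univ : Finset (Fin n))) (ξ : Fin n → Ω → ℝ) (T : ℝ)
    (ω : Ω) : ℝ :=
  n * ∑ i, {ω | T < |lsEst m₀ (noise ξ ω) i|}.indicator
    (fun ω => (lsEst m₀ (noise ξ ω) i) ^ 2) ω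

lemma largeEnergy_nonneg (m₀ : Finpartition (Finset.univ : Finset (Fin n))) (ξ : Fin n → Ω → ℝ)
    (T : ℝ) (ω : Ω) : 0 ≤ largeEnergy m₀ ξ T ω :=
  mul_nonneg (Nat.cast_nonneg _) (Finset.sum_nonneg fun _ _ =>
    Set.indicator_nonneg (fun _ _ => sq_nonneg _) ω)

lemma measurable_largeEnergy {ξ : Fin n → Ω → ℝ} (hm : ∀ i, Measurable (ξ i))
    (m₀ : Finpartition (Finset.univ : Finset (Fin n))) (T : ℝ) :
    Measurable (largeEnergy m₀ ξ T) := by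
  refine (Finset.measurable_sum _ fun i _ => ?_).const_mul _
  have h := measurable_lsEst_noise_apply hm m₀ i
  exact (h.pow_const 2).indicator (measurableSet_lt measurable_const h.abs)

lemma norm_sq_le_largeEnergy (m₀ : Finpartition (Finset.univ : Finset (Fin n)))
    (ξ : Fin n → Ω → ℝ) {T : ℝ} {ω : Ω} {i : Fin n} (hi : T < |lsEst m₀ (noise ξ ω) i|) :
    ‖lsEst m₀ (noise ξ ω)‖ ^ 2 ≤ largeEnergy m₀ ξ T ω := by
  set x := lsEst m₀ (noise ξ ω) with hx
  obtain ⟨j, -, hj⟩ := Finset.exists_max_image Finset.univ (fun j => |x j|) ⟨i, Finset.mem_univ i⟩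
  have h1 : ‖x‖ ^ 2 ≤ n * x j ^ 2 := by
    rw [EuclideanSpace.norm_sq_eq]
    calc ∑ k, ‖x k‖ ^ 2 ≤ ∑ _k : Fin n, x j ^ 2 := by
          refine Finset.sum_le_sum fun k _ => ?_
          rw [Real.norm_eq_abs, ← sq_abs (x j)]
          have := hj k (Finset.mem_univ k)
          gcongr
      _ = _ := by simp
  refine h1.trans (mul_le_mul_of_nonneg_left ?_ (Nat.cast_nonneg _))
  have h2 : T < |lsEst m₀ (noise ξ ω) j| := hi.trans_le (hj i (Finset.mem_univ i))
  have h3 := Finset.single_le_sum (f := fun i => {ω | T < |lsEst m₀ (noise ξ ω) i|}.indicator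
    (fun ω => (lsEst m₀ (noise ξ ω) i) ^ 2) ω)
    (fun i _ => Set.indicator_nonneg (fun ω _ => sq_nonneg _) ω) (Finset.mem_univ j)
  refine le_trans (le_of_eq ?_) h3
  exact (Set.indicator_of_mem (s := {ω | T < |lsEst m₀ (noise ξ ω) j|}) h2
    (fun ω => (lsEst m₀ (noise ξ ω) j) ^ 2)).symm

/-- Let `p` be the size of the block and `x = c / (σ + c)`. The length of the blocks yields `γ c ≤
0.9 p x` and `σ² γ² ≤ 0.81 (1 - x)² p`, so the Bernstein exponent is bounded uniformly in `σ` and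
`c`. -/
lemma lintegral_exp_lsEst_apply_le_const {ξ : Fin n → Ω → ℝ} (hm : ∀ i, Measurable (ξ i))
    (hi : iIndepFun ξ μ) {σ c : ℝ} (hσ : 0 < σ) (hc : 0 ≤ c)
    (hb : ∀ i, BernsteinBound μ (ξ i) σ c)
    (m₀ : Finpartition (Finset.univ : Finset (Fin n))) {a L : ℝ}
    (hsize : ∀ I ∈ m₀.parts, a ^ 2 * L ^ 2 ≤ (I.card : ℝ)) (i : Fin n) {s : ℝ}
    (hs : |s| = 0.9 * L * a / (σ + c)) :
    ∫⁻ ω, ENNReal.ofReal (Real.exp (s * lsEst m₀ (noise ξ ω) i)) ∂μ ≤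
      ENNReal.ofReal (Real.exp 0.405) := by
  have hσc : 0 < σ + c := by linarith
  set γ := 0.9 * L * a / (σ + c) with hγ
  have hmem := m₀.mem_part (Finset.mem_univ i)
  have hI := m₀.part_mem.2 (Finset.mem_univ i)
  have hp := hsize _ hI
  have hp1 : (1 : ℝ) ≤ (m₀.part i).card := by exact_mod_cast Finset.card_pos.2 ⟨i, hmem⟩
  -- `p` is at least `1` and at least `(a L)²`, hence at least `a L` in either case.
  have hpa : a * L ≤ (m₀.part i).card := by
    by_cases h : a * L ≤ 1
    · linarith
    · nlinarith
  set p : ℝ := ((m₀.part i).card : ℝ)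
  have hγc : γ * c ≤ 0.9 * p * (c / (σ + c)) := by
    have : γ * c = 0.9 * (a * L) * (c / (σ + c)) := by rw [hγ]; ring
    rw [this]; gcongr
  have hcs : c / (σ + c) ≤ 1 := by rw [div_le_one hσc]; linarith
  have hlt : γ * c < p := by
    have : 0.9 * p * (c / (σ + c)) ≤ 0.9 * p * 1 := by gcongr
    linarith
  refine (lintegral_exp_lsEst_apply_le hm hi hc hb m₀ i (by rw [hs]; exact hlt)).trans
    (ENNReal.ofReal_le_ofReal (Real.exp_le_exp.2 ?_))
  rw [hs, ← sq_abs s, hs, div_le_iff₀ (by linarith)]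
  set x := c / (σ + c) with hx
  have hx0 : 0 ≤ x := by positivity
  have e1 : σ ^ 2 * γ ^ 2 = 0.81 * (1 - x) ^ 2 * (a ^ 2 * L ^ 2) := by
    rw [hγ, hx]; field_simp; ring
  have e2 : (1 - x) ^ 2 ≤ 1 - 0.9 * x := by nlinarith
  calc σ ^ 2 * γ ^ 2 ≤ 0.81 * (1 - 0.9 * x) * p := by
        rw [e1]
        have : 0 ≤ 0.81 * (1 - 0.9 * x) := by nlinarith
        gcongr
    _ ≤ 0.405 * (2 * (p - γ * c)) := by nlinarith

lemma exp_le_eight_fifths : Real.exp 0.405 ≤ 1.6 := by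
  have h1 : Real.exp 0.2025 ≤ 1.26 := by
    rw [← inv_inv (Real.exp 0.2025), ← Real.exp_neg]
    refine inv_le_of_inv_le₀ (by norm_num) ?_
    have := Real.add_one_le_exp (-0.2025 : ℝ)
    norm_num at this ⊢
    linarith
  calc Real.exp 0.405 = Real.exp 0.2025 ^ 2 := by rw [← Real.exp_nat_mul]; norm_num
    _ ≤ 1.26 ^ 2 := by gcongr
    _ ≤ 1.6 := by norm_num

/-- One factor `n` comes from the definition of `largeEnergy`, the other from the sum over
coordinates. Each coordinate contributes a Chernoff factor `exp (-γ T)` with `γ T = 0.9 τ B log n`.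
-/
lemma lintegral_largeEnergy_le {ξ : Fin n → Ω → ℝ} (hm : ∀ i, Measurable (ξ i))
    (hi : iIndepFun ξ μ) {σ c : ℝ} (hσ : 0 < σ) (hc : 0 ≤ c)
    (hb : ∀ i, BernsteinBound μ (ξ i) σ c) (hn : 2 ≤ n)
    (m₀ : Finpartition (Finset.univ : Finset (Fin n))) {a B : ℝ} (ha : 0 < a) (hB : 2 ≤ B)
    (hsize : ∀ I ∈ m₀.parts, a ^ 2 * Real.log n ^ 2 ≤ (I.card : ℝ)) {τ : ℝ} (hτ : 2 ≤ τ) :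
    ∫⁻ ω, ENNReal.ofReal (largeEnergy m₀ ξ (τ * ((σ + c) * B / a)) ω) ∂μ ≤
      ENNReal.ofReal (3.2 * τ ^ 2 * n ^ 2 * Real.exp (-(0.9 * τ * B * Real.log n)) *
        ((σ + c) * B / a) ^ 2) := by
  set L := Real.log n with hL
  set u := (σ + c) * B / a with hu
  have hL0 : 0.69 ≤ L := by
    have h1 : Real.log 2 ≤ L := Real.log_le_log (by norm_num) (by exact_mod_cast hn)
    linarith [Real.log_two_gt_d9]
  have hσc : 0 < σ + c := by linarith
  have hu0 : 0 < u := by rw [hu]; positivity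
  set T := τ * u with hT
  have hT0 : 0 < T := by rw [hT]; positivity
  set γ := 0.9 * L * a / (σ + c) with hγ
  have hγ0 : 0 < γ := by rw [hγ]; positivity
  have hγu : γ * u = 0.9 * B * L := by rw [hγ, hu]; field_simp
  have hγT : γ * T = 0.9 * τ * B * L := by rw [hT]; linear_combination τ * hγu
  have hγT2 : 2 ≤ γ * T := by
    rw [hγT]
    calc (2 : ℝ) ≤ 0.9 * 2 * 2 * 0.69 := by norm_num
      _ ≤ _ := by gcongr
  have hlap : ∀ (i : Fin n) (s : ℝ), |s| = γ →
      ∫⁻ ω, ENNReal.ofReal (Real.exp (s * lsEst m₀ (noise ξ ω) i)) ∂μ ≤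
        ENNReal.ofReal (Real.exp 0.405) :=
    fun i s hs => lintegral_exp_lsEst_apply_le_const hm hi hσ hc hb m₀ hsize i hs
  have hexp : 2 * Real.exp 0.405 ≤ 3.2 := by
    linarith [exp_le_eight_fifths]
  have hpt : ∀ ω, ENNReal.ofReal (largeEnergy m₀ ξ T ω) ≤
      ENNReal.ofReal (n * (T ^ 2 * Real.exp (-(γ * T)))) * ∑ i,
        (ENNReal.ofReal (Real.exp (γ * lsEst m₀ (noise ξ ω) i)) +
          ENNReal.ofReal (Real.exp (-γ * lsEst m₀ (noise ξ ω) i))) := by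
    intro ω
    simp_rw [← ENNReal.ofReal_add (Real.exp_pos _).le (Real.exp_pos _).le]
    rw [← ENNReal.ofReal_sum_of_nonneg (fun i _ => by positivity),
      ← ENNReal.ofReal_mul (by positivity)]
    refine ENNReal.ofReal_le_ofReal ?_
    rw [largeEnergy, mul_assoc]
    refine mul_le_mul_of_nonneg_left ?_ (Nat.cast_nonneg _)
    rw [Finset.mul_sum]
    refine Finset.sum_le_sum fun i _ => ?_
    by_cases hω : T < |lsEst m₀ (noise ξ ω) i|
    · rw [Set.indicator_of_mem (by exact hω)]
      have := sq_le_of_le_abs hT0 hγT2 hω.le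
      simpa [neg_mul] using this
    · rw [Set.indicator_of_notMem (by exact hω)]
      positivity
  have hmeas : ∀ (s : ℝ) i, Measurable fun ω =>
      ENNReal.ofReal (Real.exp (s * lsEst m₀ (noise ξ ω) i)) := fun s i => by
    exact (Real.measurable_exp.comp
      ((measurable_lsEst_noise_apply hm m₀ i).const_mul s)).ennreal_ofReal
  have key : ∫⁻ ω, ENNReal.ofReal (largeEnergy m₀ ξ T ω) ∂μ ≤
      ENNReal.ofReal (n * (T ^ 2 * Real.exp (-(γ * T))) * (n * (2 * Real.exp 0.405))) := by
    clear_value T γ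
    calc ∫⁻ ω, ENNReal.ofReal (largeEnergy m₀ ξ T ω) ∂μ
        ≤ ∫⁻ ω, ENNReal.ofReal (n * (T ^ 2 * Real.exp (-(γ * T)))) * ∑ i,
          (ENNReal.ofReal (Real.exp (γ * lsEst m₀ (noise ξ ω) i)) +
            ENNReal.ofReal (Real.exp (-γ * lsEst m₀ (noise ξ ω) i))) ∂μ := lintegral_mono hpt
      _ = ENNReal.ofReal (n * (T ^ 2 * Real.exp (-(γ * T)))) * ∑ i,
          (∫⁻ ω, ENNReal.ofReal (Real.exp (γ * lsEst m₀ (noise ξ ω) i)) ∂μ +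
            ∫⁻ ω, ENNReal.ofReal (Real.exp (-γ * lsEst m₀ (noise ξ ω) i)) ∂μ) := by
          rw [lintegral_const_mul' _ _ ENNReal.ofReal_ne_top]
          congr 1
          refine (lintegral_finsetSum _ fun i _ => ?_).trans
            (Finset.sum_congr rfl fun i _ => lintegral_add_left (hmeas γ i) _)
          exact (hmeas γ i).add (hmeas (-γ) i)
      _ ≤ ENNReal.ofReal (n * (T ^ 2 * Real.exp (-(γ * T)))) * ∑ _i : Fin n,
          (ENNReal.ofReal (Real.exp 0.405) + ENNReal.ofReal (Real.exp 0.405)) := by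
          gcongr with i
          · exact hlap i γ (abs_of_pos hγ0)
          · exact hlap i (-γ) (by rw [abs_neg, abs_of_pos hγ0])
      _ = ENNReal.ofReal (n * (T ^ 2 * Real.exp (-(γ * T))) * (n * (2 * Real.exp 0.405))) := by
          rw [← ENNReal.ofReal_add (by positivity) (by positivity), ← two_mul, Finset.sum_const,
            nsmul_eq_mul, Finset.card_univ, Fintype.card_fin,
            ENNReal.ofReal_mul (p := (n : ℝ) * (T ^ 2 * Real.exp (-(γ * T)))) (by positivity),
            ENNReal.ofReal_mul (p := (n : ℝ)) (q := 2 * Real.exp 0.405) (by positivity),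
            ENNReal.ofReal_natCast]
  refine key.trans (ENNReal.ofReal_le_ofReal ?_)
  rw [hγT]
  calc (n : ℝ) * (T ^ 2 * Real.exp (-(0.9 * τ * B * L))) * (n * (2 * Real.exp 0.405))
      ≤ n * (T ^ 2 * Real.exp (-(0.9 * τ * B * L))) * (n * 3.2) := by gcongr
    _ = _ := by rw [hT]; ring

lemma exp_neg_three_fifths_le : Real.exp (-0.6) ≤ 0.625 := by
  rw [Real.exp_neg, inv_le_comm₀ (Real.exp_pos _) (by norm_num)]
  linarith [Real.add_one_le_exp (0.6 : ℝ)]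

/-- The squared norms of the projected noise are uniformly controlled. -/
theorem exists_bound_norm_lsEst_sq {ξ : Fin n → Ω → ℝ} (hm : ∀ i, Measurable (ξ i))
    (hi : iIndepFun ξ μ) {σ c : ℝ} (hσ : 0 < σ) (hc : 0 ≤ c)
    (hb : ∀ i, BernsteinBound μ (ξ i) σ c) (hn : 2 ≤ n)
    (m₀ : Finpartition (Finset.univ : Finset (Fin n))) {a B : ℝ} (ha : 0 < a) (hB : 2 ≤ B)
    (hsize : ∀ I ∈ m₀.parts, a ^ 2 * Real.log n ^ 2 ≤ (I.card : ℝ))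
    (M : Finset (Finpartition (Finset.univ : Finset (Fin n))))
    (hM_sub : ∀ m ∈ M, histSpace m ≤ histSpace m₀)
    (Δ : Finpartition (Finset.univ : Finset (Fin n)) → ℝ) (hΔ : ∀ m ∈ M, 0 ≤ Δ m)
    {u Q : ℝ} (hu : u = (σ + c) * B / a) (hQ : Q = 9 * σ ^ 2 + c * u) :
    ∃ Z : Ω → ℝ, Integrable Z μ ∧
      ∫ ω, Z ω ∂μ ≤ 5.625 * Q * ∑ m ∈ M, Real.exp (-Δ m) +
        80 * n ^ 2 * Real.exp (-(4.5 * B * Real.log n)) * u ^ 2 ∧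
      ∀ m ∈ M, ∀ ω, ‖lsEst m (noise ξ ω)‖ ^ 2 - 18 * Q * (m.parts.card + Δ m) ≤ Z ω := by
  have hσc : 0 < σ + c := by linarith
  have hu0 : 0 < u := by rw [hu]; positivity
  have hQ0 : 0 < Q := by rw [hQ]; positivity
  -- The bound on the coordinates of the finest projection passes to every coarser one by averaging.
  let S : Set Ω := {ω | ∀ i, |lsEst m₀ (noise ξ ω) i| ≤ 5 * u}
  have hS : MeasurableSet S := by
    have : S = ⋂ i, {ω | |lsEst m₀ (noise ξ ω) i| ≤ 5 * u} := by ext; simp [S]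
    rw [this]
    exact MeasurableSet.iInter fun i =>
      measurableSet_le (measurable_lsEst_noise_apply hm m₀ i).abs measurable_const
  let W (m : Finpartition (Finset.univ : Finset (Fin n))) : Ω → ℝ :=
    S.indicator fun ω => ‖lsEst m (noise ξ ω)‖ ^ 2 - 18 * Q * (m.parts.card + Δ m)
  have hWm : ∀ m, Measurable (W m) := fun m =>
    (((measurable_lsEst_noise hm m).norm.pow_const 2).sub_const _).indicator hS
  have hW : ∀ m ∈ M, ∫⁻ ω, ENNReal.ofReal (W m ω) ∂μ ≤
      ENNReal.ofReal (5.625 * Q * Real.exp (-Δ m)) := by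
    intro m hmM
    have hD : (1 : ℝ) ≤ m.parts.card := by
      have h1 : m.part ⟨0, by omega⟩ ∈ m.parts := m.part_mem.2 (Finset.mem_univ _)
      exact_mod_cast Finset.card_pos.2 ⟨_, h1⟩
    have hΔm := hΔ m hmM
    have h := lintegral_ofReal_le_of_tail (μ := μ) (hWm m)
      (C := 0.625 * Real.exp (-Δ m)) (κ := 9 * Q) (by positivity) (by positivity) (by
        intro t ht
        -- With `z² = 18 Q y` the exponent is `1.4 |m| - 2 y ≤ -0.6 - Δ m - t / (9 Q)`, since `|m| ≥
        -- 1`. The weight `exp (-Δ m)` pays for the union over `M`, and integrating in `t` gives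
        -- `0.625 * 9 = 5.625`.
        set y := m.parts.card + Δ m + t / (18 * Q) with hy
        have hy0 : 0 < y := by positivity
        have hQy : 18 * Q * y = 18 * Q * (m.parts.card + Δ m) + t := by rw [hy]; field_simp
        have h1 := measure_norm_lsEst_ge_le hm hi hσ hc hb m (z := √(18 * Q * y)) hu0 hy0
          (by positivity) (by rw [Real.sq_sqrt (by positivity), hQ])
        refine (measure_mono fun ω hω => ?_).trans (h1.trans (ENNReal.ofReal_le_ofReal ?_))
        · have hω' : t ≤ W m ω := hω
          by_cases hωS : ω ∈ S
          · simp only [W, Set.indicator_of_mem hωS] at hω'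
            refine ⟨?_, abs_lsEst_apply_le (hM_sub m hmM) _ hωS⟩
            rw [Real.sqrt_le_left (norm_nonneg _), hQy]
            linarith
          · simp only [W, Set.indicator_of_notMem hωS] at hω'
            linarith
        · have e : 2 * (t / (18 * Q)) = t / (9 * Q) := by field_simp; norm_num
          calc Real.exp (1.4 * m.parts.card - 2 * y)
              ≤ Real.exp (-0.6 + -Δ m + -(t / (9 * Q))) := by
                refine Real.exp_le_exp.2 ?_
                rw [← e, hy]; linarith
            _ = Real.exp (-0.6) * Real.exp (-Δ m) * Real.exp (-(t / (9 * Q))) := by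
                rw [Real.exp_add, Real.exp_add]
            _ ≤ _ := by gcongr; exact exp_neg_three_fifths_le)
    refine h.trans (ENNReal.ofReal_le_ofReal (le_of_eq ?_))
    ring
  have hoff := lintegral_largeEnergy_le (μ := μ) hm hi hσ hc hb hn m₀ ha hB hsize (τ := 5)
    (by norm_num)
  rw [← hu] at hoff
  -- Outside `S` every projection has norm at most that of the finest one, whose square
  -- `largeEnergy` dominates.
  let Z : Ω → ℝ := fun ω => (∑ m ∈ M, max (W m ω) 0) + largeEnergy m₀ ξ (5 * u) ω
  have hZm : Measurable Z := (Finset.measurable_sum _ fun m _ =>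
    (hWm m).max measurable_const).add (measurable_largeEnergy hm m₀ _)
  have hsum0 : ∀ ω, 0 ≤ ∑ m ∈ M, max (W m ω) 0 := fun ω =>
    Finset.sum_nonneg fun m _ => le_max_right _ _
  have hZ0 : ∀ ω, 0 ≤ Z ω := fun ω => add_nonneg (hsum0 ω) (largeEnergy_nonneg _ _ _ _)
  have hexpnn : 0 ≤ ∑ m ∈ M, Real.exp (-Δ m) := Finset.sum_nonneg fun m _ => (Real.exp_pos _).le
  have hlin : ∫⁻ ω, ENNReal.ofReal (Z ω) ∂μ ≤
      ENNReal.ofReal (5.625 * Q * ∑ m ∈ M, Real.exp (-Δ m) +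
        80 * n ^ 2 * Real.exp (-(4.5 * B * Real.log n)) * u ^ 2) := by
    simp only [Z]
    simp_rw [fun ω => ENNReal.ofReal_add (hsum0 ω) (largeEnergy_nonneg m₀ ξ (5 * u) ω),
      fun ω => ENNReal.ofReal_sum_of_nonneg (s := M) (f := fun m => max (W m ω) 0)
        (fun m _ => le_max_right _ _)]
    rw [lintegral_add_right _ (measurable_largeEnergy hm m₀ _).ennreal_ofReal,
      lintegral_finsetSum _ fun m _ => ((hWm m).max measurable_const).ennreal_ofReal,
      ENNReal.ofReal_add (by positivity) (by positivity)]
    refine add_le_add ?_ (hoff.trans (ENNReal.ofReal_le_ofReal (le_of_eq ?_)))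
    · rw [Finset.mul_sum, ENNReal.ofReal_sum_of_nonneg fun m _ => by positivity]
      refine Finset.sum_le_sum fun m hmM => ?_
      refine le_trans (le_of_eq ?_) (hW m hmM)
      congr 1; ext ω
      simp [ENNReal.ofReal_max]
    · rw [show (0.9 : ℝ) * 5 * B * Real.log n = 4.5 * B * Real.log n by ring]
      ring
  obtain ⟨hint, hle⟩ := integrable_and_integral_le hZm hZ0 (by positivity) hlin
  refine ⟨Z, hint, hle, fun m hmM ω => ?_⟩
  have hpen : 0 ≤ 18 * Q * (m.parts.card + Δ m) := by
    have := hΔ m hmM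
    positivity
  by_cases hω : ω ∈ S
  · have h1 : W m ω ≤ ∑ m ∈ M, max (W m ω) 0 := (le_max_left _ _).trans
      (Finset.single_le_sum (f := fun m => max (W m ω) 0) (fun m _ => le_max_right _ _) hmM)
    have h2 := largeEnergy_nonneg m₀ ξ (5 * u) ω
    have h4 : W m ω = ‖lsEst m (noise ξ ω)‖ ^ 2 - 18 * Q * (m.parts.card + Δ m) :=
      Set.indicator_of_mem hω _
    rw [h4] at h1
    exact h1.trans (le_add_of_nonneg_right h2)
  · simp only [S, Set.mem_ofPred_eq, not_forall, not_le] at hω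
    obtain ⟨i, hi'⟩ := hω
    have h1 := norm_sq_le_largeEnergy m₀ ξ hi'
    have h2 : ‖lsEst m (noise ξ ω)‖ ≤ ‖lsEst m₀ (noise ξ ω)‖ := by
      rw [← lsEst_lsEst_of_le (hM_sub m hmM)]
      exact norm_lsEst_le _ _
    have h3 : ‖lsEst m (noise ξ ω)‖ ^ 2 ≤ ‖lsEst m₀ (noise ξ ω)‖ ^ 2 := by gcongr
    have := hsum0 ω
    simp only [Z]
    linarith

end Block

/-! ### The linear term for bounded `K`: truncation and a weighted union bound. -/

section LinearSmall

open scoped InnerProductSpace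

variable {Ω : Type*} [MeasurableSpace Ω] {μ : Measure Ω} [IsProbabilityMeasure μ] {n : ℕ}

/-- The part of a vector carried by its coordinates of absolute value at most `T`. -/
def truncate (T : ℝ) (g : EuclideanSpace ℝ (Fin n)) : EuclideanSpace ℝ (Fin n) :=
  WithLp.toLp 2 fun i => if |g i| ≤ T then g i else 0

lemma truncate_mem {m₀ : Finpartition (Finset.univ : Finset (Fin n))} {T : ℝ}
    {g : EuclideanSpace ℝ (Fin n)} (hg : g ∈ histSpace m₀) : truncate T g ∈ histSpace m₀ := by
  intro I hI i hi j hj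
  simp only [truncate]
  rw [hg I hI i hi j hj]

lemma abs_truncate_le {T : ℝ} (hT : 0 ≤ T) (g : EuclideanSpace ℝ (Fin n)) (i : Fin n) :
    |truncate T g i| ≤ T := by
  simp only [truncate]
  split_ifs with h
  · exact h
  · simpa using hT

/-- When the noise is bounded, large coordinates of the signal are absorbed by its energy. -/
lemma linear_le_truncate (g x : EuclideanSpace ℝ (Fin n)) {K T : ℝ} (hK : 0 < K)
    (hx : ∀ i, 2 * K * |x i| ≤ T) :
    -(2 * ⟪g, x⟫_ℝ) - ‖g‖ ^ 2 / K ≤ -(2 * ⟪truncate T g, x⟫_ℝ) - ‖truncate T g‖ ^ 2 / K := by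
  simp only [EuclideanSpace.norm_sq_eq, PiLp.inner_apply, RCLike.inner_apply, conj_trivial,
    Real.norm_eq_abs, sq_abs, Finset.mul_sum, Finset.sum_div, ← Finset.sum_neg_distrib,
    ← Finset.sum_sub_distrib]
  refine Finset.sum_le_sum fun i _ => ?_
  simp only [truncate]
  split_ifs with h
  · exact le_rfl
  · have h1 : 2 * K * |x i| * |g i| ≤ g i ^ 2 := by
      rw [← sq_abs, sq]
      exact mul_le_mul_of_nonneg_right ((hx i).trans (not_le.1 h).le) (abs_nonneg _)
    have h2 : -(x i * g i) ≤ |x i| * |g i| := by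
      rw [← abs_mul]; exact neg_le_abs _
    have h3 : 2 * (|x i| * |g i|) ≤ g i ^ 2 / K := by
      rw [le_div_iff₀ hK]; linarith
    simp only [mul_zero, neg_zero, ne_eq, OfNat.ofNat_ne_zero, not_false_eq_true, zero_pow,
      zero_div, sub_zero]
    linarith

/-- The constant is the maximum of `r * exp (-lam * r)` over `r ≥ 0`. -/
lemma max_le_exp_div {r lam : ℝ} (hlam : 0 < lam) :
    max r 0 ≤ Real.exp (-1) / lam * Real.exp (lam * r) := by
  rw [div_mul_eq_mul_div, ← Real.exp_add, le_div_iff₀ hlam]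
  rcases le_total r 0 with h | h
  · rw [max_eq_right h]; simpa using (Real.exp_pos _).le
  · rw [max_eq_left h]; linarith [Real.add_one_le_exp (-1 + lam * r)]

lemma exp_neg_sixteen_sevenths_le : Real.exp (-(9 / 7) + -1) ≤ 0.11 := by
  have h1 : Real.exp (-(9 / 7) + -1) = Real.exp (-(8 / 7)) ^ 2 := by
    rw [← Real.exp_nat_mul]; norm_num
  have h2 : Real.exp (-(8 / 7)) ≤ 0.33 := by
    rw [Real.exp_neg, inv_le_comm₀ (Real.exp_pos _) (by norm_num)]
    have h3 : Real.exp (8 / 7) = Real.exp 1 * Real.exp (1 / 7) := by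
      rw [← Real.exp_add]; norm_num
    rw [h3]
    have h4 := Real.add_one_le_exp (1 / 7 : ℝ)
    have h5 := Real.exp_one_gt_d9
    calc (0.33 : ℝ)⁻¹ ≤ 2.7182818283 * (1 / 7 + 1) := by norm_num
      _ ≤ _ := by gcongr
  rw [h1]
  calc Real.exp (-(8 / 7)) ^ 2 ≤ 0.33 ^ 2 := by gcongr
    _ ≤ 0.11 := by norm_num

/-- The linear terms are uniformly controlled when `K` is not large. -/
theorem exists_bound_linear_of_le {ξ : Fin n → Ω → ℝ} (hm : ∀ i, Measurable (ξ i))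
    (hi : iIndepFun ξ μ) {σ c : ℝ} (hσ : 0 < σ) (hc : 0 ≤ c)
    (hb : ∀ i, BernsteinBound μ (ξ i) σ c) (hn : 2 ≤ n)
    (m₀ : Finpartition (Finset.univ : Finset (Fin n))) {a B : ℝ} (ha : 0 < a) (hB : 2 ≤ B)
    (hsize : ∀ I ∈ m₀.parts, a ^ 2 * Real.log n ^ 2 ≤ (I.card : ℝ))
    (M : Finset (Finpartition (Finset.univ : Finset (Fin n))))
    (hM_sub : ∀ m ∈ M, histSpace m ≤ histSpace m₀)
    (Δ : Finpartition (Finset.univ : Finset (Fin n)) → ℝ) (hΔ : ∀ m ∈ M, 0 ≤ Δ m)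
    {u Q : ℝ} (hu : u = (σ + c) * B / a) (hQ : Q = 9 * σ ^ 2 + c * u) {K : ℝ} (hK : 0 < K)
    (hK15 : K ≤ 15) (f : EuclideanSpace ℝ (Fin n)) :
    ∃ Z : Ω → ℝ, Integrable Z μ ∧
      ∫ ω, Z ω ∂μ ≤ 23.1 * Q * ∑ m ∈ M, Real.exp (-Δ m) +
        588 * n ^ 2 * Real.exp (-(3.15 * B * Real.log n)) * u ^ 2 ∧
      ∀ m ∈ M, ∀ ω, -(2 * ⟪resid m₀ m f, noise ξ ω⟫_ℝ) - ‖resid m₀ m f‖ ^ 2 / K -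
        18 * K * Q * (m.parts.card + Δ m) ≤ Z ω := by
  have hσc : 0 < σ + c := by linarith
  have hu0 : 0 < u := by rw [hu]; positivity
  have hQ0 : 0 < Q := by rw [hQ]; positivity
  -- Outside an exceptional event the projected noise has coordinates at most `3.5 u`. Coordinates
  -- of the residual above `7 u K = 2 K * 3.5 u` are then absorbed by their own energy, and only the
  -- truncated residual meets the noise.
  set G : Finpartition (Finset.univ : Finset (Fin n)) → EuclideanSpace ℝ (Fin n) :=
    fun m => truncate (7 * u * K) (resid m₀ m f) with hG
  -- This makes `1 - 14 c u / ρ = 2 σ² / ρ`, so that the Bernstein exponent at `2 * lam * G` is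
  -- exactly `lam * ‖G‖² / K` and `exp (lam * X)` has mean at most one.
  set ρ := 2 * σ ^ 2 + 14 * (c * u) with hρ
  have hρ0 : 0 < ρ := by positivity
  set lam := 1 / (K * ρ) with hlam
  have hlam0 : 0 < lam := by positivity
  let X (m : Finpartition (Finset.univ : Finset (Fin n))) (ω : Ω) : ℝ :=
    -(2 * ⟪G m, noise ξ ω⟫_ℝ) - ‖G m‖ ^ 2 / K
  have hXm : ∀ m, Measurable (X m) := by
    intro m
    refine Measurable.sub_const (Measurable.neg (Measurable.const_mul ?_ 2)) _
    simp_rw [inner_noise]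
    exact Finset.measurable_sum _ fun i _ => (hm i).const_mul _
  have hlap : ∀ m, ∫⁻ ω, ENNReal.ofReal (Real.exp (lam * X m ω)) ∂μ ≤ 1 := by
    intro m
    have hτc : 2 * lam * (7 * u * K) * c = 14 * (c * u) / ρ := by
      rw [hlam]; field_simp; ring
    have hlt : 2 * lam * (7 * u * K) * c < 1 := by
      rw [hτc, div_lt_one hρ0, hρ]
      have : 0 < σ ^ 2 := by positivity
      linarith
    have h := lintegral_exp_linear_le hm hi hc hb Finset.univ (fun i => -(2 * lam * G m i))
      (τ := 2 * lam * (7 * u * K)) (fun i _ => by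
        rw [abs_neg, abs_mul, abs_of_pos (by positivity : 0 < 2 * lam)]
        gcongr
        exact abs_truncate_le (by positivity) _ _) hlt
    have hsum : ∑ i, (-(2 * lam * G m i)) ^ 2 = 4 * lam ^ 2 * ‖G m‖ ^ 2 := by
      rw [EuclideanSpace.norm_sq_eq, Finset.mul_sum]
      refine Finset.sum_congr rfl fun i _ => ?_
      rw [Real.norm_eq_abs, sq_abs]; ring
    have hval : σ ^ 2 * (∑ i, (-(2 * lam * G m i)) ^ 2) / (2 * (1 - 2 * lam * (7 * u * K) * c)) =
        lam * (‖G m‖ ^ 2 / K) := by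
      rw [hsum, hτc]
      have e1 : 1 - 14 * (c * u) / ρ = 2 * σ ^ 2 / ρ := by
        rw [eq_div_iff hρ0.ne', sub_mul, div_mul_cancel₀ _ hρ0.ne', hρ]; ring
      have e2 : lam * (K * ρ) = 1 := by rw [hlam]; field_simp
      rw [e1]
      have e3 : σ ^ 2 * (4 * lam ^ 2 * ‖G m‖ ^ 2) / (2 * (2 * σ ^ 2 / ρ)) =
        lam * ‖G m‖ ^ 2 * (lam * ρ) := by field_simp; ring
      rw [e3, hlam]; field_simp
    rw [hval] at h
    calc ∫⁻ ω, ENNReal.ofReal (Real.exp (lam * X m ω)) ∂μ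
        = ∫⁻ ω, ENNReal.ofReal (Real.exp (-(lam * (‖G m‖ ^ 2 / K)))) *
          ENNReal.ofReal (Real.exp (∑ i, -(2 * lam * G m i) * ξ i ω)) ∂μ := by
          congr 1; ext ω
          rw [← ENNReal.ofReal_mul (Real.exp_pos _).le, ← Real.exp_add]
          congr 2
          simp only [X, inner_noise, neg_mul, mul_assoc, Finset.sum_neg_distrib, ← Finset.mul_sum]
          ring
      _ ≤ ENNReal.ofReal (Real.exp (-(lam * (‖G m‖ ^ 2 / K)))) *
          ENNReal.ofReal (Real.exp (lam * (‖G m‖ ^ 2 / K))) := by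
          rw [lintegral_const_mul' _ _ ENNReal.ofReal_ne_top]
          gcongr
      _ = 1 := by
          rw [← ENNReal.ofReal_mul (Real.exp_pos _).le, ← Real.exp_add]; simp
  let W (m : Finpartition (Finset.univ : Finset (Fin n))) (ω : Ω) : ℝ :=
    max (X m ω - 18 * K * Q * (m.parts.card + Δ m)) 0
  have hWm : ∀ m, Measurable (W m) := fun m => ((hXm m).sub_const _).max measurable_const
  have hW : ∀ m ∈ M, ∫⁻ ω, ENNReal.ofReal (W m ω) ∂μ ≤
      ENNReal.ofReal (23.1 * Q * Real.exp (-Δ m)) := by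
    intro m hmM
    have hD : (1 : ℝ) ≤ m.parts.card := by
      have h1 : m.part ⟨0, by omega⟩ ∈ m.parts := m.part_mem.2 (Finset.mem_univ _)
      exact_mod_cast Finset.card_pos.2 ⟨_, h1⟩
    have hΔm := hΔ m hmM
    set p := 18 * K * Q * (m.parts.card + Δ m) with hp
    -- In `18 Q / ρ ≥ 9 / 7` the terms in `c u` balance exactly; the terms in `σ²` have room to
    -- spare.
    have hpl : 9 / 7 + Δ m ≤ lam * p := by
      have e1 : lam * (18 * K * Q) = 18 * Q / ρ := by rw [hlam]; field_simp
      have e2 : 9 / 7 ≤ 18 * Q / ρ := by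
        rw [le_div_iff₀ hρ0, hρ, hQ]
        have := sq_nonneg σ
        linarith
      calc 9 / 7 + Δ m ≤ 9 / 7 * (m.parts.card + Δ m) := by linarith
        _ ≤ 18 * Q / ρ * (m.parts.card + Δ m) := by gcongr
        _ = lam * p := by rw [hp, ← e1]; ring
    calc ∫⁻ ω, ENNReal.ofReal (W m ω) ∂μ
        ≤ ∫⁻ ω, ENNReal.ofReal (Real.exp (-1) / lam * Real.exp (-(lam * p))) *
          ENNReal.ofReal (Real.exp (lam * X m ω)) ∂μ := by
          refine lintegral_mono fun ω => ?_
          rw [← ENNReal.ofReal_mul (by positivity), mul_assoc, ← Real.exp_add]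
          refine ENNReal.ofReal_le_ofReal ((max_le_exp_div hlam0).trans (le_of_eq ?_))
          congr 2; ring
      _ ≤ ENNReal.ofReal (Real.exp (-1) / lam * Real.exp (-(lam * p))) * 1 := by
          rw [lintegral_const_mul' _ _ ENNReal.ofReal_ne_top]
          gcongr
          exact hlap m
      _ ≤ _ := by
          rw [mul_one]
          refine ENNReal.ofReal_le_ofReal ?_
          have e1 : Real.exp (-1) / lam = Real.exp (-1) * (K * ρ) := by rw [hlam]; field_simp
          -- Here, and in the exceptional term below, `K ≤ 15` is needed: these means are
          -- proportional to `K`, while the remainder of the theorem does not grow with `K`.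
          have e2 : K * ρ ≤ 210 * Q := by
            have : ρ ≤ 14 * Q := by
              rw [hρ, hQ]
              have := sq_nonneg σ
              linarith
            calc K * ρ ≤ 15 * (14 * Q) := by gcongr
              _ = _ := by ring
          calc Real.exp (-1) / lam * Real.exp (-(lam * p))
              ≤ Real.exp (-1) * (210 * Q) * Real.exp (-(9 / 7) + -Δ m) := by
                rw [e1]
                gcongr
                linarith
            _ = Real.exp (-(9 / 7) + -1) * (210 * Q) * Real.exp (-Δ m) := by
                rw [Real.exp_add, Real.exp_add]; ring
            _ ≤ 0.11 * (210 * Q) * Real.exp (-Δ m) := by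
                gcongr; exact exp_neg_sixteen_sevenths_le
            _ = _ := by ring
  have hoff := lintegral_largeEnergy_le (μ := μ) hm hi hσ hc hb hn m₀ ha hB hsize (τ := 3.5)
    (by norm_num)
  rw [← hu] at hoff
  let Z : Ω → ℝ := fun ω => (∑ m ∈ M, W m ω) + K * largeEnergy m₀ ξ (3.5 * u) ω
  have hZm : Measurable Z := (Finset.measurable_sum _ fun m _ => hWm m).add
    ((measurable_largeEnergy hm m₀ _).const_mul K)
  have hW0 : ∀ m ω, 0 ≤ W m ω := fun m ω => le_max_right _ _
  have hsum0 : ∀ ω, 0 ≤ ∑ m ∈ M, W m ω := fun ω => Finset.sum_nonneg fun m _ => hW0 m ω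
  have hoff0 : ∀ ω, 0 ≤ K * largeEnergy m₀ ξ (3.5 * u) ω := fun ω =>
    mul_nonneg hK.le (largeEnergy_nonneg _ _ _ _)
  have hexpnn : 0 ≤ ∑ m ∈ M, Real.exp (-Δ m) := Finset.sum_nonneg fun m _ => (Real.exp_pos _).le
  have hlin : ∫⁻ ω, ENNReal.ofReal (Z ω) ∂μ ≤
      ENNReal.ofReal (23.1 * Q * ∑ m ∈ M, Real.exp (-Δ m) +
        588 * n ^ 2 * Real.exp (-(3.15 * B * Real.log n)) * u ^ 2) := by
    simp only [Z]
    simp_rw [fun ω => ENNReal.ofReal_add (hsum0 ω) (hoff0 ω),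
      fun ω => ENNReal.ofReal_sum_of_nonneg (s := M) (f := fun m => W m ω)
        (fun m _ => hW0 m ω), fun ω => ENNReal.ofReal_mul (q := largeEnergy m₀ ξ (3.5 * u) ω) hK.le]
    rw [lintegral_add_right _ ((measurable_largeEnergy hm m₀ _).ennreal_ofReal.const_mul _),
      lintegral_finsetSum _ fun m _ => (hWm m).ennreal_ofReal,
      ENNReal.ofReal_add (by positivity) (by positivity),
      lintegral_const_mul' _ _ ENNReal.ofReal_ne_top]
    refine add_le_add ?_ ?_
    · rw [Finset.mul_sum, ENNReal.ofReal_sum_of_nonneg fun m _ => by positivity]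
      exact Finset.sum_le_sum hW
    · refine (mul_le_mul_right hoff _).trans ?_
      rw [← ENNReal.ofReal_mul hK.le]
      refine ENNReal.ofReal_le_ofReal ?_
      rw [show (0.9 : ℝ) * 3.5 * B * Real.log n = 3.15 * B * Real.log n by ring]
      calc K * (3.2 * 3.5 ^ 2 * n ^ 2 * Real.exp (-(3.15 * B * Real.log n)) * u ^ 2)
          ≤ 15 * (3.2 * 3.5 ^ 2 * n ^ 2 * Real.exp (-(3.15 * B * Real.log n)) * u ^ 2) := by
            gcongr
        _ = _ := by ring
  obtain ⟨hint, hle⟩ := integrable_and_integral_le hZm (fun ω => add_nonneg (hsum0 ω) (hoff0 ω))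
    (by positivity) hlin
  refine ⟨Z, hint, hle, fun m hmM ω => ?_⟩
  have hpen : 0 ≤ 18 * K * Q * (m.parts.card + Δ m) := by
    have := hΔ m hmM
    positivity
  set g := resid m₀ m f with hg
  have hgm : g ∈ histSpace m₀ := resid_mem (hM_sub m hmM) f
  set x := lsEst m₀ (noise ξ ω) with hx
  have hproj : ∀ t ∈ histSpace m₀, ⟪t, noise ξ ω⟫_ℝ = ⟪t, x⟫_ℝ := fun t ht => by
    have := inner_sub_lsEst m₀ (noise ξ ω) ht
    rw [real_inner_comm, inner_sub_right] at this
    linarith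
  by_cases hω : ∀ i, |x i| ≤ 3.5 * u
  · have h1 := linear_le_truncate g x (T := 7 * u * K) hK (fun i => by
      have := hω i
      nlinarith)
    rw [← hproj _ hgm, ← hproj _ (truncate_mem hgm)] at h1
    have h2 : W m ω ≤ ∑ m ∈ M, W m ω :=
      Finset.single_le_sum (f := fun m => W m ω) (fun m _ => hW0 m ω) hmM
    have h3 : X m ω - 18 * K * Q * (m.parts.card + Δ m) ≤ W m ω := le_max_left _ _
    have h4 := hoff0 ω
    simp only [Z]
    have h5 : X m ω = -(2 * ⟪truncate (7 * u * K) g, noise ξ ω⟫_ℝ) -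
      ‖truncate (7 * u * K) g‖ ^ 2 / K := rfl
    linarith
  · push Not at hω
    obtain ⟨i, hi'⟩ := hω
    have h1 := norm_sq_le_largeEnergy m₀ ξ hi'
    have h2 : -(2 * ⟪g, x⟫_ℝ) - ‖g‖ ^ 2 / K ≤ K * ‖x‖ ^ 2 := by
      have h3 : -⟪g, x⟫_ℝ ≤ ‖g‖ * ‖x‖ := (neg_le_abs _).trans (abs_real_inner_le_norm _ _)
      have h4 : 0 ≤ (‖g‖ - K * ‖x‖) ^ 2 / K := by positivity
      have h5 : (‖g‖ - K * ‖x‖) ^ 2 / K = ‖g‖ ^ 2 / K - 2 * (‖g‖ * ‖x‖) + K * ‖x‖ ^ 2 := by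
        field_simp; ring
      linarith
    rw [hproj _ hgm]
    have := hsum0 ω
    have h6 : K * ‖x‖ ^ 2 ≤ K * largeEnergy m₀ ξ (3.5 * u) ω := by gcongr
    simp only [Z]
    linarith

end LinearSmall

/-! ### Decomposition of the residual over the blocks of a partition. -/

section Blocks

open scoped InnerProductSpace

variable {n : ℕ}

/-- The deviation of a coordinate of `φ` from the mean of `φ` over `I`. -/
def dev (φ : Fin n → ℝ) (I : Finset (Fin n)) (i : Fin n) : ℝ :=
  φ i - (∑ j ∈ I, φ j) / I.card

/-- The energy of the deviations of `φ` from its mean over `I`. -/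
def energy (φ : Fin n → ℝ) (I : Finset (Fin n)) : ℝ := ∑ i ∈ I, dev φ I i ^ 2

lemma energy_nonneg (φ : Fin n → ℝ) (I : Finset (Fin n)) : 0 ≤ energy φ I :=
  Finset.sum_nonneg fun _ _ => sq_nonneg _

lemma resid_apply {m m₀ : Finpartition (Finset.univ : Finset (Fin n))}
    (h : histSpace m ≤ histSpace m₀) (f : EuclideanSpace ℝ (Fin n)) {I : Finset (Fin n)}
    (hI : I ∈ m.parts) {i : Fin n} (hi : i ∈ I) :
    resid m₀ m f i = dev (lsEst m₀ f) I i := by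
  rw [dev, ← lsEst_apply m (lsEst m₀ f) hI hi, lsEst_lsEst_of_le h, resid, PiLp.sub_apply]

lemma norm_sq_resid {m m₀ : Finpartition (Finset.univ : Finset (Fin n))}
    (h : histSpace m ≤ histSpace m₀) (f : EuclideanSpace ℝ (Fin n)) :
    ‖resid m₀ m f‖ ^ 2 = ∑ I ∈ m.parts, energy (lsEst m₀ f) I := by
  rw [EuclideanSpace.norm_sq_eq, ← sum_parts m]
  refine Finset.sum_congr rfl fun I hI => Finset.sum_congr rfl fun i hi => ?_
  rw [resid_apply h f hI hi, Real.norm_eq_abs, sq_abs]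

lemma inner_resid_noise {Ω : Type*} {m m₀ : Finpartition (Finset.univ : Finset (Fin n))}
    (h : histSpace m ≤ histSpace m₀) (f : EuclideanSpace ℝ (Fin n)) (ξ : Fin n → Ω → ℝ) (ω : Ω) :
    ⟪resid m₀ m f, noise ξ ω⟫_ℝ =
      ∑ I ∈ m.parts, ∑ i ∈ I, dev (lsEst m₀ f) I i * ξ i ω := by
  have e : ⟪resid m₀ m f, noise ξ ω⟫_ℝ = ∑ i, resid m₀ m f i * ξ i ω := by
    rw [PiLp.inner_apply]
    simp [noise, mul_comm]
  rw [e, ← sum_parts m]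
  refine Finset.sum_congr rfl fun I hI => Finset.sum_congr rfl fun i hi => ?_
  rw [resid_apply h f hI hi]

/-- A set of indices which does not separate the elements of any block. -/
def Saturated (m₀ : Finpartition (Finset.univ : Finset (Fin n))) (I : Finset (Fin n)) : Prop :=
  ∀ J ∈ m₀.parts, ∀ i ∈ J, i ∈ I → J ⊆ I

/-- The indicator of a block of `m` lies in `histSpace m`, hence is constant on every block of `m₀`.
-/
lemma saturated_of_mem {m m₀ : Finpartition (Finset.univ : Finset (Fin n))}
    (h : histSpace m ≤ histSpace m₀) {I : Finset (Fin n)} (hI : I ∈ m.parts) :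
    Saturated m₀ I := by
  intro J hJ i hiJ hiI j hjJ
  let t : EuclideanSpace ℝ (Fin n) := WithLp.toLp 2 fun j => if j ∈ I then 1 else 0
  have ht : t ∈ histSpace m := by
    intro J hJ a ha b hb
    by_cases hJI : J = I
    · subst hJI; simp [t, ha, hb]
    · have hd : Disjoint J I := m.disjoint hJ hI hJI
      simp [t, Finset.disjoint_left.1 hd ha, Finset.disjoint_left.1 hd hb]
  have h1 := h ht J hJ i hiJ j hjJ
  by_contra hj
  simp [t, hiI, hj] at h1

lemma exists_eq_Icc {m : Finpartition (Finset.univ : Finset (Fin n))} (hm : IsConsecutive m)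
    {I : Finset (Fin n)} (hI : I ∈ m.parts) : ∃ i j, i ≤ j ∧ I = Finset.Icc i j := by
  have hne := m.nonempty_of_mem_parts hI
  refine ⟨I.min' hne, I.max' hne, I.min'_le_max' hne, ?_⟩
  ext k
  rw [Finset.mem_Icc]
  refine ⟨fun hk => ⟨I.min'_le k hk, I.le_max' k hk⟩, fun hk => ?_⟩
  have := (hm I hI).out (I.min'_mem hne) (I.max'_mem hne) hk
  exact_mod_cast this

/-- On a saturated set the square of a blockwise constant vector is dominated by its energy. -/
lemma mul_sq_le_sum_of_saturated {m₀ : Finpartition (Finset.univ : Finset (Fin n))} {ℓ : ℝ}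
    (hℓ : ∀ J ∈ m₀.parts, ℓ ≤ (J.card : ℝ)) {φ : EuclideanSpace ℝ (Fin n)}
    (hφ : φ ∈ histSpace m₀) {I : Finset (Fin n)} (hI : Saturated m₀ I) {i : Fin n} (hi : i ∈ I)
    (b : ℝ) : ℓ * (φ i - b) ^ 2 ≤ ∑ j ∈ I, (φ j - b) ^ 2 := by
  have hJ := m₀.part_mem.2 (Finset.mem_univ i)
  have hiJ := m₀.mem_part (Finset.mem_univ i)
  have hsub := hI _ hJ i hiJ hi
  calc ℓ * (φ i - b) ^ 2 ≤ (m₀.part i).card * (φ i - b) ^ 2 := by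
        gcongr; exact hℓ _ hJ
    _ = ∑ j ∈ m₀.part i, (φ j - b) ^ 2 := by
        rw [← nsmul_eq_mul, ← Finset.sum_const]
        exact Finset.sum_congr rfl fun j hj => by rw [hφ _ hJ i hiJ j hj]
    _ ≤ _ := Finset.sum_le_sum_of_subset_of_nonneg hsub fun _ _ _ => sq_nonneg _

/-- Swapping coordinates matches the two orders, which together fit in the off-diagonal. -/
lemma card_pairs_lt : ((Finset.univ : Finset (Fin n × Fin n)).filter fun p => p.1 < p.2).card ≤
    n * (n - 1) / 2 := by
  have h1 : ((Finset.univ : Finset (Fin n × Fin n)).filter fun p => p.1 < p.2).card =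
      ((Finset.univ : Finset (Fin n × Fin n)).filter fun p => p.2 < p.1).card := by
    refine Finset.card_bij (fun p _ => p.swap) (fun p hp => ?_) (fun p _ q _ h => ?_)
      (fun p hp => ⟨p.swap, ?_, ?_⟩)
    · simpa using hp
    · exact Prod.swap_injective h
    · simpa using hp
    · simp
  have h2 : ((Finset.univ : Finset (Fin n × Fin n)).filter fun p => p.1 < p.2).card +
      ((Finset.univ : Finset (Fin n × Fin n)).filter fun p => p.2 < p.1).card ≤
      (Finset.univ : Finset (Fin n)).offDiag.card := by
    rw [← Finset.card_union_of_disjoint]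
    · refine Finset.card_le_card fun p hp => ?_
      simp only [Finset.mem_union, Finset.mem_filter, Finset.mem_univ, true_and] at hp
      simp only [Finset.mem_offDiag, Finset.mem_univ, true_and]
      rcases hp with h | h
      · exact h.ne
      · exact h.ne'
    · rw [Finset.disjoint_left]
      intro p hp hq
      simp only [Finset.mem_filter, Finset.mem_univ, true_and] at hp hq
      exact absurd hp (not_lt.2 hq.le)
  rw [Finset.offDiag_card, Finset.card_univ, Fintype.card_fin] at h2
  rw [Nat.mul_sub_one]
  omega

end Blocks

/-! ### The linear term by a union bound over intervals. -/

section Naive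

open scoped InnerProductSpace

variable {Ω : Type*} [MeasurableSpace Ω] {μ : Measure Ω} [IsProbabilityMeasure μ] {n : ℕ}

/-- The positive part of a normalized quadratic excess over one interval. -/
lemma lintegral_sq_excess_le {ξ : Fin n → Ω → ℝ} (hm : ∀ i, Measurable (ξ i))
    (hi : iIndepFun ξ μ) {σ c ℓ : ℝ} (hσ : 0 < σ) (hc : 0 ≤ c) (hℓ : 0 < ℓ)
    (hb : ∀ i, BernsteinBound μ (ξ i) σ c) (I : Finset (Fin n)) (r : Fin n → ℝ)
    (hr : ∀ i ∈ I, ℓ * r i ^ 2 ≤ ∑ j ∈ I, r j ^ 2) {β p q z x : ℝ} (hp : 0 < p) (hq : 1 < q)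
    (hβ : β = p * σ + q * (c / √ℓ)) (hz : x * β ≤ z) (hx : 2 ≤ x) :
    ∫⁻ ω, ENNReal.ofReal ((∑ i ∈ I, r i * ξ i ω) ^ 2 / (∑ i ∈ I, r i ^ 2) - z ^ 2) ∂μ ≤
      ENNReal.ofReal (z ^ 2 * (2 * Real.exp (1 / (2 * p ^ 2) - x))) := by
  set V := ∑ i ∈ I, r i ^ 2 with hV
  have hV0 : 0 ≤ V := Finset.sum_nonneg fun _ _ => sq_nonneg _
  -- When `V = 0` the quotient is zero by convention and the excess is nonpositive.
  rcases hV0.eq_or_lt with h0 | hVpos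
  · rw [← h0]
    have : ∀ y : ℝ, ENNReal.ofReal (y ^ 2 / 0 - z ^ 2) = 0 := fun y => by
      rw [ENNReal.ofReal_eq_zero, div_zero]; linarith [sq_nonneg z]
    simp_rw [this]
    simp
  set d := c / √ℓ with hd
  have hd0 : 0 ≤ d := by positivity
  have hβ0 : 0 < β := by rw [hβ]; positivity
  have hz0 : 0 < z := lt_of_lt_of_le (by positivity) hz
  have hβd : 0 < β - d := by
    have : p * σ > 0 := by positivity
    rw [hβ]; nlinarith
  have hlap : ∀ s : ℝ, |s| = 1 / β →
      ∫⁻ ω, ENNReal.ofReal (Real.exp (∑ i ∈ I, (s * r i / √V) * ξ i ω)) ∂μ ≤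
        ENNReal.ofReal (Real.exp (1 / (2 * p ^ 2))) := by
    intro s hs
    -- By `hr` the normalized coefficients `r i / √V` are at most `1 / √ℓ`: long blocks replace `c`
    -- by `d = c / √ℓ` in the Bernstein condition.
    have hcoef : ∀ i ∈ I, |s * r i / √V| ≤ 1 / (β * √ℓ) := by
      intro i hiI
      have h1 := hr i hiI
      rw [abs_div, abs_mul, hs, abs_of_pos (Real.sqrt_pos.2 hVpos), div_mul_eq_mul_div, one_mul,
        div_div]
      rw [div_le_div_iff₀ (by positivity) (by positivity)]
      have h2 : √ℓ * |r i| ≤ √V := by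
        rw [← Real.sqrt_sq_eq_abs, ← Real.sqrt_mul hℓ.le]
        exact Real.sqrt_le_sqrt h1
      nlinarith
    have hcβ : 1 / (β * √ℓ) * c = d / β := by rw [hd]; field_simp
    have hlt : 1 / (β * √ℓ) * c < 1 := by
      rw [hcβ, div_lt_one hβ0]; linarith
    refine (lintegral_exp_linear_le hm hi hc hb I (fun i => s * r i / √V) hcoef hlt).trans
      (ENNReal.ofReal_le_ofReal (Real.exp_le_exp.2 ?_))
    have hsum : ∑ i ∈ I, (s * r i / √V) ^ 2 = 1 / β ^ 2 := by
      have : ∀ i ∈ I, (s * r i / √V) ^ 2 = 1 / β ^ 2 / V * r i ^ 2 := fun i _ => by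
        rw [div_pow, mul_pow, Real.sq_sqrt hV0, ← sq_abs s, hs]; field_simp
      rw [Finset.sum_congr rfl this, ← Finset.mul_sum, ← hV]
      field_simp
    rw [hsum, hcβ]
    have e1 : σ ^ 2 * (1 / β ^ 2) / (2 * (1 - d / β)) = σ ^ 2 / (2 * (β * (β - d))) := by
      field_simp
    rw [e1, div_le_div_iff₀ (by positivity) (by positivity)]
    -- Both `β` and, because `q > 1`, `β - d` are at least `p σ`, which gives the exponent `1 / (2
    -- p²)`.
    have h1 : p * σ ≤ β := by rw [hβ]; nlinarith
    have h2 : p * σ ≤ β - d := by rw [hβ]; nlinarith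
    have h3 : (p * σ) * (p * σ) ≤ β * (β - d) := by gcongr
    nlinarith
  set X : Ω → ℝ := fun ω => (∑ i ∈ I, r i * ξ i ω) / √V with hX
  have hXs : ∀ (s : ℝ) ω, ∑ i ∈ I, (s * r i / √V) * ξ i ω = s * X ω := fun s ω => by
    rw [hX, mul_div_assoc', Finset.mul_sum, Finset.sum_div]
    exact Finset.sum_congr rfl fun i _ => by ring
  have hXm : Measurable X := (Finset.measurable_sum _ fun i _ => (hm i).const_mul _).div_const _
  have hpt : ∀ ω, ENNReal.ofReal ((∑ i ∈ I, r i * ξ i ω) ^ 2 / V - z ^ 2) ≤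
      ENNReal.ofReal (z ^ 2 * Real.exp (-x)) *
        (ENNReal.ofReal (Real.exp (1 / β * X ω)) + ENNReal.ofReal (Real.exp (-(1 / β) * X ω))) := by
    intro ω
    rw [← ENNReal.ofReal_add (Real.exp_pos _).le (Real.exp_pos _).le,
      ← ENNReal.ofReal_mul (by positivity)]
    refine ENNReal.ofReal_le_ofReal ?_
    have e : (∑ i ∈ I, r i * ξ i ω) ^ 2 / V = X ω ^ 2 := by
      rw [hX, div_pow, Real.sq_sqrt hV0]
    rw [e]
    by_cases h : z ≤ |X ω|
    · have h2 : x ≤ 1 / β * z := by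
        rw [div_mul_eq_mul_div, one_mul, le_div_iff₀ hβ0]; exact hz
      have h1 := sq_le_of_le_abs hz0 (γ := 1 / β) (hx.trans h2) h
      have h3 : Real.exp (-(1 / β * z)) ≤ Real.exp (-x) := Real.exp_le_exp.2 (by linarith)
      calc X ω ^ 2 - z ^ 2 ≤ X ω ^ 2 := by linarith [sq_nonneg z]
        _ ≤ _ := h1
        _ ≤ _ := by rw [neg_mul]; gcongr
    · have h1 : X ω ^ 2 ≤ z ^ 2 := by
        rw [← sq_abs]
        have := (not_le.1 h).le
        gcongr
      have : 0 ≤ z ^ 2 * Real.exp (-x) * (Real.exp (1 / β * X ω) + Real.exp (-(1 / β) * X ω)) := by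
        positivity
      linarith
  have hE : ∀ s : ℝ, |s| = 1 / β → ∫⁻ ω, ENNReal.ofReal (Real.exp (s * X ω)) ∂μ ≤
      ENNReal.ofReal (Real.exp (1 / (2 * p ^ 2))) := fun s hs => by
    have := hlap s hs
    simp_rw [hXs] at this
    exact this
  have hmeas : Measurable fun ω => ENNReal.ofReal (Real.exp (1 / β * X ω)) :=
    (Real.measurable_exp.comp (hXm.const_mul _)).ennreal_ofReal
  refine (lintegral_mono hpt).trans ?_
  rw [lintegral_const_mul' _ _ ENNReal.ofReal_ne_top, lintegral_add_left hmeas]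
  refine (mul_le_mul_right (add_le_add (hE _ (abs_of_pos (by positivity)))
    (hE _ (by rw [abs_neg]; exact abs_of_pos (by positivity)))) _).trans ?_
  rw [← ENNReal.ofReal_add (by positivity) (by positivity), ← ENNReal.ofReal_mul (by positivity)]
  refine ENNReal.ofReal_le_ofReal (le_of_eq ?_)
  rw [sub_eq_add_neg, Real.exp_add]; ring

/-- Linear terms are controlled by a union bound over intervals. -/
theorem exists_bound_linear_of_union {ξ : Fin n → Ω → ℝ} (hm : ∀ i, Measurable (ξ i))
    (hi : iIndepFun ξ μ) {σ c ℓ : ℝ} (hσ : 0 < σ) (hc : 0 ≤ c) (hℓ : 0 < ℓ)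
    (hb : ∀ i, BernsteinBound μ (ξ i) σ c) (hn : 2 ≤ n)
    (m₀ : Finpartition (Finset.univ : Finset (Fin n)))
    (hsize : ∀ I ∈ m₀.parts, ℓ ≤ (I.card : ℝ))
    (M : Finset (Finpartition (Finset.univ : Finset (Fin n))))
    (hM_cons : ∀ m ∈ M, IsConsecutive m)
    (hM_sub : ∀ m ∈ M, histSpace m ≤ histSpace m₀)
    (f : EuclideanSpace ℝ (Fin n)) {K κ F F' G p q x : ℝ} (hK : 0 < K) (hκ : 0 < κ)
    (hp : 0 < p) (hq : 1 < q) (hx : 2 ≤ x) (hF' : 0 ≤ F')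
    (hz : (x * (p * σ + q * (c / √ℓ))) ^ 2 ≤ κ * F')
    (hG : (n * (n - 1) / 2 : ℝ) * (F' * (2 * Real.exp (1 / (2 * p ^ 2) - x))) ≤ G)
    (hF : F' + G ≤ F) :
    ∃ Z : Ω → ℝ, Integrable Z μ ∧ ∫ ω, Z ω ∂μ ≤ 0 ∧
      ∀ m ∈ M, ∀ ω, -(2 * ⟪resid m₀ m f, noise ξ ω⟫_ℝ) - κ / K * ‖resid m₀ m f‖ ^ 2 -
        K * F * m.parts.card ≤ Z ω := by
  classical
  set φ := lsEst m₀ f with hφ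
  have hφm : φ ∈ histSpace m₀ := lsEst_mem m₀ f
  -- One-point intervals have zero energy and need no control, so only `n (n - 1) / 2` intervals
  -- count.
  let P : Finset (Fin n × Fin n) := Finset.univ.filter fun p =>
    p.1 < p.2 ∧ Saturated m₀ (Finset.Icc p.1 p.2)
  have hPcard : (P.card : ℝ) ≤ n * (n - 1) / 2 := by
    have h1 : P.card ≤ n * (n - 1) / 2 := by
      refine (Finset.card_le_card fun p hp => ?_).trans card_pairs_lt
      simp only [P, Finset.mem_filter] at hp ⊢
      exact ⟨hp.1, hp.2.1⟩
    have h2 : ((n * (n - 1) / 2 : ℕ) : ℝ) ≤ ((n * (n - 1) : ℕ) : ℝ) / 2 := Nat.cast_div_le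
    rw [Nat.cast_mul, Nat.cast_sub (by omega)] at h2
    push_cast at h2
    exact (by exact_mod_cast h1 : (P.card : ℝ) ≤ ((n * (n - 1) / 2 : ℕ) : ℝ)).trans h2
  let W (p : Fin n × Fin n) (ω : Ω) : ℝ :=
    max ((∑ i ∈ Finset.Icc p.1 p.2, dev φ (Finset.Icc p.1 p.2) i * ξ i ω) ^ 2 /
      energy φ (Finset.Icc p.1 p.2) - κ * F') 0
  have hWm : ∀ p, Measurable (W p) := fun p =>
    ((((Finset.measurable_sum _ fun i _ => (hm i).const_mul _).pow_const 2).div_const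
      _).sub_const _).max measurable_const
  have hW0 : ∀ p ω, 0 ≤ W p ω := fun p ω => le_max_right _ _
  have hβ0 : 0 < p * σ + q * (c / √ℓ) := by positivity
  have hκF : 0 ≤ κ * F' := by positivity
  have hWE : ∀ e ∈ P, ∫⁻ ω, ENNReal.ofReal (W e ω) ∂μ ≤
      ENNReal.ofReal (κ * F' * (2 * Real.exp (1 / (2 * p ^ 2) - x))) := by
    intro e he
    have hsat : Saturated m₀ (Finset.Icc e.1 e.2) := (Finset.mem_filter.1 he).2.2
    have h := lintegral_sq_excess_le hm hi hσ hc hℓ hb (Finset.Icc e.1 e.2)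
      (dev φ (Finset.Icc e.1 e.2))
      (fun i hiI => mul_sq_le_sum_of_saturated hsize hφm hsat hiI _) hp hq rfl
      (z := √(κ * F')) (Real.le_sqrt_of_sq_le hz) hx
    rw [Real.sq_sqrt hκF] at h
    refine le_trans (le_of_eq ?_) h
    congr 1; ext ω
    simp [W, ENNReal.ofReal_max, energy]
  have hG0 : 0 ≤ G := le_trans (by
    have : (0 : ℝ) ≤ (n : ℝ) * (n - 1) / 2 := (Nat.cast_nonneg _).trans hPcard
    positivity) hG
  have hlin : ∫⁻ ω, ENNReal.ofReal (∑ e ∈ P, W e ω) ∂μ ≤ ENNReal.ofReal (κ * G) := by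
    simp_rw [fun ω => ENNReal.ofReal_sum_of_nonneg (s := P) (f := fun e => W e ω)
      fun e _ => hW0 e ω]
    rw [lintegral_finsetSum _ fun e _ => (hWm e).ennreal_ofReal]
    refine (Finset.sum_le_sum hWE).trans ?_
    rw [Finset.sum_const, nsmul_eq_mul, ← ENNReal.ofReal_natCast,
      ← ENNReal.ofReal_mul (Nat.cast_nonneg _)]
    refine ENNReal.ofReal_le_ofReal ?_
    calc (P.card : ℝ) * (κ * F' * (2 * Real.exp (1 / (2 * p ^ 2) - x)))
        ≤ (n * (n - 1) / 2 : ℝ) * (κ * F' * (2 * Real.exp (1 / (2 * p ^ 2) - x))) := by gcongr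
      _ = κ * ((n * (n - 1) / 2 : ℝ) * (F' * (2 * Real.exp (1 / (2 * p ^ 2) - x)))) := by ring
      _ ≤ κ * G := by gcongr
  obtain ⟨hint, hle⟩ := integrable_and_integral_le
    (Finset.measurable_sum P fun e _ => hWm e)
    (fun ω => Finset.sum_nonneg fun e _ => hW0 e ω) (by positivity) hlin
  -- The sum over intervals involves no partition and has mean at most `κ G`. Subtracting `K G`
  -- makes the mean nonpositive, and the penalty can repay `K G` because a partition has at least
  -- one block.
  refine ⟨fun ω => K / κ * (∑ e ∈ P, W e ω) - K * G, (hint.const_mul _).sub (integrable_const _),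
    ?_, fun m hmM ω => ?_⟩
  · rw [integral_sub (hint.const_mul _) (integrable_const _), integral_const_mul]
    have : K / κ * ∫ ω, ∑ e ∈ P, W e ω ∂μ ≤ K / κ * (κ * G) := by gcongr
    have e : K / κ * (κ * G) = K * G := by field_simp
    simp only [integral_const, probReal_univ, one_smul]
    linarith
  · rw [inner_resid_noise (hM_sub m hmM), norm_sq_resid (hM_sub m hmM)]
    have hblock : ∀ I ∈ m.parts, ∃ V : Finset (Fin n × Fin n), V ⊆ P ∧
        (∀ e ∈ V, Finset.Icc e.1 e.2 = I ∧ e.1 ≤ e.2) ∧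
        -(2 * ∑ i ∈ I, dev φ I i * ξ i ω) - κ / K * energy φ I - K * F' ≤
          K / κ * ∑ e ∈ V, W e ω := by
      intro I hI
      obtain ⟨i, j, hij, rfl⟩ := exists_eq_Icc (hM_cons m hmM) hI
      have hsat := saturated_of_mem (hM_sub m hmM) hI
      set I := Finset.Icc i j with hIdef
      set Y := ∑ k ∈ I, dev φ I k * ξ k ω with hY
      have hen := energy_nonneg φ I
      by_cases hz0 : energy φ I = 0
      · refine ⟨∅, Finset.empty_subset _, by simp, ?_⟩
        have : Y = 0 := Finset.sum_eq_zero fun k hk => by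
          have h1 := (Finset.sum_eq_zero_iff_of_nonneg fun _ _ => sq_nonneg _).1 hz0 k hk
          have h2 : dev φ I k = 0 := by simpa using h1
          rw [h2, zero_mul]
        rw [this, hz0]
        have : 0 ≤ K * F' := by positivity
        simpa using this
      · have hpos : 0 < energy φ I := lt_of_le_of_ne hen (Ne.symm hz0)
        have hlt : i < j := by
          refine lt_of_le_of_ne hij fun h => hz0 ?_
          subst h
          simp [energy, hIdef, dev]
        refine ⟨{(i, j)}, ?_, ?_, ?_⟩
        · simp only [Finset.singleton_subset_iff, P, Finset.mem_filter, Finset.mem_univ, true_and]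
          exact ⟨hlt, hsat⟩
        · intro e he
          rw [Finset.mem_singleton] at he
          subst he
          exact ⟨rfl, hij⟩
        · rw [Finset.sum_singleton]
          have h1 : Y ^ 2 / energy φ I - κ * F' ≤ W (i, j) ω := le_max_left _ _
          have h2 : K / κ * (Y ^ 2 / energy φ I - κ * F') ≤ K / κ * W (i, j) ω := by gcongr
          -- This square encodes `-2 Y ≤ (κ / K) * energy + (K / κ) * Y² / energy`.
          have h3 : 0 ≤ (K * Y + κ * energy φ I) ^ 2 / (K * κ * energy φ I) := by positivity
          have h4 : (K * Y + κ * energy φ I) ^ 2 / (K * κ * energy φ I) =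
              K / κ * (Y ^ 2 / energy φ I - κ * F') + K * F' + 2 * Y + κ / K * energy φ I := by
            field_simp; ring
          linarith
    choose! V hVP hVI hVle using hblock
    have hdisj : (m.parts : Set (Finset (Fin n))).PairwiseDisjoint V := by
      intro I hI J hJ hne
      refine Finset.disjoint_left.2 fun e he he' => hne ?_
      rw [← (hVI I hI e he).1, (hVI J hJ e he').1]
    have hsum : ∑ I ∈ m.parts, ∑ e ∈ V I, W e ω ≤ ∑ e ∈ P, W e ω := by
      rw [← Finset.sum_biUnion hdisj]
      exact Finset.sum_le_sum_of_subset_of_nonneg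
        (Finset.biUnion_subset.2 fun I hI => hVP I hI) fun e _ _ => hW0 e ω
    have hD : (1 : ℝ) ≤ m.parts.card := by
      have h1 : m.part ⟨0, by omega⟩ ∈ m.parts := m.part_mem.2 (Finset.mem_univ _)
      exact_mod_cast Finset.card_pos.2 ⟨_, h1⟩
    have htot := Finset.sum_le_sum hVle
    rw [← Finset.mul_sum, Finset.sum_sub_distrib, Finset.sum_sub_distrib, Finset.sum_neg_distrib,
      ← Finset.mul_sum, ← Finset.mul_sum, Finset.sum_const, nsmul_eq_mul] at htot
    have h5 : K / κ * ∑ I ∈ m.parts, ∑ e ∈ V I, W e ω ≤ K / κ * ∑ e ∈ P, W e ω := by gcongr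
    have h6 : m.parts.card * (K * F') + K * G ≤ K * F * m.parts.card := by
      calc m.parts.card * (K * F') + K * G ≤ m.parts.card * (K * F') + m.parts.card * (K * G) := by
            have : 0 ≤ K * G := by positivity
            nlinarith
        _ = K * (F' + G) * m.parts.card := by ring
        _ ≤ _ := by gcongr
    linarith

end Naive

/-! ### Geometric sums over finite sets of integer exponents. -/

section Geometric

lemma sum_zpow_le_max {r : ℝ} (hr : 1 < r) (T : Finset ℤ) (K : ℤ) (hT : ∀ k ∈ T, k ≤ K) :
    ∑ k ∈ T, r ^ k ≤ r / (r - 1) * r ^ K := by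
  have hr0 : 0 < r := by linarith
  have hr1 : 0 < r - 1 := by linarith
  induction T using Finset.induction_on_max generalizing K with
  | empty => simp only [Finset.sum_empty]; positivity
  | insert a s ha ih =>
    rw [Finset.sum_insert fun h => lt_irrefl _ (ha a h)]
    have h1 := ih (a - 1) fun k hk => by have := ha k hk; omega
    have h2 : r ^ a ≤ r ^ K := zpow_le_zpow_right₀ hr.le (hT a (Finset.mem_insert_self _ _))
    rw [zpow_sub_one₀ hr0.ne'] at h1
    have h3 : r / (r - 1) * (r ^ a * r⁻¹) + r ^ a = r / (r - 1) * r ^ a := by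
      field_simp; ring
    have h4 : r / (r - 1) * r ^ a ≤ r / (r - 1) * r ^ K := by gcongr
    linarith

lemma sum_zpow_le {r : ℝ} (hr : 1 < r) (T : Finset ℤ) {X : ℝ} (hX : 0 ≤ X)
    (hT : ∀ k ∈ T, r ^ k ≤ X) : ∑ k ∈ T, r ^ k ≤ r / (r - 1) * X := by
  have hr1 : 0 < r - 1 := by linarith
  rcases T.eq_empty_or_nonempty with rfl | hne
  · simp only [Finset.sum_empty]; positivity
  · refine (sum_zpow_le_max hr T (T.max' hne) fun k hk => T.le_max' k hk).trans ?_
    have := hT _ (T.max'_mem hne)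
    gcongr

lemma sum_inv_zpow_le {r : ℝ} (hr : 1 < r) (T : Finset ℤ) {X : ℝ} (hX : 0 < X)
    (hT : ∀ k ∈ T, X ≤ r ^ k) : ∑ k ∈ T, (r ^ k)⁻¹ ≤ r / (r - 1) * X⁻¹ := by
  have h := sum_zpow_le hr (T.image Neg.neg) (inv_nonneg.2 hX.le) (by
    intro k hk
    obtain ⟨j, hj, rfl⟩ := Finset.mem_image.1 hk
    rw [zpow_neg]
    have := hT j hj
    gcongr)
  rw [Finset.sum_image neg_injective.injOn] at h
  simpa [zpow_neg] using h

end Geometric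

/-! ### Maximal inequalities for weighted partial sums. -/

section Maximal

variable {Ω : Type*} [MeasurableSpace Ω] {μ : Measure Ω} [IsProbabilityMeasure μ]
  {ι : Type*} [DecidableEq ι] {η : ι → Ω → ℝ}

/-- Maximal inequality for the partial sums of a weighted independent sequence. -/
lemma measure_exists_abs_sum_ge_le (hm : ∀ i, Measurable (η i)) (hi : iIndepFun η μ)
    (hint : ∀ i, Integrable (η i) μ) (h0 : ∀ i, ∫ ω, η i ω ∂μ = 0) {Λ ℓ : ℝ} (hΛ : 0 ≤ Λ)
    (hη : ∀ i (t : ℝ), ℓ * t ^ 2 ≤ Λ ^ 2 → ∫⁻ ω, ENNReal.ofReal (Real.exp (t * η i ω)) ∂μ ≤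
      ENNReal.ofReal (Real.exp (t ^ 2 / 2)))
    {N : ℕ} {k : ℕ → ι} (hk : Set.InjOn k (Set.Iio N)) (v : ℕ → ℝ) (s : Finset ℕ)
    (hs : ∀ i ∈ s, i ≤ N) {w : ℝ} (hw : 0 < w)
    (hV : ∀ i ∈ s, ∑ j ∈ Finset.range i, v j ^ 2 ≤ w ^ 2)
    (hv : ∀ i ∈ s, ∀ j < i, ℓ * v j ^ 2 ≤ w ^ 2) (y : ℝ) :
    μ {ω | ∃ i ∈ s, w * y ≤ |∑ j ∈ Finset.range i, v j * η (k j) ω|} ≤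
      ENNReal.ofReal (2 * Real.exp (Λ ^ 2 / 2 - Λ * y)) := by
  rcases s.eq_empty_or_nonempty with rfl | hne
  · simp
  set N' := s.max' hne with hN'
  have hN's : N' ∈ s := s.max'_mem hne
  have hk' : Set.InjOn k (Set.Iio N') :=
    hk.mono fun x hx => lt_of_lt_of_le (Set.mem_Iio.1 hx) (hs _ hN's)
  -- A single exponential parameter, `Λ / w`, is used: by `hv` it keeps every weight in the range
  -- where the Laplace transforms are Gaussian. The number `e` is the sign of the sum.
  have key : ∀ e : ℝ, e ^ 2 = 1 → μ {ω | ∃ i ≤ N', Λ * y ≤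
      ∑ j ∈ Finset.range i, (e * Λ / w * v j) * η (k j) ω} ≤
      ENNReal.ofReal (Real.exp (Λ ^ 2 / 2 - Λ * y)) := by
    intro e he
    refine (maximal_exp hm hi hint h0 N' k hk' (fun j => e * Λ / w * v j)
      (fun j => (Λ / w * v j) ^ 2 / 2) (fun j hj => ?_) (Λ * y)).trans
      (ENNReal.ofReal_le_ofReal (Real.exp_le_exp.2 ?_))
    · have e1 : (e * Λ / w * v j) ^ 2 = (Λ / w * v j) ^ 2 := by
        rw [mul_div_assoc, mul_assoc, mul_pow, he, one_mul]
      rw [← e1]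
      refine hη _ _ ?_
      rw [e1]
      have h1 := hv _ hN's j hj
      have h2 : ℓ * (Λ / w * v j) ^ 2 = Λ ^ 2 * (ℓ * v j ^ 2 / w ^ 2) := by field_simp
      rw [h2]
      have h3 : ℓ * v j ^ 2 / w ^ 2 ≤ 1 := by rw [div_le_one (by positivity)]; exact h1
      exact mul_le_of_le_one_right (sq_nonneg Λ) h3
    · have h1 := hV _ hN's
      have h2 : ∑ j ∈ Finset.range N', (Λ / w * v j) ^ 2 / 2 =
          Λ ^ 2 / 2 * ((∑ j ∈ Finset.range N', v j ^ 2) / w ^ 2) := by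
        rw [Finset.sum_div, Finset.mul_sum]
        exact Finset.sum_congr rfl fun j _ => by field_simp
      rw [h2]
      have h3 : (∑ j ∈ Finset.range N', v j ^ 2) / w ^ 2 ≤ 1 := by
        rw [div_le_one (by positivity)]; exact h1
      nlinarith [sq_nonneg Λ]
  have hsub : {ω | ∃ i ∈ s, w * y ≤ |∑ j ∈ Finset.range i, v j * η (k j) ω|} ⊆
      {ω | ∃ i ≤ N', Λ * y ≤ ∑ j ∈ Finset.range i, (1 * Λ / w * v j) * η (k j) ω} ∪
      {ω | ∃ i ≤ N', Λ * y ≤ ∑ j ∈ Finset.range i, (-1 * Λ / w * v j) * η (k j) ω} := by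
    rintro ω ⟨i, his, hω⟩
    have hfac : ∀ e : ℝ, ∑ j ∈ Finset.range i, (e * Λ / w * v j) * η (k j) ω =
        e * Λ / w * ∑ j ∈ Finset.range i, v j * η (k j) ω := fun e => by
      rw [Finset.mul_sum]; exact Finset.sum_congr rfl fun j _ => by ring
    have hmul : Λ * y ≤ Λ / w * |∑ j ∈ Finset.range i, v j * η (k j) ω| := by
      calc Λ * y = Λ / w * (w * y) := by field_simp
        _ ≤ _ := by gcongr
    rcases abs_cases (∑ j ∈ Finset.range i, v j * η (k j) ω) with ⟨h, _⟩ | ⟨h, _⟩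
    · refine Or.inl ⟨i, s.le_max' i his, ?_⟩
      rw [hfac, one_mul]
      rwa [h] at hmul
    · refine Or.inr ⟨i, s.le_max' i his, ?_⟩
      rw [hfac]
      rw [h] at hmul
      have : -1 * Λ / w = -(Λ / w) := by ring
      rw [this]
      linarith
  refine (measure_mono hsub).trans ((measure_union_le _ _).trans ?_)
  refine (add_le_add (key 1 (by norm_num)) (key (-1) (by norm_num))).trans ?_
  rw [← ENNReal.ofReal_add (by positivity) (by positivity), two_mul]

/-- It follows from `log s ≤ s - 1` at `s = 1 / √v`. Raising a deviation level by `1 / √v` thus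
gains a factor `v` in probability, which makes the later sums over classes converge. -/
lemma exp_neg_div_sqrt_le {v z : ℝ} (hv : 0 < v) (hv1 : v ≤ 1) (hz : 2 ≤ z) :
    Real.exp (-(z / √v)) ≤ v * Real.exp (-z) := by
  have hs : 0 < √v := Real.sqrt_pos.2 hv
  have hs1 : √v ≤ 1 := Real.sqrt_le_one.2 hv1
  have hlog : -Real.log v ≤ 2 * (1 / √v - 1) := by
    have h1 := Real.log_le_sub_one_of_pos (x := 1 / √v) (by positivity)
    rw [one_div, Real.log_inv, Real.log_sqrt hv.le] at h1
    rw [one_div]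
    linarith
  have h2 : 2 * (1 / √v - 1) ≤ z * (1 / √v - 1) := by
    have : 1 ≤ 1 / √v := by rw [le_div_iff₀ hs]; linarith
    gcongr
  calc Real.exp (-(z / √v)) ≤ Real.exp (Real.log v + -z) := by
        refine Real.exp_le_exp.2 ?_
        have : z / √v = z * (1 / √v) := by ring
        rw [this]; linarith
    _ = v * Real.exp (-z) := by rw [Real.exp_add, Real.exp_log hv]

/-- Maximal inequality for partial sums multiplied by a small factor. -/
lemma measure_exists_mul_abs_sum_ge_le (hm : ∀ i, Measurable (η i)) (hi : iIndepFun η μ)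
    (hint : ∀ i, Integrable (η i) μ) (h0 : ∀ i, ∫ ω, η i ω ∂μ = 0) {Λ ℓ : ℝ} (hΛ : 0 ≤ Λ)
    (hη : ∀ i (t : ℝ), ℓ * t ^ 2 ≤ Λ ^ 2 → ∫⁻ ω, ENNReal.ofReal (Real.exp (t * η i ω)) ∂μ ≤
      ENNReal.ofReal (Real.exp (t ^ 2 / 2)))
    {N : ℕ} {k : ℕ → ι} (hk : Set.InjOn k (Set.Iio N)) (s : Finset ℕ)
    (hs : ∀ i ∈ s, i ≤ N) {W : ℝ} (hW : 0 < W) (hsW : ∀ i ∈ s, (i : ℝ) ≤ W) (hℓW : ℓ ≤ W)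
    {ρ w v y : ℝ} (hρ : 0 ≤ ρ) (hw : 0 < w) (hv : 0 < v) (hv1 : v ≤ 1)
    (hρv : ρ ^ 2 * W ≤ v * w ^ 2) (hy : 2 ≤ Λ * y) :
    μ {ω | ∃ i ∈ s, w * y ≤ ρ * |∑ j ∈ Finset.range i, η (k j) ω|} ≤
      ENNReal.ofReal (2 * v * Real.exp (Λ ^ 2 / 2 - Λ * y)) := by
  have h := measure_exists_abs_sum_ge_le hm hi hint h0 hΛ hη hk (fun _ => 1) s hs
    (w := √W) (Real.sqrt_pos.2 hW)
    (fun i his => by rw [Real.sq_sqrt hW.le]; simpa using hsW i his)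
    (fun i _ j _ => by rw [Real.sq_sqrt hW.le]; simpa using hℓW) (y / √v)
  have hy0 : 0 < y := by
    by_contra hneg
    have := mul_nonpos_of_nonneg_of_nonpos hΛ (not_lt.1 hneg)
    linarith
  refine (measure_mono ?_).trans (h.trans (ENNReal.ofReal_le_ofReal ?_))
  · rintro ω ⟨i, his, hω⟩
    refine ⟨i, his, ?_⟩
    simp only [one_mul]
    set A := |∑ j ∈ Finset.range i, η (k j) ω|
    have hA : 0 ≤ A := abs_nonneg _
    have h1 : ρ * √W ≤ √v * w := by
      have h2 : √(ρ ^ 2 * W) ≤ √(v * w ^ 2) := Real.sqrt_le_sqrt hρv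
      rwa [Real.sqrt_mul (sq_nonneg ρ), Real.sqrt_sq hρ, Real.sqrt_mul hv.le,
        Real.sqrt_sq hw.le] at h2
    have hρ0 : 0 < ρ := by
      refine lt_of_le_of_ne hρ fun h => ?_
      rw [← h, zero_mul] at hω
      have : 0 < w * y := by positivity
      linarith
    have hsv : 0 < √v := Real.sqrt_pos.2 hv
    rw [mul_div_assoc', div_le_iff₀ hsv]
    refine le_of_mul_le_mul_left ?_ hρ0
    calc ρ * (√W * y) = ρ * √W * y := by ring
      _ ≤ √v * w * y := by gcongr
      _ = √v * (w * y) := by ring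
      _ ≤ √v * (ρ * A) := by gcongr
      _ = ρ * (A * √v) := by ring
  · have h3 := exp_neg_div_sqrt_le hv hv1 hy
    rw [sub_eq_add_neg, sub_eq_add_neg, Real.exp_add, Real.exp_add, mul_div_assoc']
    calc 2 * (Real.exp (Λ ^ 2 / 2) * Real.exp (-(Λ * y / √v)))
        ≤ 2 * (Real.exp (Λ ^ 2 / 2) * (v * Real.exp (-(Λ * y)))) := by gcongr
      _ = _ := by ring

end Maximal

/-! ### Total size of the deviations of window means. -/

section LayerCake

/-- If `2 |t| < ρ`, the first term is enough. Only the scales `ρ ≤ 2 |t|` keep a term linear in `ρ`,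
which can be summed over scales. -/
lemma abs_le_half_add {ρ t : ℝ} (hρ : 0 ≤ ρ) :
    ρ * |t| ≤ ρ ^ 2 / 2 + if ρ ≤ 2 * |t| then ρ * |t| else 0 := by
  split_ifs with h
  · nlinarith [sq_nonneg ρ]
  · nlinarith [not_le.1 h]

/-- A geometric sum of ratio `9 / 8` is at most `9` times its largest admissible term `2 |t|`. -/
lemma sum_zpow_mul_abs_le (T : Finset ℤ) (t : ℝ) :
    ∑ k ∈ T, (if (9 / 8 : ℝ) ^ k ≤ 2 * |t| then (9 / 8 : ℝ) ^ k * |t| else 0) ≤ 18 * t ^ 2 := by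
  rw [← Finset.sum_filter, ← Finset.sum_mul]
  have h := sum_zpow_le (r := 9 / 8) (by norm_num) (T.filter fun k => (9 / 8 : ℝ) ^ k ≤ 2 * |t|)
    (X := 2 * |t|) (by positivity) (fun k hk => (Finset.mem_filter.1 hk).2)
  calc _ ≤ (9 / 8 / (9 / 8 - 1) * (2 * |t|)) * |t| := by gcongr
    _ = 18 * |t| ^ 2 := by ring
    _ = _ := by rw [sq_abs]

/-- A layer-cake bound for the dyadic sizes of the deviations of window means. -/
lemma sum_zpow_sq_mul_le (T : Finset ℤ) (a b : ℕ → ℝ) (u : ℝ) (i j : ℤ → ℕ) (c : ℤ → ℝ)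
    (I J : ℕ) (hi : ∀ k ∈ T, i k ≤ I) (hj : ∀ k ∈ T, j k ≤ J)
    (hmean : ∀ k ∈ T, ∑ l ∈ Finset.range (i k), (a l - c k) +
      ∑ l ∈ Finset.range (j k), (b l - c k) = 0)
    (hc : ∀ k ∈ T, (9 / 8 : ℝ) ^ k ≤ |c k - u|) :
    ∑ k ∈ T, ((9 / 8 : ℝ) ^ k) ^ 2 * (i k + j k) ≤
      36 * (∑ l ∈ Finset.range I, (a l - u) ^ 2 + ∑ l ∈ Finset.range J, (b l - u) ^ 2) := by
  let h (k : ℤ) (t : ℝ) : ℝ := if (9 / 8 : ℝ) ^ k ≤ 2 * |t| then (9 / 8 : ℝ) ^ k * |t| else 0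
  have hh : ∀ k t, 0 ≤ h k t := fun k t => by
    simp only [h]; split_ifs
    · positivity
    · exact le_rfl
  have hstep : ∀ k ∈ T, ((9 / 8 : ℝ) ^ k) ^ 2 * (i k + j k) ≤
      2 * (∑ l ∈ Finset.range I, h k (a l - u) + ∑ l ∈ Finset.range J, h k (b l - u)) := by
    intro k hk
    set ρ := (9 / 8 : ℝ) ^ k with hρ
    have hρ0 : 0 < ρ := by positivity
    -- As `c k` is the mean over its window, its distance to `u` times the length is at most the sum
    -- of the distances of the values to `u`.
    have h1 : (c k - u) * (i k + j k) = ∑ l ∈ Finset.range (i k), (a l - u) +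
        ∑ l ∈ Finset.range (j k), (b l - u) := by
      have := hmean k hk
      simp only [Finset.sum_sub_distrib, Finset.sum_const, Finset.card_range, nsmul_eq_mul] at *
      linarith
    have h2 : ρ * (i k + j k) ≤ ∑ l ∈ Finset.range (i k), |a l - u| +
        ∑ l ∈ Finset.range (j k), |b l - u| := by
      calc ρ * (i k + j k) ≤ |c k - u| * (i k + j k) := by gcongr; exact hc k hk
        _ = |(c k - u) * (i k + j k)| := by
            rw [abs_mul, abs_of_nonneg (by positivity : (0 : ℝ) ≤ i k + j k)]
        _ ≤ _ := by
            rw [h1]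
            exact (abs_add_le _ _).trans (add_le_add (Finset.abs_sum_le_sum_abs _ _)
              (Finset.abs_sum_le_sum_abs _ _))
    -- The terms `ρ² / 2` add up to half of the quantity to be bounded and are moved to the left,
    -- hence the factor `2` of `hstep`.
    have h3 : ∀ (x : ℕ → ℝ) (p P : ℕ), p ≤ P → ρ * ∑ l ∈ Finset.range p, |x l| ≤
        p * (ρ ^ 2 / 2) + ∑ l ∈ Finset.range P, h k (x l) := by
      intro x p P hpP
      calc ρ * ∑ l ∈ Finset.range p, |x l| ≤ ∑ l ∈ Finset.range p, (ρ ^ 2 / 2 + h k (x l)) := by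
            rw [Finset.mul_sum]
            exact Finset.sum_le_sum fun l _ => abs_le_half_add hρ0.le
        _ = p * (ρ ^ 2 / 2) + ∑ l ∈ Finset.range p, h k (x l) := by
            rw [Finset.sum_add_distrib]; simp
        _ ≤ _ := by
            have := Finset.sum_le_sum_of_subset_of_nonneg (Finset.range_mono hpP)
              fun l _ _ => hh k (x l)
            linarith
    have h4 := h3 (fun l => a l - u) _ _ (hi k hk)
    have h5 := h3 (fun l => b l - u) _ _ (hj k hk)
    have h6 := mul_le_mul_of_nonneg_left h2 hρ0.le
    rw [mul_add] at h6
    nlinarith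
  have hswap : ∀ (x : ℕ → ℝ) (P : ℕ), ∑ k ∈ T, ∑ l ∈ Finset.range P, h k (x l) ≤
      18 * ∑ l ∈ Finset.range P, x l ^ 2 := by
    intro x P
    rw [Finset.sum_comm, Finset.mul_sum]
    exact Finset.sum_le_sum fun l _ => sum_zpow_mul_abs_le T (x l)
  have h1 := hswap (fun l => a l - u) I
  have h2 := hswap (fun l => b l - u) J
  refine (Finset.sum_le_sum hstep).trans ?_
  rw [← Finset.mul_sum, Finset.sum_add_distrib]
  linarith

end LayerCake

/-! ### Windows around a cut and the noise they carry. -/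

section TwoSided

variable {Ω : Type*} [MeasurableSpace Ω] {μ : Measure Ω} [IsProbabilityMeasure μ]
  {ι : Type*} [DecidableEq ι] {η : ι → Ω → ℝ}

/-- The weighted sum of the noise over a window around a cut. -/
def windowSum (η : ι → Ω → ℝ) (kA kB : ℕ → ι) (a b : ℕ → ℝ) (x : ℝ) (p : ℕ × ℕ) (ω : Ω) : ℝ :=
  ∑ l ∈ Finset.range p.1, (a l - x) * η (kA l) ω + ∑ l ∈ Finset.range p.2, (b l - x) * η (kB l) ω

lemma abs_windowSum_le (kA kB : ℕ → ι) (a b : ℕ → ℝ) {x c ρ : ℝ} (hρ : |c - x| ≤ ρ)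
    (p : ℕ × ℕ) (ω : Ω) :
    |windowSum η kA kB a b c p ω| ≤ |∑ l ∈ Finset.range p.1, (a l - x) * η (kA l) ω| +
      |∑ l ∈ Finset.range p.2, (b l - x) * η (kB l) ω| +
      (ρ * |∑ l ∈ Finset.range p.1, η (kA l) ω| + ρ * |∑ l ∈ Finset.range p.2, η (kB l) ω|) := by
  have e : windowSum η kA kB a b c p ω = ∑ l ∈ Finset.range p.1, (a l - x) * η (kA l) ω +
      ∑ l ∈ Finset.range p.2, (b l - x) * η (kB l) ω -
      ((c - x) * ∑ l ∈ Finset.range p.1, η (kA l) ω +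
        (c - x) * ∑ l ∈ Finset.range p.2, η (kB l) ω) := by
    simp only [windowSum, sub_mul, Finset.sum_sub_distrib, ← Finset.mul_sum]
    ring
  rw [e]
  refine (abs_sub _ _).trans (add_le_add (abs_add_le _ _) ((abs_add_le _ _).trans ?_))
  rw [abs_mul, abs_mul]
  gcongr

/-- Data for the windows around a cut: their energies are at most `8 w²`, and the blocks on which
the signal is constant are long. -/
structure WindowFamily (ℓ w : ℝ) (NA NB : ℕ) (a b : ℕ → ℝ) (P : Finset (ℕ × ℕ))
    (c : ℕ × ℕ → ℝ) : Prop where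
  le_left : ∀ p ∈ P, p.1 ≤ NA
  le_right : ∀ p ∈ P, p.2 ≤ NB
  right_le_left : ∀ p ∈ P, p.2 ≤ p.1
  length_right : ∀ p ∈ P, ℓ ≤ p.2
  sq_left : ∀ p ∈ P, ∀ x, ∀ l < p.1, ℓ * (a l - x) ^ 2 ≤ ∑ l ∈ Finset.range p.1, (a l - x) ^ 2
  sq_right : ∀ p ∈ P, ∀ x, ∀ l < p.2, ℓ * (b l - x) ^ 2 ≤ ∑ l ∈ Finset.range p.2, (b l - x) ^ 2
  energy_le : ∀ p ∈ P, ∑ l ∈ Finset.range p.1, (a l - c p) ^ 2 +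
    ∑ l ∈ Finset.range p.2, (b l - c p) ^ 2 ≤ 8 * w ^ 2
  mean : ∀ p ∈ P, ∑ l ∈ Finset.range p.1, (a l - c p) + ∑ l ∈ Finset.range p.2, (b l - c p) = 0

variable {ℓ w : ℝ} {NA NB : ℕ} {a b : ℕ → ℝ} {P : Finset (ℕ × ℕ)} {c : ℕ × ℕ → ℝ}

lemma WindowFamily.mono (h : WindowFamily ℓ w NA NB a b P c) {P' : Finset (ℕ × ℕ)}
    (hP : P' ⊆ P) : WindowFamily ℓ w NA NB a b P' c where
  le_left p hp := h.le_left p (hP hp)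
  le_right p hp := h.le_right p (hP hp)
  right_le_left p hp := h.right_le_left p (hP hp)
  length_right p hp := h.length_right p (hP hp)
  sq_left p hp := h.sq_left p (hP hp)
  sq_right p hp := h.sq_right p (hP hp)
  energy_le p hp := h.energy_le p (hP hp)
  mean p hp := h.mean p (hP hp)

/-- Pythagoras around the mean of a window. -/
lemma WindowFamily.energy_eq (h : WindowFamily ℓ w NA NB a b P c) {p : ℕ × ℕ} (hp : p ∈ P)
    (x : ℝ) : ∑ l ∈ Finset.range p.1, (a l - x) ^ 2 + ∑ l ∈ Finset.range p.2, (b l - x) ^ 2 =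
      ∑ l ∈ Finset.range p.1, (a l - c p) ^ 2 + ∑ l ∈ Finset.range p.2, (b l - c p) ^ 2 +
        (p.1 + p.2) * (c p - x) ^ 2 := by
  have hm := h.mean p hp
  have e : ∀ (v : ℕ → ℝ) (N : ℕ), ∑ l ∈ Finset.range N, (v l - x) ^ 2 =
      ∑ l ∈ Finset.range N, (v l - c p) ^ 2 +
        2 * (c p - x) * ∑ l ∈ Finset.range N, (v l - c p) + N * (c p - x) ^ 2 := by
    intro v N
    rw [Finset.mul_sum, ← Finset.sum_add_distrib]
    have : (N : ℝ) * (c p - x) ^ 2 = ∑ _l ∈ Finset.range N, (c p - x) ^ 2 := by simp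
    rw [this, ← Finset.sum_add_distrib]
    exact Finset.sum_congr rfl fun l _ => by ring
  rw [e a, e b]
  linear_combination 2 * (c p - x) * hm

/-- Moving the reference from the window mean to `x` adds at most `w²` to an energy of at most `8
w²`, and `8 + 1 = 3²`. -/
lemma WindowFamily.sum_sq_le (h : WindowFamily ℓ w NA NB a b P c) {p : ℕ × ℕ} (hp : p ∈ P)
    {x : ℝ} (hx : (p.1 + p.2) * (c p - x) ^ 2 ≤ w ^ 2) :
    ∑ l ∈ Finset.range p.1, (a l - x) ^ 2 ≤ (3 * w) ^ 2 ∧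
      ∑ l ∈ Finset.range p.2, (b l - x) ^ 2 ≤ (3 * w) ^ 2 := by
  have h1 := h.energy_eq hp x
  have h2 := h.energy_le p hp
  have h3 : 0 ≤ ∑ l ∈ Finset.range p.1, (a l - x) ^ 2 := Finset.sum_nonneg fun _ _ => sq_nonneg _
  have h4 : 0 ≤ ∑ l ∈ Finset.range p.2, (b l - x) ^ 2 := Finset.sum_nonneg fun _ _ => sq_nonneg _
  constructor <;> nlinarith

end TwoSided

/-! ### Deviations over windows whose means are close to a common reference. -/

section TwoSided

/-- Independent centered variables whose Laplace transforms are Gaussian on an interval. -/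
structure LocallySubgaussian {Ω : Type*} [MeasurableSpace Ω] (μ : Measure Ω) {ι : Type*}
    (η : ι → Ω → ℝ) (Λ ℓ : ℝ) : Prop where
  meas : ∀ i, Measurable (η i)
  indep : iIndepFun η μ
  integrable : ∀ i, Integrable (η i) μ
  centered : ∀ i, ∫ ω, η i ω ∂μ = 0
  lintegral_exp_le : ∀ i (t : ℝ), ℓ * t ^ 2 ≤ Λ ^ 2 →
    ∫⁻ ω, ENNReal.ofReal (Real.exp (t * η i ω)) ∂μ ≤ ENNReal.ofReal (Real.exp (t ^ 2 / 2))

variable {Ω : Type*} [MeasurableSpace Ω] {μ : Measure Ω} [IsProbabilityMeasure μ]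
  {ι : Type*} [DecidableEq ι] {η : ι → Ω → ℝ} {Λ ℓ w : ℝ} {NA NB : ℕ} {a b : ℕ → ℝ}
  {P : Finset (ℕ × ℕ)} {c : ℕ × ℕ → ℝ} {kA kB : ℕ → ι}

/-- Once the reference `x` no longer depends on the window, the sums over this side are partial sums
of one sequence, and a single maximal inequality covers all windows. -/
lemma WindowFamily.measure_left_le (h : WindowFamily ℓ w NA NB a b P c)
    (hη : LocallySubgaussian μ η Λ ℓ) (hΛ : 0 ≤ Λ) (hkA : Set.InjOn kA (Set.Iio NA))
    (hw : 0 < w) {x : ℝ} (hx : ∀ p ∈ P, (p.1 + p.2) * (c p - x) ^ 2 ≤ w ^ 2) (y : ℝ) :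
    μ {ω | ∃ p ∈ P, 3 * w * y ≤ |∑ l ∈ Finset.range p.1, (a l - x) * η (kA l) ω|} ≤
      ENNReal.ofReal (2 * Real.exp (Λ ^ 2 / 2 - Λ * y)) := by
  have h1 := measure_exists_abs_sum_ge_le hη.meas hη.indep hη.integrable hη.centered hΛ
    hη.lintegral_exp_le hkA (fun l => a l - x) (P.image Prod.fst) (w := 3 * w)
    (fun i hi => by
      obtain ⟨p, hp, rfl⟩ := Finset.mem_image.1 hi
      exact h.le_left p hp) (by positivity)
    (fun i hi => by
      obtain ⟨p, hp, rfl⟩ := Finset.mem_image.1 hi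
      exact (h.sum_sq_le hp (hx p hp)).1)
    (fun i hi l hl => by
      obtain ⟨p, hp, rfl⟩ := Finset.mem_image.1 hi
      exact (h.sq_left p hp x l hl).trans (h.sum_sq_le hp (hx p hp)).1) y
  refine (measure_mono ?_).trans h1
  rintro ω ⟨p, hp, hω⟩
  exact ⟨p.1, Finset.mem_image_of_mem _ hp, hω⟩

lemma WindowFamily.measure_right_le (h : WindowFamily ℓ w NA NB a b P c)
    (hη : LocallySubgaussian μ η Λ ℓ) (hΛ : 0 ≤ Λ) (hkB : Set.InjOn kB (Set.Iio NB))
    (hw : 0 < w) {x : ℝ} (hx : ∀ p ∈ P, (p.1 + p.2) * (c p - x) ^ 2 ≤ w ^ 2) (y : ℝ) :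
    μ {ω | ∃ p ∈ P, 3 * w * y ≤ |∑ l ∈ Finset.range p.2, (b l - x) * η (kB l) ω|} ≤
      ENNReal.ofReal (2 * Real.exp (Λ ^ 2 / 2 - Λ * y)) := by
  have h1 := measure_exists_abs_sum_ge_le hη.meas hη.indep hη.integrable hη.centered hΛ
    hη.lintegral_exp_le hkB (fun l => b l - x) (P.image Prod.snd) (w := 3 * w)
    (fun i hi => by
      obtain ⟨p, hp, rfl⟩ := Finset.mem_image.1 hi
      exact h.le_right p hp) (by positivity)
    (fun i hi => by
      obtain ⟨p, hp, rfl⟩ := Finset.mem_image.1 hi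
      exact (h.sum_sq_le hp (hx p hp)).2)
    (fun i hi l hl => by
      obtain ⟨p, hp, rfl⟩ := Finset.mem_image.1 hi
      exact (h.sq_right p hp x l hl).trans (h.sum_sq_le hp (hx p hp)).2) y
  refine (measure_mono ?_).trans h1
  rintro ω ⟨p, hp, hω⟩
  exact ⟨p.2, Finset.mem_image_of_mem _ hp, hω⟩

/-- Unweighted sums over the two sides of windows of bounded length. -/
lemma WindowFamily.measure_sides_le (h : WindowFamily ℓ w NA NB a b P c)
    (hη : LocallySubgaussian μ η Λ ℓ) (hΛ : 0 ≤ Λ) (hℓ : 0 < ℓ)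
    (hkA : Set.InjOn kA (Set.Iio NA)) (hkB : Set.InjOn kB (Set.Iio NB))
    (hw : 0 < w) {ρ W v y : ℝ} (hW : ∀ p ∈ P, (p.1 + p.2 : ℝ) ≤ W) (hρ : 0 ≤ ρ) (hv : 0 < v)
    (hv1 : v ≤ 1) (hρv : ρ ^ 2 * W ≤ v * w ^ 2) (hy : 2 ≤ Λ * y) :
    μ {ω | ∃ p ∈ P, w * y ≤ ρ * |∑ l ∈ Finset.range p.1, η (kA l) ω| ∨
        w * y ≤ ρ * |∑ l ∈ Finset.range p.2, η (kB l) ω|} ≤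
      ENNReal.ofReal (4 * v * Real.exp (Λ ^ 2 / 2 - Λ * y)) := by
  rcases P.eq_empty_or_nonempty with rfl | ⟨p₀, hp₀⟩
  · simp
  have hW0 : ℓ ≤ W := by
    have h1 := h.length_right p₀ hp₀
    have h2 := hW p₀ hp₀
    have h3 : (0 : ℝ) ≤ p₀.1 := Nat.cast_nonneg _
    linarith
  have hA := measure_exists_mul_abs_sum_ge_le hη.meas hη.indep hη.integrable hη.centered hΛ
    hη.lintegral_exp_le hkA (P.image Prod.fst) (fun i hi => by
      obtain ⟨p, hp, rfl⟩ := Finset.mem_image.1 hi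
      exact h.le_left p hp) (hℓ.trans_le hW0) (fun i hi => by
      obtain ⟨p, hp, rfl⟩ := Finset.mem_image.1 hi
      have h2 := hW p hp
      have h3 : (0 : ℝ) ≤ p.2 := Nat.cast_nonneg _
      linarith) hW0 hρ hw hv hv1 hρv hy
  have hB := measure_exists_mul_abs_sum_ge_le hη.meas hη.indep hη.integrable hη.centered hΛ
    hη.lintegral_exp_le hkB (P.image Prod.snd) (fun i hi => by
      obtain ⟨p, hp, rfl⟩ := Finset.mem_image.1 hi
      exact h.le_right p hp) (hℓ.trans_le hW0) (fun i hi => by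
      obtain ⟨p, hp, rfl⟩ := Finset.mem_image.1 hi
      have h2 := hW p hp
      have h3 : (0 : ℝ) ≤ p.1 := Nat.cast_nonneg _
      linarith) hW0 hρ hw hv hv1 hρv hy
  refine (measure_mono (t := _ ∪ _) ?_).trans ((measure_union_le _ _).trans
    ((add_le_add hA hB).trans (le_of_eq ?_)))
  · rintro ω ⟨p, hp, hω | hω⟩
    · exact Or.inl ⟨p.1, Finset.mem_image_of_mem _ hp, hω⟩
    · exact Or.inr ⟨p.2, Finset.mem_image_of_mem _ hp, hω⟩
  · rw [← ENNReal.ofReal_add (by positivity) (by positivity)]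
    congr 1; ring

/-- The two weighted sums around `x` may each use `3 w y`, and the two unweighted sums correcting
for `c p - x` may each use `w y`: in all `8 w y`. -/
lemma WindowFamily.measure_windowSum_le_of_ref (h : WindowFamily ℓ w NA NB a b P c)
    (hη : LocallySubgaussian μ η Λ ℓ) (hΛ : 0 ≤ Λ) (hℓ : 0 < ℓ)
    (hkA : Set.InjOn kA (Set.Iio NA)) (hkB : Set.InjOn kB (Set.Iio NB))
    (hw : 0 < w) {x ρ W y : ℝ} (hx : ∀ p ∈ P, |c p - x| ≤ ρ)
    (hW : ∀ p ∈ P, (p.1 + p.2 : ℝ) ≤ W) (hρ : 0 ≤ ρ)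
    (hρW : ρ ^ 2 * W ≤ w ^ 2) (hy : 2 ≤ Λ * y) :
    μ {ω | ∃ p ∈ P, 8 * w * y ≤ |windowSum η kA kB a b (c p) p ω|} ≤
      ENNReal.ofReal (8 * Real.exp (Λ ^ 2 / 2 - Λ * y)) := by
  have hx2 : ∀ p ∈ P, (p.1 + p.2) * (c p - x) ^ 2 ≤ w ^ 2 := fun p hp => by
    have h1 : (c p - x) ^ 2 ≤ ρ ^ 2 := by
      rw [← sq_abs]
      have := hx p hp
      gcongr
    calc ((p.1 : ℝ) + p.2) * (c p - x) ^ 2 ≤ W * ρ ^ 2 := by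
          have h2 := hW p hp
          have h3 : (0 : ℝ) ≤ (p.1 : ℝ) + p.2 := by positivity
          exact mul_le_mul h2 h1 (sq_nonneg _) (h3.trans h2)
      _ ≤ w ^ 2 := by linarith
  have hA := h.measure_left_le hη hΛ hkA hw hx2 y
  have hB := h.measure_right_le hη hΛ hkB hw hx2 y
  have hS := h.measure_sides_le hη hΛ hℓ hkA hkB hw hW hρ one_pos le_rfl
    (by rw [one_mul]; exact hρW) hy
  refine (measure_mono (t := (_ ∪ _) ∪ _) ?_).trans ((measure_union_le _ _).trans
    ((add_le_add ((measure_union_le _ _).trans (add_le_add hA hB)) hS).trans (le_of_eq ?_)))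
  · rintro ω ⟨p, hp, hω⟩
    have h1 := abs_windowSum_le (η := η) kA kB a b (hx p hp) p ω
    by_contra hcon
    simp only [Set.mem_union, Set.mem_ofPred_eq, not_or, not_exists, not_and, not_le] at hcon
    obtain ⟨⟨h2, h3⟩, h4⟩ := hcon
    have := h2 p hp
    have := h3 p hp
    have := h4 p hp
    linarith
  · rw [← ENNReal.ofReal_add (by positivity) (by positivity),
      ← ENNReal.ofReal_add (by positivity) (by positivity)]
    congr 1; ring

/-- The weighted sums are shared by all classes and paid for once. Only the corrections are treated
class by class, and a class with a small correction costs only a multiple of `v k`. -/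
lemma WindowFamily.measure_windowSum_le_of_classes (h : WindowFamily ℓ w NA NB a b P c)
    (hη : LocallySubgaussian μ η Λ ℓ) (hΛ : 0 ≤ Λ) (hℓ : 0 < ℓ)
    (hkA : Set.InjOn kA (Set.Iio NA)) (hkB : Set.InjOn kB (Set.Iio NB))
    (hw : 0 < w) {x y : ℝ} (T : Finset ℤ) (κ : ℕ × ℕ → ℤ) (ρ W v : ℤ → ℝ)
    (hx : ∀ p ∈ P, c p = x ∨ κ p ∈ T ∧ |c p - x| ≤ ρ (κ p) ∧ (p.1 + p.2 : ℝ) ≤ W (κ p))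
    (hρ : ∀ k ∈ T, 0 ≤ ρ k) (hv : ∀ k ∈ T, 0 < v k) (hv1 : ∀ k ∈ T, v k ≤ 1)
    (hρv : ∀ k ∈ T, ρ k ^ 2 * W k ≤ v k * w ^ 2) (hy : 2 ≤ Λ * y) :
    μ {ω | ∃ p ∈ P, 8 * w * y ≤ |windowSum η kA kB a b (c p) p ω|} ≤
      ENNReal.ofReal ((4 + 4 * ∑ k ∈ T, v k) * Real.exp (Λ ^ 2 / 2 - Λ * y)) := by
  classical
  have hx2 : ∀ p ∈ P, (p.1 + p.2) * (c p - x) ^ 2 ≤ w ^ 2 := fun p hp => by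
    rcases hx p hp with h1 | ⟨hk, h1, h2⟩
    · rw [h1]; simpa using sq_nonneg w
    have h3 : (c p - x) ^ 2 ≤ ρ (κ p) ^ 2 := by
      rw [← sq_abs]
      gcongr
    calc ((p.1 : ℝ) + p.2) * (c p - x) ^ 2 ≤ W (κ p) * ρ (κ p) ^ 2 := by
          have h4 : (0 : ℝ) ≤ (p.1 : ℝ) + p.2 := by positivity
          exact mul_le_mul h2 h3 (sq_nonneg _) (h4.trans h2)
      _ ≤ v (κ p) * w ^ 2 := by linarith [hρv _ hk]
      _ ≤ 1 * w ^ 2 := by gcongr; exact hv1 _ hk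
      _ = w ^ 2 := one_mul _
  have hy0 : 0 < y := by
    by_contra hneg
    have := mul_nonpos_of_nonneg_of_nonpos hΛ (not_lt.1 hneg)
    linarith
  have hA := h.measure_left_le hη hΛ hkA hw hx2 y
  have hB := h.measure_right_le hη hΛ hkB hw hx2 y
  have hS : ∀ k ∈ T, _ := fun k hk =>
    (h.mono (Finset.filter_subset (fun p => κ p = k ∧ (p.1 + p.2 : ℝ) ≤ W k) P)).measure_sides_le
      hη hΛ hℓ hkA hkB hw (W := W k) (fun p hp => (Finset.mem_filter.1 hp).2.2) (hρ k hk)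
      (hv k hk) (hv1 k hk) (hρv k hk) hy
  refine (measure_mono (t := (_ ∪ _) ∪ ⋃ k ∈ T, _) ?_).trans ((measure_union_le _ _).trans
    ((add_le_add ((measure_union_le _ _).trans (add_le_add hA hB))
      ((measure_biUnion_finset_le _ _).trans (Finset.sum_le_sum hS))).trans (le_of_eq ?_)))
  · rintro ω ⟨p, hp, hω⟩
    by_contra hcon
    simp only [Set.mem_union, Set.mem_iUnion, Set.mem_ofPred_eq, not_or, not_exists, not_and,
      not_le, Finset.mem_filter] at hcon
    obtain ⟨⟨h2, h3⟩, h4⟩ := hcon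
    have h5 := h2 p hp
    have h6 := h3 p hp
    have hwy : 0 < w * y := by positivity
    rcases hx p hp with h1 | ⟨hk, h1, h7⟩
    · have h8 := abs_windowSum_le (η := η) kA kB a b (x := x) (c := c p) (ρ := 0) (by simp [h1]) p ω
      linarith
    · have h8 := abs_windowSum_le (η := η) kA kB a b h1 p ω
      have h9 := h4 _ hk p ⟨hp, rfl, h7⟩
      linarith
  · rw [← ENNReal.ofReal_sum_of_nonneg fun k hk => by have := hv k hk; positivity,
      ← ENNReal.ofReal_add (by positivity) (by positivity),
      ← ENNReal.ofReal_add (by positivity)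
        (Finset.sum_nonneg fun k hk => by have := hv k hk; positivity),
      ← Finset.sum_mul, ← Finset.mul_sum]
    congr 1; ring

end TwoSided

/-! ### Classification of windows by their means. -/

section TwoSided

variable {Ω : Type*} [MeasurableSpace Ω] {μ : Measure Ω} [IsProbabilityMeasure μ]
  {ι : Type*} [DecidableEq ι] {η : ι → Ω → ℝ} {Λ ℓ w : ℝ} {NA NB : ℕ} {a b : ℕ → ℝ}
  {P : Finset (ℕ × ℕ)} {c : ℕ × ℕ → ℝ} {kA kB : ℕ → ι}

/-- A common reference value for all the windows of a family. -/
lemma WindowFamily.exists_center (h : WindowFamily ℓ w NA NB a b P c) (hℓ : 0 < ℓ)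
    (hP : P.Nonempty) :
    ∃ (u : ℝ) (I J : ℕ), (∀ p ∈ P, p.1 ≤ I) ∧ (∀ p ∈ P, p.2 ≤ J) ∧
      (∀ p ∈ P, (p.1 + p.2) * (c p - u) ^ 2 ≤ 64 * w ^ 2) ∧
      ∑ l ∈ Finset.range I, (a l - u) ^ 2 + ∑ l ∈ Finset.range J, (b l - u) ^ 2 ≤ 80 * w ^ 2 := by
  -- The centre is the mean over the longest first side, around which the energy of that side is at
  -- most `8 w²`. This side contains all other first sides, and the first side of a window is its
  -- longer one, so every window mean can be compared with the centre through its first side.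
  obtain ⟨p, hp, hpmax⟩ := P.exists_max_image Prod.fst hP
  obtain ⟨q, hq, hqmax⟩ := P.exists_max_image Prod.snd hP
  have hp0 : (0 : ℝ) < p.1 := by
    have h1 := h.length_right p hp
    have h2 : (p.2 : ℝ) ≤ p.1 := by exact_mod_cast h.right_le_left p hp
    linarith
  set u := (∑ l ∈ Finset.range p.1, a l) / p.1 with hu
  have hmean : ∑ l ∈ Finset.range p.1, (a l - u) = 0 := by
    rw [Finset.sum_sub_distrib, Finset.sum_const, Finset.card_range, nsmul_eq_mul, hu]
    field_simp; ring
  have hA : ∑ l ∈ Finset.range p.1, (a l - u) ^ 2 ≤ 8 * w ^ 2 := by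
    have e : ∑ l ∈ Finset.range p.1, (a l - c p) ^ 2 =
        ∑ l ∈ Finset.range p.1, (a l - u) ^ 2 +
          2 * (u - c p) * ∑ l ∈ Finset.range p.1, (a l - u) + p.1 * (u - c p) ^ 2 := by
      have : (p.1 : ℝ) * (u - c p) ^ 2 = ∑ _l ∈ Finset.range p.1, (u - c p) ^ 2 := by simp
      rw [this, Finset.mul_sum, ← Finset.sum_add_distrib, ← Finset.sum_add_distrib]
      exact Finset.sum_congr rfl fun l _ => by ring
    have h1 := h.energy_le p hp
    have h2 : 0 ≤ ∑ l ∈ Finset.range p.2, (b l - c p) ^ 2 :=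
      Finset.sum_nonneg fun _ _ => sq_nonneg _
    have h3 : 0 ≤ (p.1 : ℝ) * (u - c p) ^ 2 := by positivity
    rw [hmean, mul_zero] at e
    linarith
  have hcu : ∀ p ∈ P, (p.1 + p.2) * (c p - u) ^ 2 ≤ 64 * w ^ 2 := by
    intro r hr
    have h1 : ∑ l ∈ Finset.range r.1, (a l - u) ^ 2 ≤ 8 * w ^ 2 :=
      (Finset.sum_le_sum_of_subset_of_nonneg (Finset.range_mono (hpmax r hr))
        fun _ _ _ => sq_nonneg _).trans hA
    have h2 := h.energy_le r hr
    have h3 : 0 ≤ ∑ l ∈ Finset.range r.2, (b l - c r) ^ 2 :=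
      Finset.sum_nonneg fun _ _ => sq_nonneg _
    have h4 : (r.1 : ℝ) * (c r - u) ^ 2 ≤ 2 * ∑ l ∈ Finset.range r.1, (a l - u) ^ 2 +
        2 * ∑ l ∈ Finset.range r.1, (a l - c r) ^ 2 := by
      have : (r.1 : ℝ) * (c r - u) ^ 2 = ∑ _l ∈ Finset.range r.1, (c r - u) ^ 2 := by simp
      rw [this, Finset.mul_sum, Finset.mul_sum, ← Finset.sum_add_distrib]
      refine Finset.sum_le_sum fun l _ => ?_
      nlinarith [sq_nonneg (a l - u + (a l - c r))]
    have h5 : (r.2 : ℝ) ≤ r.1 := by exact_mod_cast h.right_le_left r hr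
    have h6 : (r.2 : ℝ) * (c r - u) ^ 2 ≤ r.1 * (c r - u) ^ 2 := by gcongr
    linarith
  refine ⟨u, p.1, q.2, hpmax, hqmax, hcu, ?_⟩
  have h1 := h.energy_eq hq u
  have h2 := h.energy_le q hq
  have h3 := hcu q hq
  have h4 : 0 ≤ ∑ l ∈ Finset.range q.1, (a l - u) ^ 2 := Finset.sum_nonneg fun _ _ => sq_nonneg _
  linarith

/-- Deviations of the noise over all the windows around a cut. -/
theorem WindowFamily.measure_windowSum_le (h : WindowFamily ℓ w NA NB a b P c)
    (hη : LocallySubgaussian μ η Λ ℓ) (hΛ : 0 ≤ Λ) (hℓ : 0 < ℓ)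
    (hkA : Set.InjOn kA (Set.Iio NA)) (hkB : Set.InjOn kB (Set.Iio NB))
    (hw : 0 < w) {y : ℝ} (hy : 2 ≤ Λ * y) :
    μ {ω | ∃ p ∈ P, 8 * w * y ≤ |windowSum η kA kB a b (c p) p ω|} ≤
      ENNReal.ofReal (58400 * Real.exp (Λ ^ 2 / 2 - Λ * y)) := by
  classical
  rcases P.eq_empty_or_nonempty with rfl | hP
  · simp
  obtain ⟨u, I, J, hI, hJ, hcu, hmass⟩ := h.exists_center hℓ hP
  have hκ : ∀ p : ℕ × ℕ, ∃ k : ℤ, c p ≠ u →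
      |c p - u| ∈ Set.Ico ((9 / 8 : ℝ) ^ k) ((9 / 8 : ℝ) ^ (k + 1)) := by
    intro p
    by_cases hpu : c p = u
    · exact ⟨0, fun h => absurd hpu h⟩
    · obtain ⟨k, hk⟩ := exists_mem_Ico_zpow (x := |c p - u|) (y := 9 / 8)
        (abs_pos.2 (sub_ne_zero.2 hpu)) (by norm_num)
      exact ⟨k, fun _ => hk⟩
  choose κ hκ using hκ
  set P' := P.filter fun p => c p ≠ u with hP'
  set T := P'.image κ with hT
  have hq : ∀ k ∈ T, ∃ p ∈ P', κ p = k ∧ ∀ q ∈ P', κ q = k → (q.1 + q.2 : ℝ) ≤ p.1 + p.2 := by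
    intro k hk
    obtain ⟨p, hp, hpk⟩ := Finset.mem_image.1 hk
    obtain ⟨q, hq, hqmax⟩ := (P'.filter fun p => κ p = k).exists_max_image
      (fun p => (p.1 + p.2 : ℝ)) ⟨p, Finset.mem_filter.2 ⟨hp, hpk⟩⟩
    rw [Finset.mem_filter] at hq
    exact ⟨q, hq.1, hq.2, fun r hr hrk => hqmax r (Finset.mem_filter.2 ⟨hr, hrk⟩)⟩
  choose! q hqP hqκ hqmax using hq
  have hqP1 : ∀ k ∈ T, q k ∈ P := fun k hk => (Finset.mem_filter.1 (hqP k hk)).1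
  have hqP2 : ∀ k ∈ T, c (q k) ≠ u := fun k hk => (Finset.mem_filter.1 (hqP k hk)).2
  have hqr : ∀ k ∈ T, (9 / 8 : ℝ) ^ k ≤ |c (q k) - u| := fun k hk => by
    have := (hκ (q k) (hqP2 k hk)).1
    rwa [hqκ k hk] at this
  let W (k : ℤ) : ℝ := (q k).1 + (q k).2
  have hW0 : ∀ k ∈ T, 0 < W k := fun k hk => by
    have h1 := h.length_right _ (hqP1 k hk)
    have h2 : (0 : ℝ) ≤ (q k).1 := Nat.cast_nonneg _
    simp only [W]
    linarith
  let C (k : ℤ) : ℝ := ((9 / 8 : ℝ) ^ k) ^ 2 * W k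
  have hC0 : ∀ k ∈ T, 0 < C k := fun k hk => by
    have := hW0 k hk
    positivity
  -- Here `2880 = 36 * 80`. The classes have a bounded total size whatever their number, which keeps
  -- the logarithm of the number of cuts out of the final constant.
  have hCsum : ∑ k ∈ T, C k ≤ 2880 * w ^ 2 := by
    have h1 := sum_zpow_sq_mul_le T a b u (fun k => (q k).1) (fun k => (q k).2) (fun k => c (q k))
      I J (fun k hk => hI _ (hqP1 k hk)) (fun k hk => hJ _ (hqP1 k hk))
      (fun k hk => h.mean _ (hqP1 k hk)) hqr
    simp only [C, W]
    linarith
  have hC64 : ∀ k ∈ T, C k ≤ 64 * w ^ 2 := fun k hk => by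
    refine le_trans ?_ (hcu _ (hqP1 k hk))
    have h1 := hqr k hk
    have h2 : ((9 / 8 : ℝ) ^ k) ^ 2 ≤ (c (q k) - u) ^ 2 := by
      rw [← sq_abs (c (q k) - u)]; gcongr
    have h3 := (hW0 k hk).le
    calc C k ≤ (c (q k) - u) ^ 2 * W k := by simp only [C]; gcongr
      _ = _ := by simp only [W]; ring
  set E := Real.exp (Λ ^ 2 / 2 - Λ * y) with hE
  have hE0 : 0 < E := Real.exp_pos _
  -- For the small classes the reference `u` is good enough, with `v k = (9 / 8)² C k / w² ≤ 1`. A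
  -- large class gets its own references `u ± (9 / 8) ^ k`, which lie within `(9 / 8) ^ k / 8` of
  -- its means; as `C k` is bounded below there, its cost is again at most a multiple of `C k`.
  set Ts := T.filter fun k => C k ≤ 64 / 81 * w ^ 2 with hTs
  set Tb := T.filter fun k => ¬ C k ≤ 64 / 81 * w ^ 2 with hTb
  have hTbT : ∀ k ∈ Tb, k ∈ T := fun k hk => (Finset.mem_filter.1 hk).1
  have hTsT : ∀ k ∈ Ts, k ∈ T := fun k hk => (Finset.mem_filter.1 hk).1
  have hzs : ∀ k : ℤ, (9 / 8 : ℝ) ^ (k + 1) = 9 / 8 * (9 / 8 : ℝ) ^ k := fun k => by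
    rw [zpow_add_one₀ (by norm_num)]; ring
  have hκT : ∀ p ∈ P, c p ≠ u → κ p ∈ T := fun p hp hpu =>
    Finset.mem_image_of_mem _ (Finset.mem_filter.2 ⟨hp, hpu⟩)
  have hWle : ∀ p ∈ P, c p ≠ u → (p.1 + p.2 : ℝ) ≤ W (κ p) := fun p hp hpu =>
    hqmax _ (hκT p hp hpu) p (Finset.mem_filter.2 ⟨hp, hpu⟩) rfl
  -- small classes
  have hsmall := (h.mono (Finset.filter_subset (fun p => c p = u ∨ κ p ∈ Ts)
    P)).measure_windowSum_le_of_classes hη hΛ hℓ hkA hkB hw (x := u) (y := y) Ts κ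
    (fun k => (9 / 8 : ℝ) ^ (k + 1)) W (fun k => 81 / 64 * C k / w ^ 2)
    (fun p hp => by
      obtain ⟨hp, hp'⟩ := Finset.mem_filter.1 hp
      by_cases hpu : c p = u
      · exact Or.inl hpu
      · exact Or.inr ⟨hp'.resolve_left hpu, (hκ p hpu).2.le, hWle p hp hpu⟩)
    (fun k _ => by positivity)
    (fun k hk => by have := hC0 k (hTsT k hk); positivity)
    (fun k hk => by
      rw [div_le_one (by positivity)]
      have := (Finset.mem_filter.1 hk).2
      linarith)
    (fun k _ => by
      rw [div_mul_cancel₀ _ (by positivity), hzs]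
      simp only [C]
      refine le_of_eq ?_
      ring) hy
  -- large classes
  have hbig : ∀ k ∈ Tb, ∀ s : ℝ, (s = 1 ∨ s = -1) →
      μ {ω | ∃ p ∈ P.filter (fun p => κ p = k ∧ c p ≠ u ∧ |c p - u| = s * (c p - u)),
        8 * w * y ≤ |windowSum η kA kB a b (c p) p ω|} ≤ ENNReal.ofReal (8 * E) := by
    intro k hk s hs
    refine (h.mono (Finset.filter_subset _ P)).measure_windowSum_le_of_ref hη hΛ hℓ hkA hkB hw
      (x := u + s * (9 / 8 : ℝ) ^ k) (ρ := (9 / 8 : ℝ) ^ k / 8) (W := W k) ?_ ?_ (by positivity)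
      ?_ hy
    · intro p hp
      obtain ⟨hp, rfl, hpu, hps⟩ := Finset.mem_filter.1 hp
      obtain ⟨h1, h2⟩ := hκ p hpu
      rw [hzs] at h2
      have e : |c p - (u + s * (9 / 8 : ℝ) ^ κ p)| = |s * (c p - u) - (9 / 8 : ℝ) ^ κ p| := by
        rcases hs with rfl | rfl
        · congr 1; ring
        · rw [← abs_neg]; congr 1; ring
      rw [e, ← hps, abs_le]
      constructor <;> linarith [(by positivity : (0 : ℝ) < (9 / 8 : ℝ) ^ κ p)]
    · intro p hp
      obtain ⟨hpP, rfl, hpu, -⟩ := Finset.mem_filter.1 hp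
      exact hWle p hpP hpu
    · have h1 := hC64 k (hTbT k hk)
      simp only [C] at h1
      linarith
  have hbig2 : ∀ k ∈ Tb, μ
      ({ω | ∃ p ∈ P.filter (fun p => κ p = k ∧ c p ≠ u ∧ |c p - u| = 1 * (c p - u)),
        8 * w * y ≤ |windowSum η kA kB a b (c p) p ω|} ∪
      {ω | ∃ p ∈ P.filter (fun p => κ p = k ∧ c p ≠ u ∧ |c p - u| = (-1) * (c p - u)),
        8 * w * y ≤ |windowSum η kA kB a b (c p) p ω|}) ≤
      ENNReal.ofReal (81 / 4 * (C k / w ^ 2) * E) := by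
    intro k hk
    refine (measure_union_le _ _).trans ((add_le_add (hbig k hk 1 (Or.inl rfl))
      (hbig k hk (-1) (Or.inr rfl))).trans ?_)
    rw [← ENNReal.ofReal_add (by positivity) (by positivity)]
    refine ENNReal.ofReal_le_ofReal ?_
    -- Two signs cost `16 = (81 / 4) * (64 / 81)`.
    have h1 : 64 / 81 ≤ C k / w ^ 2 := by
      rw [le_div_iff₀ (by positivity)]
      exact (not_le.1 (Finset.mem_filter.1 hk).2).le
    nlinarith
  have hsub : {ω | ∃ p ∈ P, 8 * w * y ≤ |windowSum η kA kB a b (c p) p ω|} ⊆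
      {ω | ∃ p ∈ P.filter (fun p => c p = u ∨ κ p ∈ Ts),
        8 * w * y ≤ |windowSum η kA kB a b (c p) p ω|} ∪ ⋃ k ∈ Tb,
      ({ω | ∃ p ∈ P.filter (fun p => κ p = k ∧ c p ≠ u ∧ |c p - u| = 1 * (c p - u)),
        8 * w * y ≤ |windowSum η kA kB a b (c p) p ω|} ∪
      {ω | ∃ p ∈ P.filter (fun p => κ p = k ∧ c p ≠ u ∧ |c p - u| = (-1) * (c p - u)),
        8 * w * y ≤ |windowSum η kA kB a b (c p) p ω|}) := by
    rintro ω ⟨p, hp, hω⟩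
    by_cases h1 : c p = u ∨ κ p ∈ Ts
    · exact Or.inl ⟨p, Finset.mem_filter.2 ⟨hp, h1⟩, hω⟩
    · rw [not_or] at h1
      obtain ⟨hpu, hns⟩ := h1
      have hb : κ p ∈ Tb := by
        have := hκT p hp hpu
        simp only [hTs, hTb, Finset.mem_filter, this, true_and] at hns ⊢
        exact hns
      refine Or.inr (Set.mem_biUnion hb ?_)
      rcases abs_cases (c p - u) with ⟨h2, _⟩ | ⟨h2, _⟩
      · exact Or.inl ⟨p, Finset.mem_filter.2 ⟨hp, rfl, hpu, by rw [h2, one_mul]⟩, hω⟩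
      · exact Or.inr ⟨p, Finset.mem_filter.2 ⟨hp, rfl, hpu, by rw [h2, neg_one_mul]⟩, hω⟩
  refine (measure_mono hsub).trans ((measure_union_le _ _).trans ((add_le_add hsmall
    ((measure_biUnion_finset_le _ _).trans (Finset.sum_le_sum hbig2))).trans ?_))
  have hs0 : 0 ≤ ∑ k ∈ Ts, 81 / 64 * C k / w ^ 2 := Finset.sum_nonneg fun k hk => by
    have := hC0 k (hTsT k hk)
    positivity
  have hb0 : ∀ k ∈ Tb, 0 ≤ 81 / 4 * (C k / w ^ 2) * E := fun k hk => by
    have := hC0 k (hTbT k hk)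
    positivity
  rw [← ENNReal.ofReal_sum_of_nonneg hb0, ← ENNReal.ofReal_add (by positivity)
    (Finset.sum_nonneg hb0)]
  refine ENNReal.ofReal_le_ofReal ?_
  rw [← Finset.sum_mul, ← add_mul]
  refine mul_le_mul_of_nonneg_right ?_ hE0.le
  have hsplit : ∑ k ∈ Ts, C k + ∑ k ∈ Tb, C k = ∑ k ∈ T, C k :=
    Finset.sum_filter_add_sum_filter_not T _ _
  have e1 : ∑ k ∈ Ts, 81 / 64 * C k / w ^ 2 = 81 / 64 * ((∑ k ∈ Ts, C k) / w ^ 2) := by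
    rw [Finset.sum_div, Finset.mul_sum]
    exact Finset.sum_congr rfl fun k _ => by ring
  have e2 : ∑ k ∈ Tb, 81 / 4 * (C k / w ^ 2) = 81 / 4 * ((∑ k ∈ Tb, C k) / w ^ 2) := by
    rw [Finset.sum_div, Finset.mul_sum]
  have h1 : (∑ k ∈ Ts, C k) / w ^ 2 + (∑ k ∈ Tb, C k) / w ^ 2 ≤ 2880 := by
    rw [← add_div, hsplit, div_le_iff₀ (by positivity)]
    exact hCsum
  have h2 : 0 ≤ (∑ k ∈ Ts, C k) / w ^ 2 :=
    div_nonneg (Finset.sum_nonneg fun k hk => (hC0 k (hTsT k hk)).le) (sq_nonneg _)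
  -- What remains is `4 + (81 / 4) * 2880 ≤ 58400`.
  rw [e1, e2]
  linarith

end TwoSided

/-! ### Sparse sets of anchors. -/

section Anchors

/-- A sparse set of anchors meeting the interior of every interval of large energy. -/
lemma exists_anchors (cuts : Finset ℕ) (e : ℕ → ℕ → ℝ) (he0 : ∀ l p, 0 ≤ e l p)
    (hsup : ∀ l x y p, l ≤ x → x ≤ y → y ≤ p → e x y + e y p ≤ e l p) {s : ℝ} (hs : 0 < s)
    (hint : ∀ l ∈ cuts, ∀ p ∈ cuts, l < p → 0 < e l p → ∃ y ∈ cuts, l < y ∧ y < p) :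
    ∃ X ⊆ cuts, (∀ l ∈ cuts, ∀ p ∈ cuts, l < p → s ≤ e l p → ∃ x ∈ X, l < x ∧ x < p) ∧
      ∀ l p, l ≤ p → ((X.filter fun x => l < x ∧ x < p).card : ℝ) ≤ 3 * (e l p / s) + 2 := by
  classical
  let good (X : Finset ℕ) : Prop :=
    ∀ l ∈ cuts, ∀ p ∈ cuts, l < p → s ≤ e l p → ∃ x ∈ X, l < x ∧ x < p
  have hmono : ∀ l x y p, l ≤ x → x ≤ y → y ≤ p → e x y ≤ e l p := fun l x y p h1 h2 h3 => by
    linarith [hsup l x y p h1 h2 h3, he0 y p]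
  -- In a good set of least cardinality each point is the only one inside some interval of energy at
  -- least `s`.
  obtain ⟨X, hX, hXmin⟩ := (cuts.powerset.filter good).exists_min_image Finset.card
    ⟨cuts, Finset.mem_filter.2 ⟨Finset.mem_powerset_self _, fun l hl p hp hlp hsl =>
      hint l hl p hp hlp (hs.trans_le hsl)⟩⟩
  obtain ⟨hXc, hXg⟩ := Finset.mem_filter.1 hX
  rw [Finset.mem_powerset] at hXc
  refine ⟨X, hXc, hXg, ?_⟩
  have hpriv : ∀ x ∈ X, ∃ l p, l < x ∧ x < p ∧ s ≤ e l p ∧ ∀ y ∈ X, l < y → y < p → y = x := by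
    intro x hx
    have hng : ¬ good (X.erase x) := fun hg => by
      have h1 := hXmin (X.erase x) (Finset.mem_filter.2
        ⟨Finset.mem_powerset.2 ((Finset.erase_subset _ _).trans hXc), hg⟩)
      have h2 := Finset.card_erase_lt_of_mem hx
      omega
    simp only [good, not_forall] at hng
    obtain ⟨l, hl, p, hp, hlp, hsl, hno⟩ := hng
    have hno' : ∀ y ∈ X, l < y → y < p → y = x := fun y hy h1 h2 => by
      by_contra hne
      exact hno ⟨y, Finset.mem_erase.2 ⟨hne, hy⟩, h1, h2⟩
    obtain ⟨y, hy, h1, h2⟩ := hXg l hl p hp hlp hsl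
    have := hno' y hy h1 h2
    subst this
    exact ⟨l, p, h1, h2, hsl, hno'⟩
  have hmain : ∀ d l p, p - l ≤ d → l ≤ p →
      ((X.filter fun x => l < x ∧ x < p).card : ℝ) ≤ 3 * (e l p / s) + 2 := by
    intro d
    induction d with
    | zero =>
      intro l p hd hlp
      have : X.filter (fun x => l < x ∧ x < p) = ∅ := by
        refine Finset.filter_eq_empty_iff.2 fun x _ h => ?_
        omega
      rw [this]
      have := he0 l p
      simp only [Finset.card_empty, Nat.cast_zero]
      positivity
    | succ d ih =>
      intro l p hd hlp
      set A := X.filter fun x => l < x ∧ x < p with hA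
      by_cases hcard : A.card ≤ 2
      · have h1 : (A.card : ℝ) ≤ 2 := by exact_mod_cast hcard
        have := he0 l p
        have : 0 ≤ 3 * (e l p / s) := by positivity
        linarith
      have hA0 : A.Nonempty := Finset.card_pos.1 (by omega)
      -- The interval private to the second of three consecutive anchors lies between the first and
      -- the third, so `e y1 y3 ≥ s`. By superadditivity every three anchors consume an amount `s`
      -- of energy.
      set y1 := A.min' hA0
      have hy1 : y1 ∈ A := A.min'_mem _
      have hc1 : (A.erase y1).card = A.card - 1 := Finset.card_erase_of_mem hy1
      have hA1 : (A.erase y1).Nonempty := Finset.card_pos.1 (by omega)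
      set y2 := (A.erase y1).min' hA1
      have hy2 : y2 ∈ A.erase y1 := Finset.min'_mem _ _
      have hc2 : ((A.erase y1).erase y2).card = (A.erase y1).card - 1 :=
        Finset.card_erase_of_mem hy2
      have hA2 : ((A.erase y1).erase y2).Nonempty := Finset.card_pos.1 (by omega)
      set y3 := ((A.erase y1).erase y2).min' hA2
      have hy3 : y3 ∈ (A.erase y1).erase y2 := Finset.min'_mem _ _
      have hy2A := Finset.mem_of_mem_erase hy2
      have hy3A1 := Finset.mem_of_mem_erase hy3
      have hy3A := Finset.mem_of_mem_erase hy3A1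
      have h12 : y1 < y2 := lt_of_le_of_ne (A.min'_le _ hy2A) (Finset.ne_of_mem_erase hy2).symm
      have h23 : y2 < y3 := lt_of_le_of_ne (Finset.min'_le _ _ hy3A1)
        (Finset.ne_of_mem_erase hy3).symm
      obtain ⟨hy1X, hy1l, -⟩ := Finset.mem_filter.1 hy1
      obtain ⟨hy2X, -, -⟩ := Finset.mem_filter.1 hy2A
      obtain ⟨hy3X, -, hy3p⟩ := Finset.mem_filter.1 hy3A
      obtain ⟨l', p', hl', hp', hsl, hu⟩ := hpriv y2 hy2X
      have h1l : y1 ≤ l' := by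
        by_contra hc
        exact absurd (hu y1 hy1X (not_le.1 hc) (h12.trans hp')) h12.ne
      have h3p : p' ≤ y3 := by
        by_contra hc
        exact absurd (hu y3 hy3X (hl'.trans h23) (not_le.1 hc)) h23.ne'
      have hs13 : s ≤ e y1 y3 := hsl.trans (hmono _ _ _ _ h1l (hl'.trans hp').le h3p)
      have hih := ih y3 p (by omega) hy3p.le
      have hsub : A ⊆ {y1, y2, y3} ∪ X.filter fun x => y3 < x ∧ x < p := by
        intro z hz
        simp only [Finset.mem_union, Finset.mem_insert, Finset.mem_singleton, Finset.mem_filter]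
        by_cases hz1 : z = y1
        · simp [hz1]
        by_cases hz2 : z = y2
        · simp [hz2]
        by_cases hz3 : z = y3
        · simp [hz3]
        right
        obtain ⟨hzX, -, hzp⟩ := Finset.mem_filter.1 hz
        have : y3 ≤ z := Finset.min'_le _ _
          (Finset.mem_erase.2 ⟨hz2, Finset.mem_erase.2 ⟨hz1, hz⟩⟩)
        exact ⟨hzX, lt_of_le_of_ne this (Ne.symm hz3), hzp⟩
      have hcardle : (A.card : ℝ) ≤ 3 + ((X.filter fun x => y3 < x ∧ x < p).card : ℝ) := by
        have h1 := (Finset.card_le_card hsub).trans (Finset.card_union_le _ _)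
        have h2 : ({y1, y2, y3} : Finset ℕ).card ≤ 3 := Finset.card_le_three
        exact_mod_cast h1.trans (Nat.add_le_add_right h2 _)
      have hadd := hsup l y1 y3 p hy1l.le (h12.trans h23).le hy3p.le
      have h4 : e y3 p / s + 1 ≤ e l p / s := by
        rw [div_add_one hs.ne', div_le_div_iff_of_pos_right hs]
        linarith
      linarith
  exact fun l p hlp => hmain (p - l) l p le_rfl hlp

end Anchors

/-! ### Means and energies over integer intervals. -/

section Interval

/-- The mean of `φ` over an integer interval. -/
def intervalMean (φ : ℕ → ℝ) (l p : ℕ) : ℝ := (∑ k ∈ Finset.Ico l p, φ k) / (p - l : ℕ)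

/-- The energy of the deviations of `φ` from its mean over an integer interval. -/
def intervalEnergy (φ : ℕ → ℝ) (l p : ℕ) : ℝ :=
  ∑ k ∈ Finset.Ico l p, (φ k - intervalMean φ l p) ^ 2

lemma intervalEnergy_nonneg (φ : ℕ → ℝ) (l p : ℕ) : 0 ≤ intervalEnergy φ l p :=
  Finset.sum_nonneg fun _ _ => sq_nonneg _

lemma sum_sub_intervalMean (φ : ℕ → ℝ) {l p : ℕ} (h : l < p) :
    ∑ k ∈ Finset.Ico l p, (φ k - intervalMean φ l p) = 0 := by
  have h1 : ((p - l : ℕ) : ℝ) ≠ 0 := by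
    have : p - l ≠ 0 := by omega
    exact_mod_cast this
  rw [Finset.sum_sub_distrib, Finset.sum_const, Nat.card_Ico, nsmul_eq_mul, intervalMean]
  field_simp
  ring

lemma intervalEnergy_le (φ : ℕ → ℝ) (l p : ℕ) (z : ℝ) :
    intervalEnergy φ l p ≤ ∑ k ∈ Finset.Ico l p, (φ k - z) ^ 2 := by
  by_cases h : l < p
  · have e : ∑ k ∈ Finset.Ico l p, (φ k - z) ^ 2 = intervalEnergy φ l p +
        2 * (intervalMean φ l p - z) * ∑ k ∈ Finset.Ico l p, (φ k - intervalMean φ l p) +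
        ∑ _k ∈ Finset.Ico l p, (intervalMean φ l p - z) ^ 2 := by
      rw [intervalEnergy, Finset.mul_sum, ← Finset.sum_add_distrib, ← Finset.sum_add_distrib]
      exact Finset.sum_congr rfl fun k _ => by ring
    rw [e, sum_sub_intervalMean φ h, mul_zero, add_zero]
    have : 0 ≤ ∑ _k ∈ Finset.Ico l p, (intervalMean φ l p - z) ^ 2 :=
      Finset.sum_nonneg fun _ _ => sq_nonneg _
    linarith
  · rw [intervalEnergy, Finset.Ico_eq_empty_of_le (not_lt.1 h)]
    simp

lemma intervalEnergy_add_le (φ : ℕ → ℝ) (l x y p : ℕ) (h1 : l ≤ x) (h2 : x ≤ y) (h3 : y ≤ p) :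
    intervalEnergy φ x y + intervalEnergy φ y p ≤ intervalEnergy φ l p := by
  have e1 := intervalEnergy_le φ x y (intervalMean φ l p)
  have e2 := intervalEnergy_le φ y p (intervalMean φ l p)
  have e3 : ∑ k ∈ Finset.Ico x p, (φ k - intervalMean φ l p) ^ 2 ≤ intervalEnergy φ l p :=
    Finset.sum_le_sum_of_subset_of_nonneg (Finset.Ico_subset_Ico h1 le_rfl)
      fun _ _ _ => sq_nonneg _
  rw [← Finset.sum_Ico_consecutive _ h2 h3] at e3
  linarith

/-- A sum over an interval splits around an interior point, moving away from it. -/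
lemma sum_Ico_eq_sum_range_add (F : ℕ → ℝ) {l x p : ℕ} (h1 : l ≤ x) (h2 : x ≤ p) :
    ∑ k ∈ Finset.Ico l p, F k =
      ∑ t ∈ Finset.range (p - x), F (x + t) + ∑ t ∈ Finset.range (x - l), F (x - 1 - t) := by
  rw [← Finset.sum_Ico_consecutive _ h1 h2, add_comm, Finset.sum_Ico_eq_sum_range F x p,
    Finset.sum_Ico_eq_sum_range F l x]
  congr 1
  rw [← Finset.sum_range_reflect (fun t => F (x - 1 - t))]
  refine Finset.sum_congr rfl fun t ht => ?_
  rw [Finset.mem_range] at ht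
  congr 1
  omega

end Interval

/-! ### All intervals of bounded energy around one cut. -/

section Level

variable {Ω : Type*} [MeasurableSpace Ω] {μ : Measure Ω} [IsProbabilityMeasure μ]
  {ι : Type*} [DecidableEq ι] {η : ι → Ω → ℝ} {Λ ℓ : ℝ} {n : ℕ} {cuts : Finset ℕ} {φ : ℕ → ℝ}

/-- A signal which is constant on long blocks of consecutive integers, with ends at `cuts`. -/
structure CutSignal (n : ℕ) (ℓ : ℝ) (cuts : Finset ℕ) (φ : ℕ → ℝ) : Prop where
  le : ∀ x ∈ cuts, x ≤ n
  length : ∀ x ∈ cuts, ∀ y ∈ cuts, x < y → ℓ ≤ ((y - x : ℕ) : ℝ)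
  sq_le : ∀ x ∈ cuts, ∀ y ∈ cuts, x < y → ∀ z, ∀ k ∈ Finset.Ico x y,
    ℓ * (φ k - z) ^ 2 ≤ ∑ j ∈ Finset.Ico x y, (φ j - z) ^ 2
  interior : ∀ l ∈ cuts, ∀ p ∈ cuts, l < p → 0 < intervalEnergy φ l p →
    ∃ y ∈ cuts, l < y ∧ y < p

/-- The noise integrated against the deviations of the signal over an interval. -/
def intervalSum (η : ι → Ω → ℝ) (k : ℕ → ι) (φ : ℕ → ℝ) (r : ℕ × ℕ) (ω : Ω) : ℝ :=
  ∑ j ∈ Finset.Ico r.1 r.2, (φ j - intervalMean φ r.1 r.2) * η (k j) ω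

lemma sum_Ico_eq_sum_range_right (F : ℕ → ℝ) {x p : ℕ} :
    ∑ k ∈ Finset.Ico x p, F k = ∑ t ∈ Finset.range (p - x), F (x + t) :=
  Finset.sum_Ico_eq_sum_range F x p

lemma sum_Ico_eq_sum_range_left (F : ℕ → ℝ) {l x : ℕ} (h : l ≤ x) :
    ∑ k ∈ Finset.Ico l x, F k = ∑ t ∈ Finset.range (x - l), F (x - 1 - t) := by
  simpa using sum_Ico_eq_sum_range_add F h le_rfl

lemma injOn_add {k : ℕ → ι} (hk : Set.InjOn k (Set.Iio n)) {x : ℕ} (hx : x ≤ n) :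
    Set.InjOn (fun t => k (x + t)) (Set.Iio (n - x)) := by
  intro s hs t ht h
  simp only [Set.mem_Iio] at hs ht
  have := hk (Set.mem_Iio.2 (by omega)) (Set.mem_Iio.2 (by omega)) h
  omega

lemma injOn_sub {k : ℕ → ι} (hk : Set.InjOn k (Set.Iio n)) {x : ℕ} (hx : x ≤ n) :
    Set.InjOn (fun t => k (x - 1 - t)) (Set.Iio x) := by
  intro s hs t ht h
  simp only [Set.mem_Iio] at hs ht
  have := hk (Set.mem_Iio.2 (by omega)) (Set.mem_Iio.2 (by omega)) h
  omega

/-- Both sides are read outward from `x`, the points on its left being `x - 1 - t`. The right side,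
here the longer one, comes first. -/
lemma CutSignal.windowFamily_right (h : CutSignal n ℓ cuts φ) {x : ℕ} (hx : x ∈ cuts)
    {R : Finset (ℕ × ℕ)} (hR : ∀ r ∈ R, r.1 ∈ cuts ∧ r.2 ∈ cuts ∧ r.1 < x ∧ x < r.2) {w : ℝ}
    (hw : ∀ r ∈ R, intervalEnergy φ r.1 r.2 ≤ 8 * w ^ 2) (hlong : ∀ r ∈ R, x - r.1 ≤ r.2 - x) :
    WindowFamily ℓ w (n - x) x (fun t => φ (x + t)) (fun t => φ (x - 1 - t))
      (R.image fun r => (r.2 - x, x - r.1)) (fun p => intervalMean φ (x - p.2) (x + p.1)) := by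
  have key : ∀ Q : ℕ × ℕ → Prop, (∀ r ∈ R, Q (r.2 - x, x - r.1)) →
      ∀ p ∈ R.image fun r => (r.2 - x, x - r.1), Q p := by
    intro Q hQ p hp
    obtain ⟨r, hr, rfl⟩ := Finset.mem_image.1 hp
    exact hQ r hr
  have hends : ∀ r ∈ R, x - (x - r.1) = r.1 ∧ x + (r.2 - x) = r.2 := fun r hr => by
    obtain ⟨-, -, h3, h4⟩ := hR r hr
    omega
  refine ⟨key _ fun r hr => ?_, key _ fun r hr => ?_, key _ fun r hr => hlong r hr,
    key _ fun r hr => ?_, key _ fun r hr => ?_, key _ fun r hr => ?_, key _ fun r hr => ?_,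
    key _ fun r hr => ?_⟩ <;> obtain ⟨h1, h2, h3, h4⟩ := hR r hr
  · have := h.le _ h2
    dsimp only
    omega
  · dsimp only; omega
  · exact h.length _ h1 _ hx h3
  · intro z t ht
    have := h.sq_le _ hx _ h2 h4 z (x + t) (Finset.mem_Ico.2 (by dsimp only at ht; omega))
    rwa [sum_Ico_eq_sum_range_right] at this
  · intro z t ht
    have := h.sq_le _ h1 _ hx h3 z (x - 1 - t) (Finset.mem_Ico.2 (by dsimp only at ht; omega))
    rwa [sum_Ico_eq_sum_range_left _ h3.le] at this
  · have := hw r hr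
    rw [intervalEnergy, sum_Ico_eq_sum_range_add _ h3.le h4.le] at this
    dsimp only
    rwa [(hends r hr).1, (hends r hr).2]
  · have := sum_sub_intervalMean φ (h3.trans h4)
    rw [sum_Ico_eq_sum_range_add _ h3.le h4.le] at this
    dsimp only
    rwa [(hends r hr).1, (hends r hr).2]

lemma CutSignal.windowFamily_left (h : CutSignal n ℓ cuts φ) {x : ℕ} (hx : x ∈ cuts)
    {R : Finset (ℕ × ℕ)} (hR : ∀ r ∈ R, r.1 ∈ cuts ∧ r.2 ∈ cuts ∧ r.1 < x ∧ x < r.2) {w : ℝ}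
    (hw : ∀ r ∈ R, intervalEnergy φ r.1 r.2 ≤ 8 * w ^ 2) (hlong : ∀ r ∈ R, r.2 - x ≤ x - r.1) :
    WindowFamily ℓ w x (n - x) (fun t => φ (x - 1 - t)) (fun t => φ (x + t))
      (R.image fun r => (x - r.1, r.2 - x)) (fun p => intervalMean φ (x - p.1) (x + p.2)) := by
  have key : ∀ Q : ℕ × ℕ → Prop, (∀ r ∈ R, Q (x - r.1, r.2 - x)) →
      ∀ p ∈ R.image fun r => (x - r.1, r.2 - x), Q p := by
    intro Q hQ p hp
    obtain ⟨r, hr, rfl⟩ := Finset.mem_image.1 hp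
    exact hQ r hr
  have hends : ∀ r ∈ R, x - (x - r.1) = r.1 ∧ x + (r.2 - x) = r.2 := fun r hr => by
    obtain ⟨-, -, h3, h4⟩ := hR r hr
    omega
  refine ⟨key _ fun r hr => ?_, key _ fun r hr => ?_, key _ fun r hr => hlong r hr,
    key _ fun r hr => ?_, key _ fun r hr => ?_, key _ fun r hr => ?_, key _ fun r hr => ?_,
    key _ fun r hr => ?_⟩ <;> obtain ⟨h1, h2, h3, h4⟩ := hR r hr
  · dsimp only; omega
  · have := h.le _ h2
    dsimp only
    omega
  · exact h.length _ hx _ h2 h4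
  · intro z t ht
    have := h.sq_le _ h1 _ hx h3 z (x - 1 - t) (Finset.mem_Ico.2 (by dsimp only at ht; omega))
    rwa [sum_Ico_eq_sum_range_left _ h3.le] at this
  · intro z t ht
    have := h.sq_le _ hx _ h2 h4 z (x + t) (Finset.mem_Ico.2 (by dsimp only at ht; omega))
    rwa [sum_Ico_eq_sum_range_right] at this
  · have := hw r hr
    rw [intervalEnergy, sum_Ico_eq_sum_range_add _ h3.le h4.le] at this
    dsimp only
    rw [(hends r hr).1, (hends r hr).2]
    linarith
  · have := sum_sub_intervalMean φ (h3.trans h4)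
    rw [sum_Ico_eq_sum_range_add _ h3.le h4.le] at this
    dsimp only
    rw [(hends r hr).1, (hends r hr).2]
    linarith

/-- Deviations of the noise over all the intervals of bounded energy around a cut. -/
lemma CutSignal.measure_intervalSum_le (h : CutSignal n ℓ cuts φ)
    (hη : LocallySubgaussian μ η Λ ℓ) (hΛ : 0 ≤ Λ) (hℓ : 0 < ℓ) {k : ℕ → ι}
    (hk : Set.InjOn k (Set.Iio n)) {x : ℕ} (hx : x ∈ cuts) {R : Finset (ℕ × ℕ)}
    (hR : ∀ r ∈ R, r.1 ∈ cuts ∧ r.2 ∈ cuts ∧ r.1 < x ∧ x < r.2) {w : ℝ} (hw : 0 < w)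
    (hRw : ∀ r ∈ R, intervalEnergy φ r.1 r.2 ≤ 8 * w ^ 2) {y : ℝ} (hy : 2 ≤ Λ * y) :
    μ {ω | ∃ r ∈ R, 8 * w * y ≤ |intervalSum η k φ r ω|} ≤
      ENNReal.ofReal (116800 * Real.exp (Λ ^ 2 / 2 - Λ * y)) := by
  classical
  have hxn := h.le x hx
  -- Intervals are separated according to which side of `x` is longer, hence `116800 = 2 * 58400`.
  have h1 := (h.windowFamily_right hx (R := R.filter fun r => x - r.1 ≤ r.2 - x)
    (fun r hr => hR r (Finset.mem_filter.1 hr).1) (fun r hr => hRw r (Finset.mem_filter.1 hr).1)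
    (fun r hr => (Finset.mem_filter.1 hr).2)).measure_windowSum_le hη hΛ hℓ (injOn_add hk hxn)
    (injOn_sub hk hxn) hw hy
  have h2 := (h.windowFamily_left hx (R := R.filter fun r => r.2 - x ≤ x - r.1)
    (fun r hr => hR r (Finset.mem_filter.1 hr).1) (fun r hr => hRw r (Finset.mem_filter.1 hr).1)
    (fun r hr => (Finset.mem_filter.1 hr).2)).measure_windowSum_le hη hΛ hℓ (injOn_sub hk hxn)
    (injOn_add hk hxn) hw hy
  refine (measure_mono (t := _ ∪ _) ?_).trans ((measure_union_le _ _).trans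
    ((add_le_add h1 h2).trans (le_of_eq ?_)))
  · rintro ω ⟨r, hr, hω⟩
    obtain ⟨-, -, h3, h4⟩ := hR r hr
    have e1 : x - (x - r.1) = r.1 := by omega
    have e2 : x + (r.2 - x) = r.2 := by omega
    rw [intervalSum, sum_Ico_eq_sum_range_add _ h3.le h4.le] at hω
    rcases le_total (x - r.1) (r.2 - x) with h5 | h5
    · refine Or.inl ⟨_, Finset.mem_image_of_mem _ (Finset.mem_filter.2 ⟨hr, h5⟩), ?_⟩
      simp only [windowSum, e1, e2]
      exact hω
    · refine Or.inr ⟨_, Finset.mem_image_of_mem _ (Finset.mem_filter.2 ⟨hr, h5⟩), ?_⟩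
      simp only [windowSum, e1, e2]
      rwa [add_comm]
  · rw [← ENNReal.ofReal_add (by positivity) (by positivity)]
    congr 1; ring

/-- The largest excess of `2 |Y|` over a threshold among a family of intervals. -/
def maxExcess (η : ι → Ω → ℝ) (k : ℕ → ι) (φ : ℕ → ℝ) (R : Finset (ℕ × ℕ)) (T : ℝ) (ω : Ω) : ℝ :=
  ((R.sup fun r => (2 * |intervalSum η k φ r ω| - T).toNNReal : NNReal) : ℝ)

lemma maxExcess_nonneg (k : ℕ → ι) (R : Finset (ℕ × ℕ)) (T : ℝ) (ω : Ω) :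
    0 ≤ maxExcess η k φ R T ω := NNReal.coe_nonneg _

lemma le_maxExcess (k : ℕ → ι) {R : Finset (ℕ × ℕ)} {r : ℕ × ℕ} (hr : r ∈ R) (T : ℝ) (ω : Ω) :
    2 * |intervalSum η k φ r ω| - T ≤ maxExcess η k φ R T ω := by
  have h := Finset.le_sup (f := fun r => (2 * |intervalSum η k φ r ω| - T).toNNReal) hr
  exact (Real.le_coe_toNNReal _).trans (NNReal.coe_le_coe.2 h)

lemma measurable_intervalSum (hm : ∀ i, Measurable (η i)) (k : ℕ → ι) (r : ℕ × ℕ) :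
    Measurable (intervalSum η k φ r) :=
  Finset.measurable_sum _ fun j _ => (hm (k j)).const_mul _

lemma measurable_maxExcess (hm : ∀ i, Measurable (η i)) (k : ℕ → ι) (R : Finset (ℕ × ℕ))
    (T : ℝ) : Measurable (maxExcess η k φ R T) := by
  classical
  refine Measurable.coe_nnreal_real ?_
  induction R using Finset.induction_on with
  | empty => simp
  | insert r R _ ih =>
    simp only [Finset.sup_insert]
    refine Measurable.sup ?_ ih
    exact (((measurable_intervalSum hm k r).abs.const_mul 2).sub_const T).real_toNNReal

/-- The tail at height `t` is the deviation bound with `y = (T + t) / (16 w)`; the condition on `T`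
guarantees `2 ≤ Λ y`. -/
lemma CutSignal.lintegral_maxExcess_le (h : CutSignal n ℓ cuts φ)
    (hη : LocallySubgaussian μ η Λ ℓ) (hΛ : 0 < Λ) (hℓ : 0 < ℓ) {k : ℕ → ι}
    (hk : Set.InjOn k (Set.Iio n)) {x : ℕ} (hx : x ∈ cuts) {R : Finset (ℕ × ℕ)}
    (hR : ∀ r ∈ R, r.1 ∈ cuts ∧ r.2 ∈ cuts ∧ r.1 < x ∧ x < r.2) {w : ℝ} (hw : 0 < w)
    (hRw : ∀ r ∈ R, intervalEnergy φ r.1 r.2 ≤ 8 * w ^ 2) {T : ℝ} (hT : 32 * w ≤ Λ * T) :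
    ∫⁻ ω, ENNReal.ofReal (maxExcess η k φ R T ω) ∂μ ≤
      ENNReal.ofReal (116800 * Real.exp (Λ ^ 2 / 2 - Λ * (T / (16 * w))) * (16 * w / Λ)) := by
  refine lintegral_ofReal_le_of_tail (measurable_maxExcess hη.meas k R T) (by positivity)
    (by positivity) fun t ht => ?_
  have hy : 2 ≤ Λ * ((T + t) / (16 * w)) := by
    rw [mul_div_assoc', le_div_iff₀ (by positivity)]
    have : 0 < Λ * t := by positivity
    nlinarith
  refine (measure_mono ?_).trans ((h.measure_intervalSum_le hη hΛ.le hℓ hk hx hR hw hRw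
    hy).trans (le_of_eq ?_))
  · intro ω hω
    have hω' : t ≤ maxExcess η k φ R T ω := hω
    have h1 : t.toNNReal ≤ R.sup fun r => (2 * |intervalSum η k φ r ω| - T).toNNReal := by
      rw [Real.toNNReal_le_iff_le_coe]; exact hω'
    rw [Finset.le_sup_iff (by simpa using ht)] at h1
    obtain ⟨r, hr, h2⟩ := h1
    refine ⟨r, hr, ?_⟩
    have h3 : t ≤ 2 * |intervalSum η k φ r ω| - T := by
      by_contra hcon
      have h4 := (Real.toNNReal_lt_toNNReal_iff ht).2 (not_le.1 hcon)
      exact absurd h2 (not_le.2 h4)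
    have e : 8 * w * ((T + t) / (16 * w)) = (T + t) / 2 := by field_simp; ring
    rw [e]; linarith
  · rw [mul_assoc, ← Real.exp_add]
    congr 3
    field_simp
    ring

end Level

/-! ### Numerical size of the mean excess at one energy level. -/

section Numeric

lemma exp_neg_twenty_le : Real.exp (-20) ≤ 9 * 10 ^ (-8 : ℤ) := by
  have h1 : (2.5 : ℝ) ^ 20 ≤ Real.exp 20 := by
    have h2 : Real.exp 20 = Real.exp 1 ^ 20 := by rw [← Real.exp_nat_mul]; norm_num
    rw [h2]
    have := Real.exp_one_gt_d9
    gcongr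
    linarith
  rw [Real.exp_neg, inv_le_comm₀ (Real.exp_pos _) (by norm_num)]
  refine le_trans ?_ h1
  norm_num

/-- The bound on the mean excess at the level where energies are about `6.4 w²`. -/
def levelBound (w : ℝ) : ℝ :=
  116800 * Real.exp ((8 / 3) ^ 2 / 2 - 8 / 3 * ((3.2 * (6.4 * w ^ 2) + 280) / (16 * w))) *
    (16 * w / (8 / 3))

lemma levelBound_nonneg {w : ℝ} (hw : 0 < w) : 0 ≤ levelBound w := by
  rw [levelBound]; positivity

lemma levelBound_eq {w : ℝ} (hw : 0 < w) : levelBound w =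
    700800 * w * Real.exp (32 / 9 - 256 / 75 * w - 140 / 3 / w) := by
  have e : (8 / 3 : ℝ) ^ 2 / 2 - 8 / 3 * ((3.2 * (6.4 * w ^ 2) + 280) / (16 * w)) =
      32 / 9 - 256 / 75 * w - 140 / 3 / w := by
    field_simp; norm_num; ring
  rw [levelBound, e]
  ring

/-- Useful at low levels. A factor `w³` is extracted from `exp (-15 / w)`, a part of `exp (-(140 /
3) / w)`; the rest of the exponent is bounded by completing a square. -/
lemma three_mul_levelBound_le_sq {w : ℝ} (hw : 0 < w) :
    3 * levelBound w ≤ 1.5 / 10000 * (6.4 * w ^ 2) ^ 2 := by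
  have h1 : 5 / w ≤ Real.exp (5 / w - 1) := by linarith [Real.add_one_le_exp (5 / w - 1)]
  have h2 : 125 / w ^ 3 ≤ Real.exp (15 / w - 3) := by
    calc 125 / w ^ 3 = (5 / w) ^ 3 := by rw [div_pow]; norm_num
      _ ≤ Real.exp (5 / w - 1) ^ 3 := by gcongr
      _ = _ := by
          rw [← Real.exp_nat_mul]; congr 1; push_cast; ring
  have h3 : 32 / 9 - 256 / 75 * w - 140 / 3 / w + (15 / w - 3) ≤ -20 := by
    have h4 : 20.6 ≤ 256 / 75 * w + 95 / 3 / w := by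
      have h5 : 256 / 75 * w + 95 / 3 / w = (256 / 75 * w ^ 2 + 95 / 3) / w := by
        field_simp
      rw [h5, le_div_iff₀ hw]
      -- The hint uses the vertex `20.6 / (2 * 256 / 75)` of the quadratic.
      nlinarith [sq_nonneg (w - 3.017)]
    have h6 : 140 / 3 / w = 95 / 3 / w + 15 / w := by ring
    linarith
  have h7 : Real.exp (32 / 9 - 256 / 75 * w - 140 / 3 / w) * (125 / w ^ 3) ≤
      9 * 10 ^ (-8 : ℤ) := by
    calc _ ≤ Real.exp (32 / 9 - 256 / 75 * w - 140 / 3 / w) * Real.exp (15 / w - 3) := by gcongr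
      _ ≤ Real.exp (-20) := by rw [← Real.exp_add]; exact Real.exp_le_exp.2 h3
      _ ≤ _ := exp_neg_twenty_le
  rw [mul_div_assoc', div_le_iff₀ (by positivity)] at h7
  rw [levelBound_eq hw]
  have h8 : 0 < w ^ 4 := by positivity
  have h9 : w * (Real.exp (32 / 9 - 256 / 75 * w - 140 / 3 / w) * 125) ≤
      w * (9 * 10 ^ (-8 : ℤ) * w ^ 3) := by gcongr
  have h10 : w * (9 * 10 ^ (-8 : ℤ) * w ^ 3) = 9 * 10 ^ (-8 : ℤ) * w ^ 4 := by ring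
  rw [h10] at h9
  norm_num at h9 ⊢
  nlinarith

/-- Useful at high levels. A factor `w ^ (-3)` is now extracted from part of the term linear in `w`
of the exponent. -/
lemma three_mul_levelBound_le_inv {w : ℝ} (hw : 0 < w) :
    3 * levelBound w ≤ 80 / (6.4 * w ^ 2) := by
  have h1 : w / 4 ≤ Real.exp (w / 4 - 1) := by linarith [Real.add_one_le_exp (w / 4 - 1)]
  have h2 : w ^ 3 / 64 ≤ Real.exp (3 / 4 * w - 3) := by
    calc w ^ 3 / 64 = (w / 4) ^ 3 := by rw [div_pow]; norm_num
      _ ≤ Real.exp (w / 4 - 1) ^ 3 := by gcongr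
      _ = _ := by
          rw [← Real.exp_nat_mul]; congr 1; push_cast; ring
  have h3 : 32 / 9 - 256 / 75 * w - 140 / 3 / w + (3 / 4 * w - 3) ≤ -20 := by
    have h4 : 22 ≤ 799 / 300 * w + 140 / 3 / w := by
      have h5 : 799 / 300 * w + 140 / 3 / w = (799 / 300 * w ^ 2 + 140 / 3) / w := by
        field_simp
      rw [h5, le_div_iff₀ hw]
      nlinarith [sq_nonneg (w - 4.13)]
    linarith
  have h7 : Real.exp (32 / 9 - 256 / 75 * w - 140 / 3 / w) * (w ^ 3 / 64) ≤
      9 * 10 ^ (-8 : ℤ) := by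
    calc _ ≤ Real.exp (32 / 9 - 256 / 75 * w - 140 / 3 / w) * Real.exp (3 / 4 * w - 3) := by
          gcongr
      _ ≤ Real.exp (-20) := by rw [← Real.exp_add]; exact Real.exp_le_exp.2 h3
      _ ≤ _ := exp_neg_twenty_le
  rw [levelBound_eq hw, le_div_iff₀ (by positivity)]
  norm_num at h7 ⊢
  nlinarith

end Numeric

/-! ### Summation over energy levels, simultaneously for all interval partitions. -/

section Multiscale

/-- The two bounds make both sums geometric, the first for levels up to `80` and the second above.
-/
lemma sum_level_le (Q : Finset ℤ) (E : ℤ → ℝ)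
    (h1 : ∀ q ∈ Q, E q ≤ 1.5 / 10000 * ((5 / 4 : ℝ) ^ q) ^ 2)
    (h2 : ∀ q ∈ Q, E q ≤ 80 / (5 / 4 : ℝ) ^ q) :
    ∑ q ∈ Q, E q ≤ 22.4 ∧ ∑ q ∈ Q, E q / (5 / 4 : ℝ) ^ q ≤ 0.3 := by
  have hA := sum_zpow_le (r := 5 / 4) (by norm_num) (Q.filter fun q => (5 / 4 : ℝ) ^ q ≤ 80)
    (X := 80) (by norm_num) fun k hk => (Finset.mem_filter.1 hk).2
  have hB := sum_inv_zpow_le (r := 5 / 4) (by norm_num)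
    (Q.filter fun q => ¬ (5 / 4 : ℝ) ^ q ≤ 80) (X := 80) (by norm_num)
    fun k hk => (not_le.1 (Finset.mem_filter.1 hk).2).le
  have hpos : ∀ q : ℤ, 0 < (5 / 4 : ℝ) ^ q := fun q => by positivity
  constructor
  · rw [← Finset.sum_filter_add_sum_filter_not Q (fun q => (5 / 4 : ℝ) ^ q ≤ 80)]
    have e1 : ∑ q ∈ Q.filter (fun q => (5 / 4 : ℝ) ^ q ≤ 80), E q ≤
        0.012 * ∑ q ∈ Q.filter (fun q => (5 / 4 : ℝ) ^ q ≤ 80), (5 / 4 : ℝ) ^ q := by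
      rw [Finset.mul_sum]
      refine Finset.sum_le_sum fun q hq => ?_
      obtain ⟨hq, hq'⟩ := Finset.mem_filter.1 hq
      have := h1 q hq
      nlinarith [hpos q]
    have e2 : ∑ q ∈ Q.filter (fun q => ¬ (5 / 4 : ℝ) ^ q ≤ 80), E q ≤
        80 * ∑ q ∈ Q.filter (fun q => ¬ (5 / 4 : ℝ) ^ q ≤ 80), ((5 / 4 : ℝ) ^ q)⁻¹ := by
      rw [Finset.mul_sum]
      refine Finset.sum_le_sum fun q hq => ?_
      rw [← div_eq_mul_inv]
      exact h2 q (Finset.mem_filter.1 hq).1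
    norm_num at hA hB e1 e2 ⊢
    linarith
  · rw [← Finset.sum_filter_add_sum_filter_not Q (fun q => (5 / 4 : ℝ) ^ q ≤ 80)]
    have e1 : ∑ q ∈ Q.filter (fun q => (5 / 4 : ℝ) ^ q ≤ 80), E q / (5 / 4 : ℝ) ^ q ≤
        1.5 / 10000 * ∑ q ∈ Q.filter (fun q => (5 / 4 : ℝ) ^ q ≤ 80), (5 / 4 : ℝ) ^ q := by
      rw [Finset.mul_sum]
      refine Finset.sum_le_sum fun q hq => ?_
      rw [div_le_iff₀ (hpos q)]
      have := h1 q (Finset.mem_filter.1 hq).1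
      linarith
    have e2 : ∑ q ∈ Q.filter (fun q => ¬ (5 / 4 : ℝ) ^ q ≤ 80), E q / (5 / 4 : ℝ) ^ q ≤
        ∑ q ∈ Q.filter (fun q => ¬ (5 / 4 : ℝ) ^ q ≤ 80), ((5 / 4 : ℝ) ^ q)⁻¹ := by
      refine Finset.sum_le_sum fun q hq => ?_
      obtain ⟨hq, hq'⟩ := Finset.mem_filter.1 hq
      have h3 := h2 q hq
      have h4 : 80 / (5 / 4 : ℝ) ^ q ≤ 1 := by
        rw [div_le_one (hpos q)]; exact (not_le.1 hq').le
      rw [inv_eq_one_div]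
      exact div_le_div_of_nonneg_right (h3.trans h4) (hpos q).le
    norm_num at hA hB e1 e2 ⊢
    linarith

/-- A partition of `{0, …, n - 1}` into intervals with ends at `cuts`. -/
structure IsIntervalPartition (n : ℕ) (cuts : Finset ℕ) (𝓘 : Finset (ℕ × ℕ)) : Prop where
  mem : ∀ I ∈ 𝓘, I.1 ∈ cuts ∧ I.2 ∈ cuts ∧ I.1 < I.2
  cover : ∀ x < n, ∃ I ∈ 𝓘, I.1 ≤ x ∧ x < I.2
  disjoint : ∀ I ∈ 𝓘, ∀ J ∈ 𝓘, ∀ x, I.1 ≤ x → x < I.2 → J.1 ≤ x → x < J.2 → I = J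

variable {Ω : Type*} [MeasurableSpace Ω] {μ : Measure Ω} [IsProbabilityMeasure μ]
  {ι : Type*} [DecidableEq ι] {η : ι → Ω → ℝ} {ℓ : ℝ} {n : ℕ} {cuts : Finset ℕ} {φ : ℕ → ℝ}

/-- Points of `{0, …, n - 1}` are counted through the intervals of a partition. -/
lemma IsIntervalPartition.card_le {𝓘 : Finset (ℕ × ℕ)} (h𝓘 : IsIntervalPartition n cuts 𝓘)
    (X : Finset ℕ) : ((X.filter fun x => x < n).card : ℝ) ≤
      ∑ I ∈ 𝓘, (((X.filter fun x => I.1 < x ∧ x < I.2).card : ℝ) + 1) := by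
  classical
  have h1 : X.filter (fun x => x < n) ⊆
      𝓘.biUnion fun I => insert I.1 (X.filter fun x => I.1 < x ∧ x < I.2) := by
    intro x hx
    obtain ⟨hxX, hxn⟩ := Finset.mem_filter.1 hx
    obtain ⟨I, hI, h1, h2⟩ := h𝓘.cover x hxn
    refine Finset.mem_biUnion.2 ⟨I, hI, ?_⟩
    rw [Finset.mem_insert, Finset.mem_filter]
    rcases h1.eq_or_lt with h3 | h3
    · exact Or.inl h3.symm
    · exact Or.inr ⟨hxX, h3, h2⟩
  have h2 := (Finset.card_le_card h1).trans Finset.card_biUnion_le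
  have h3 : ∑ I ∈ 𝓘, (insert I.1 (X.filter fun x => I.1 < x ∧ x < I.2)).card ≤
      ∑ I ∈ 𝓘, ((X.filter fun x => I.1 < x ∧ x < I.2).card + 1) :=
    Finset.sum_le_sum fun I _ => Finset.card_insert_le _ _
  exact_mod_cast h2.trans h3

/-- The noise integrated against the deviations of the signal over the intervals of a partition is
controlled simultaneously for all partitions. -/
theorem CutSignal.exists_multiscale_bound (h : CutSignal n ℓ cuts φ)
    (hη : LocallySubgaussian μ η (8 / 3) ℓ) (hℓ : 0 < ℓ) {k : ℕ → ι}
    (hk : Set.InjOn k (Set.Iio n)) :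
    ∃ Z : Ω → ℝ, Integrable Z μ ∧ ∫ ω, Z ω ∂μ ≤ 0 ∧
      ∀ 𝓘, IsIntervalPartition n cuts 𝓘 → ∀ ω,
        ∑ I ∈ 𝓘, (2 * |intervalSum η k φ I ω| - 3.5 * intervalEnergy φ I.1 I.2 - 302.4) ≤
          Z ω := by
  classical
  set e : ℕ × ℕ → ℝ := fun r => intervalEnergy φ r.1 r.2 with he
  have hlev : ∀ r : ℕ × ℕ, ∃ q : ℤ, 0 < e r →
      e r ∈ Set.Ico ((5 / 4 : ℝ) ^ q) ((5 / 4 : ℝ) ^ (q + 1)) := by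
    intro r
    by_cases hr : 0 < e r
    · obtain ⟨q, hq⟩ := exists_mem_Ico_zpow (x := e r) (y := 5 / 4) hr (by norm_num)
      exact ⟨q, fun _ => hq⟩
    · exact ⟨0, fun h => absurd h hr⟩
  choose lev hlev using hlev
  set pairs := (cuts ×ˢ cuts).filter fun r => r.1 < r.2 ∧ 0 < e r with hpairs
  have hmem : ∀ r ∈ pairs, r.1 ∈ cuts ∧ r.2 ∈ cuts ∧ r.1 < r.2 ∧ 0 < e r := fun r hr => by
    obtain ⟨h1, h2⟩ := Finset.mem_filter.1 hr
    obtain ⟨h3, h4⟩ := Finset.mem_product.1 h1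
    exact ⟨h3, h4, h2⟩
  set Q := pairs.image lev with hQ
  set s : ℤ → ℝ := fun q => (5 / 4 : ℝ) ^ q with hs
  have hs0 : ∀ q, 0 < s q := fun q => by simp only [hs]; positivity
  -- Energies at level `q` are below `(5 / 4) s q = 8 (w q)²`, the bound required of a window
  -- family.
  set w : ℤ → ℝ := fun q => √(s q / 6.4) with hw
  have hw0 : ∀ q, 0 < w q := fun q => Real.sqrt_pos.2 (by have := hs0 q; positivity)
  have hsw : ∀ q, 6.4 * w q ^ 2 = s q := fun q => by
    simp only [hw]
    rw [Real.sq_sqrt (by have := hs0 q; positivity)]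
    field_simp
  have hanch := fun q => exists_anchors cuts (intervalEnergy φ) (intervalEnergy_nonneg φ)
    (intervalEnergy_add_le φ) (hs0 q) h.interior
  choose X hXc hXg hXcard using hanch
  let X' (q : ℤ) : Finset ℕ := (X q).filter fun x => x < n
  let R (q : ℤ) (x : ℕ) : Finset (ℕ × ℕ) := pairs.filter fun r => lev r = q ∧ r.1 < x ∧ x < r.2
  let T (q : ℤ) : ℝ := 3.2 * (6.4 * w q ^ 2) + 280
  let D (q : ℤ) (x : ℕ) : Ω → ℝ := maxExcess η k φ (R q x) (T q)
  have hD0 : ∀ q x ω, 0 ≤ D q x ω := fun q x ω => maxExcess_nonneg k _ _ _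
  have hDm : ∀ q x, Measurable (D q x) := fun q x => measurable_maxExcess hη.meas k _ _
  have hDE : ∀ q, ∀ x ∈ X' q, ∫⁻ ω, ENNReal.ofReal (D q x ω) ∂μ ≤
      ENNReal.ofReal (levelBound (w q)) := by
    intro q x hx
    refine h.lintegral_maxExcess_le hη (by norm_num) hℓ hk (hXc q (Finset.mem_filter.1 hx).1)
      (fun r hr => ?_) (hw0 q) (fun r hr => ?_) ?_
    · obtain ⟨h1, -, h2, h3⟩ := Finset.mem_filter.1 hr
      obtain ⟨h4, h5, -⟩ := hmem r h1
      exact ⟨h4, h5, h2, h3⟩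
    · obtain ⟨h1, rfl, -⟩ := Finset.mem_filter.1 hr
      have h2 := (hlev r (hmem r h1).2.2.2).2
      rw [zpow_add_one₀ (by norm_num)] at h2
      have h3 := hsw (lev r)
      have h4 : e r < s (lev r) * (5 / 4) := h2
      have h5 : intervalEnergy φ r.1 r.2 = e r := rfl
      rw [h5]
      linarith
    · simp only [T]
      nlinarith [sq_nonneg (w q - 1), hw0 q]
  -- This bound on the expected total excess involves no partition. It is subtracted from the
  -- majorant, and then recovered from the blocks of any partition, since these must contain all the
  -- anchors.
  set zbar : ℝ := ∑ q ∈ Q, (X' q).card * levelBound (w q) with hzbar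
  have hzbar0 : 0 ≤ zbar := Finset.sum_nonneg fun q _ =>
    mul_nonneg (Nat.cast_nonneg _) (levelBound_nonneg (hw0 q))
  have hlin : ∫⁻ ω, ENNReal.ofReal (∑ q ∈ Q, ∑ x ∈ X' q, D q x ω) ∂μ ≤ ENNReal.ofReal zbar := by
    simp_rw [fun ω => ENNReal.ofReal_sum_of_nonneg (s := Q) (f := fun q => ∑ x ∈ X' q, D q x ω)
      (fun q _ => Finset.sum_nonneg fun x _ => hD0 q x ω),
      fun q ω => ENNReal.ofReal_sum_of_nonneg (s := X' q) (f := fun x => D q x ω)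
        (fun x _ => hD0 q x ω)]
    rw [lintegral_finsetSum _ fun q _ => Finset.measurable_sum _ fun x _ =>
      (hDm q x).ennreal_ofReal, hzbar, ENNReal.ofReal_sum_of_nonneg fun q _ =>
        mul_nonneg (Nat.cast_nonneg _) (levelBound_nonneg (hw0 q))]
    refine Finset.sum_le_sum fun q _ => ?_
    rw [lintegral_finsetSum _ fun x _ => (hDm q x).ennreal_ofReal]
    refine (Finset.sum_le_sum (hDE q)).trans (le_of_eq ?_)
    rw [Finset.sum_const, nsmul_eq_mul, ENNReal.ofReal_mul (Nat.cast_nonneg _),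
      ENNReal.ofReal_natCast]
  obtain ⟨hint, hle⟩ := integrable_and_integral_le
    (Finset.measurable_sum Q fun q _ => Finset.measurable_sum (X' q) fun x _ => hDm q x)
    (fun ω => Finset.sum_nonneg fun q _ => Finset.sum_nonneg fun x _ => hD0 q x ω) hzbar0 hlin
  refine ⟨fun ω => (∑ q ∈ Q, ∑ x ∈ X' q, D q x ω) - zbar, hint.sub (integrable_const _), ?_,
    fun 𝓘 h𝓘 ω => ?_⟩
  · rw [integral_sub hint (integrable_const _)]
    simpa using hle
  have hE0 : ∀ q, 0 ≤ 3 * levelBound (w q) := fun q => by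
    have := levelBound_nonneg (hw0 q)
    positivity
  obtain ⟨hS1, hS2⟩ := sum_level_le Q (fun q => 3 * levelBound (w q))
    (fun q _ => by have := three_mul_levelBound_le_sq (hw0 q); rwa [hsw] at this)
    (fun q _ => by have := three_mul_levelBound_le_inv (hw0 q); rwa [hsw] at this)
  -- A block has at most `3 e / s + 2` anchors in its interior and possibly one at its left end.
  have hzle : zbar ≤ ∑ I ∈ 𝓘, (0.3 * e I + 22.4) := by
    calc zbar ≤ ∑ q ∈ Q, ∑ I ∈ 𝓘, (3 * (e I / s q) + 3) * levelBound (w q) := by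
          refine Finset.sum_le_sum fun q _ => ?_
          rw [← Finset.sum_mul]
          refine mul_le_mul_of_nonneg_right ?_ (levelBound_nonneg (hw0 q))
          refine (h𝓘.card_le (X q)).trans (Finset.sum_le_sum fun I hI => ?_)
          have := hXcard q I.1 I.2 (h𝓘.mem I hI).2.2.le
          simp only [he]
          linarith
      _ = ∑ I ∈ 𝓘, (e I * ∑ q ∈ Q, 3 * levelBound (w q) / s q +
            ∑ q ∈ Q, 3 * levelBound (w q)) := by
          rw [Finset.sum_comm]
          refine Finset.sum_congr rfl fun I _ => ?_
          rw [Finset.mul_sum, ← Finset.sum_add_distrib]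
          exact Finset.sum_congr rfl fun q _ => by ring
      _ ≤ _ := by
          refine Finset.sum_le_sum fun I _ => ?_
          have h1 : e I * ∑ q ∈ Q, 3 * levelBound (w q) / s q ≤ e I * 0.3 :=
            mul_le_mul_of_nonneg_left hS2 (intervalEnergy_nonneg φ I.1 I.2)
          linarith
  have hpath : ∑ I ∈ 𝓘, (2 * |intervalSum η k φ I ω| - 3.2 * e I - 280) ≤
      ∑ q ∈ Q, ∑ x ∈ X' q, D q x ω := by
    set 𝓙 := 𝓘.filter fun I => 0 < e I with h𝓙
    have hx : ∀ I ∈ 𝓙, ∃ x ∈ X' (lev I), I.1 < x ∧ x < I.2 := by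
      intro I hI
      obtain ⟨hI, heI⟩ := Finset.mem_filter.1 hI
      obtain ⟨h1, h2, h3⟩ := h𝓘.mem I hI
      obtain ⟨x, hx, h4, h5⟩ := hXg (lev I) I.1 h1 I.2 h2 h3 (hlev I heI).1
      exact ⟨x, Finset.mem_filter.2 ⟨hx, h5.trans_le (h.le _ h2)⟩, h4, h5⟩
    choose! x hxX hx1 hx2 using hx
    have hpair : ∀ I ∈ 𝓙, I ∈ pairs := fun I hI => by
      obtain ⟨hI, heI⟩ := Finset.mem_filter.1 hI
      obtain ⟨h1, h2, h3⟩ := h𝓘.mem I hI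
      exact Finset.mem_filter.2 ⟨Finset.mem_product.2 ⟨h1, h2⟩, h3, heI⟩
    -- Distinct blocks are disjoint and have distinct anchors, so each pair of a level and an anchor
    -- is used at most once.
    let g (I : ℕ × ℕ) : (_ : ℤ) × ℕ := ⟨lev I, x I⟩
    have hginj : Set.InjOn g (𝓙 : Set (ℕ × ℕ)) := by
      intro I hI J hJ hIJ
      have hxx : x I = x J := by
        have := congrArg Sigma.snd hIJ
        simpa [g] using this
      have hI' := hx1 I hI
      have hI2 := hx2 I hI
      have hJ' := hx1 J hJ
      have hJ2 := hx2 J hJ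
      rw [← hxx] at hJ' hJ2
      exact h𝓘.disjoint I (Finset.mem_filter.1 hI).1 J (Finset.mem_filter.1 hJ).1 (x I) hI'.le hI2
        hJ'.le hJ2
    calc ∑ I ∈ 𝓘, (2 * |intervalSum η k φ I ω| - 3.2 * e I - 280)
        ≤ ∑ I ∈ 𝓘, if 0 < e I then D (lev I) (x I) ω else 0 := by
          refine Finset.sum_le_sum fun I hI => ?_
          split_ifs with heI
          · have hIJ : I ∈ 𝓙 := Finset.mem_filter.2 ⟨hI, heI⟩
            have h1 : I ∈ R (lev I) (x I) := Finset.mem_filter.2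
              ⟨hpair I hIJ, rfl, hx1 I hIJ, hx2 I hIJ⟩
            have h2 := le_maxExcess (η := η) (φ := φ) k h1 (T (lev I)) ω
            have h3 : s (lev I) ≤ e I := (hlev I heI).1
            simp only [T] at h2
            rw [hsw] at h2
            simp only [D, T]
            rw [hsw]
            linarith
          · have h0 : e I = 0 := le_antisymm (not_lt.1 heI) (intervalEnergy_nonneg φ I.1 I.2)
            have h1 : intervalSum η k φ I ω = 0 := Finset.sum_eq_zero fun j hj => by
              have h2 := (Finset.sum_eq_zero_iff_of_nonneg fun _ _ => sq_nonneg _).1 h0 j hj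
              have h3 : φ j - intervalMean φ I.1 I.2 = 0 := by simpa using h2
              rw [h3, zero_mul]
            rw [h1, h0]
            norm_num
      _ = ∑ I ∈ 𝓙, D (lev I) (x I) ω := by rw [h𝓙, Finset.sum_filter]
      _ = ∑ p ∈ 𝓙.image g, D p.1 p.2 ω := by rw [Finset.sum_image hginj]
      _ ≤ ∑ p ∈ Q.sigma X', D p.1 p.2 ω := by
          refine Finset.sum_le_sum_of_subset_of_nonneg (fun p hp => ?_) fun p _ _ => hD0 _ _ _
          obtain ⟨I, hI, rfl⟩ := Finset.mem_image.1 hp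
          exact Finset.mem_sigma.2 ⟨Finset.mem_image_of_mem _ (hpair I hI), hxX I hI⟩
      _ = _ := Finset.sum_sigma _ _ _
  have htot : ∑ I ∈ 𝓘, (2 * |intervalSum η k φ I ω| - 3.5 * e I - 302.4) =
      ∑ I ∈ 𝓘, (2 * |intervalSum η k φ I ω| - 3.2 * e I - 280) -
        ∑ I ∈ 𝓘, (0.3 * e I + 22.4) := by
    rw [← Finset.sum_sub_distrib]
    exact Finset.sum_congr rfl fun I _ => by ring
  have hgoal : ∑ I ∈ 𝓘, (2 * |intervalSum η k φ I ω| - 3.5 * intervalEnergy φ I.1 I.2 - 302.4) =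
      ∑ I ∈ 𝓘, (2 * |intervalSum η k φ I ω| - 3.5 * e I - 302.4) := rfl
  rw [hgoal, htot]
  linarith

end Multiscale

/-! ### From partitions of `Fin n` to integer intervals. -/

section Cuts

open scoped InnerProductSpace

variable {n : ℕ}

/-- The lengths of the initial segments which do not separate the elements of any block. -/
def cutPoints (m₀ : Finpartition (Finset.univ : Finset (Fin n))) : Finset ℕ :=
  open Classical in
  (Finset.range (n + 1)).filter fun x => ∀ J ∈ m₀.parts, ∀ i ∈ J, ∀ j ∈ J, i.val < x → j.val < x

lemma mem_cutPoints {m₀ : Finpartition (Finset.univ : Finset (Fin n))} {x : ℕ} :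
    x ∈ cutPoints m₀ ↔
      x ≤ n ∧ ∀ J ∈ m₀.parts, ∀ i ∈ J, ∀ j ∈ J, i.val < x → j.val < x := by
  simp [cutPoints]

/-- The indices lying in an integer interval. -/
def finIco (n x y : ℕ) : Finset (Fin n) := Finset.univ.filter fun i => x ≤ i.val ∧ i.val < y

lemma mem_finIco {x y : ℕ} {i : Fin n} : i ∈ finIco n x y ↔ x ≤ i.val ∧ i.val < y := by
  simp [finIco]

lemma finIco_eq_Icc (i j : Fin n) : finIco n i.val (j.val + 1) = Finset.Icc i j := by
  ext k
  rw [mem_finIco, Finset.mem_Icc, Fin.le_def, Fin.le_def, Nat.lt_succ_iff]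

/-- The index of a natural number, truncated at the last index. -/
def truncIdx (hn : 0 < n) (k : ℕ) : Fin n := ⟨min k (n - 1), by omega⟩

lemma truncIdx_val (hn : 0 < n) (i : Fin n) : truncIdx hn i.val = i := by
  ext
  have := i.isLt
  simp only [truncIdx]
  omega

lemma val_truncIdx (hn : 0 < n) {k : ℕ} (hk : k < n) : (truncIdx hn k).val = k := by
  simp only [truncIdx]
  omega

lemma sum_finIco (hn : 0 < n) (F : Fin n → ℝ) {x y : ℕ} (hy : y ≤ n) :
    ∑ i ∈ finIco n x y, F i = ∑ k ∈ Finset.Ico x y, F (truncIdx hn k) := by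
  refine Finset.sum_bij (fun i _ => i.val) (fun i hi => Finset.mem_Ico.2 (mem_finIco.1 hi))
    (fun i _ j _ h => Fin.ext h) (fun k hk => ?_) (fun i _ => by rw [truncIdx_val])
  have hk' := Finset.mem_Ico.1 hk
  have e := val_truncIdx hn (hk'.2.trans_le hy)
  exact ⟨truncIdx hn k, mem_finIco.2 (by rw [e]; exact hk'), e⟩

lemma sum_Icc_fin (hn : 0 < n) (F : Fin n → ℝ) (i j : Fin n) :
    ∑ k ∈ Finset.Icc i j, F k = ∑ k ∈ Finset.Ico i.val (j.val + 1), F (truncIdx hn k) := by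
  rw [← finIco_eq_Icc, sum_finIco hn F j.isLt]

lemma card_finIco {x y : ℕ} (hy : y ≤ n) : (finIco n x y).card = y - x := by
  rw [← Nat.card_Ico]
  refine Finset.card_bij (fun i _ => i.val) (fun i hi => Finset.mem_Ico.2 (mem_finIco.1 hi))
    (fun i _ j _ h => Fin.ext h) (fun k hk => ?_)
  have hk' := Finset.mem_Ico.1 hk
  exact ⟨⟨k, hk'.2.trans_le hy⟩, mem_finIco.2 hk', rfl⟩

lemma saturated_finIco {m₀ : Finpartition (Finset.univ : Finset (Fin n))} {x y : ℕ}
    (hx : x ∈ cutPoints m₀) (hy : y ∈ cutPoints m₀) : Saturated m₀ (finIco n x y) := by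
  intro J hJ i hiJ hi j hjJ
  rw [mem_finIco] at hi ⊢
  refine ⟨?_, (mem_cutPoints.1 hy).2 J hJ i hiJ j hjJ hi.2⟩
  by_contra hlt
  exact absurd ((mem_cutPoints.1 hx).2 J hJ j hjJ i hiJ (not_le.1 hlt)) (not_lt.2 hi.1)

lemma cutSignal_of_mem_histSpace (hn : 0 < n) {m₀ : Finpartition (Finset.univ : Finset (Fin n))}
    (hm₀ : IsConsecutive m₀) {ℓ : ℝ} (hsize : ∀ I ∈ m₀.parts, ℓ ≤ (I.card : ℝ))
    {φ : EuclideanSpace ℝ (Fin n)} (hφ : φ ∈ histSpace m₀) :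
    CutSignal n ℓ (cutPoints m₀) (fun k => φ (truncIdx hn k)) := by
  refine ⟨fun x hx => (mem_cutPoints.1 hx).1, fun x hx y hy hxy => ?_,
    fun x hx y hy hxy z k hk => ?_, fun l hl p hp hlp he => ?_⟩
  · have hyn := (mem_cutPoints.1 hy).1
    have hmem : (⟨x, hxy.trans_le hyn⟩ : Fin n) ∈ finIco n x y := mem_finIco.2 ⟨le_rfl, hxy⟩
    have hJ := m₀.part_mem.2 (Finset.mem_univ (⟨x, hxy.trans_le hyn⟩ : Fin n))
    have hsub := saturated_finIco hx hy _ hJ _ (m₀.mem_part (Finset.mem_univ _)) hmem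
    have h1 := Finset.card_le_card hsub
    rw [card_finIco hyn] at h1
    exact (hsize _ hJ).trans (by exact_mod_cast h1)
  · have hyn := (mem_cutPoints.1 hy).1
    have hk' := Finset.mem_Ico.1 hk
    have e := val_truncIdx hn (hk'.2.trans_le hyn)
    rw [← sum_finIco hn (fun i => (φ i - z) ^ 2) hyn]
    exact mul_sq_le_sum_of_saturated hsize hφ (saturated_finIco hx hy)
      (mem_finIco.2 (by rw [e]; exact hk')) z
  · by_contra! hno
    have hpn := (mem_cutPoints.1 hp).1
    set i : Fin n := ⟨l, hlp.trans_le hpn⟩ with hi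
    have hiJ := m₀.mem_part (Finset.mem_univ i)
    have hJ := m₀.part_mem.2 (Finset.mem_univ i)
    set J := m₀.part i
    have hsub := saturated_finIco hl hp J hJ i hiJ (mem_finIco.2 ⟨le_rfl, hlp⟩)
    -- The right end of the block containing `l` is a cut. Were there no cut strictly between `l`
    -- and `p`, this block would cover the whole interval, and the signal would be constant there.
    set e := J.max' ⟨i, hiJ⟩ with hedef
    have heJ : e ∈ J := J.max'_mem _
    have hie : i ≤ e := J.le_max' i hiJ
    have hep := (mem_finIco.1 (hsub heJ)).2
    have hcut : e.val + 1 ∈ cutPoints m₀ := by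
      refine mem_cutPoints.2 ⟨by omega, fun J' hJ' a ha b hb hae => ?_⟩
      by_contra hbe
      have h1 : a ≤ e := Fin.le_def.2 (by omega)
      have h2 : e < b := Fin.lt_def.2 (by omega)
      have heJ' : e ∈ J' := by
        have := (hm₀ J' hJ').out ha hb (⟨h1, h2.le⟩ : e ∈ Set.Icc a b)
        exact_mod_cast this
      have : J' = J := m₀.eq_of_mem_parts hJ' hJ heJ' heJ
      rw [this] at hb
      exact absurd (J.le_max' b hb) (not_le.2 h2)
    have hle : i.val ≤ e.val := hie
    have hpe : p ≤ e.val + 1 := hno _ hcut (by simp only [hi] at hle; omega)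
    have hconst : ∀ k ∈ Finset.Ico l p, φ (truncIdx hn k) = φ i := by
      intro k hk
      have hk' := Finset.mem_Ico.1 hk
      have ek := val_truncIdx hn (hk'.2.trans_le hpn)
      refine hφ J hJ _ ?_ i hiJ
      have := (hm₀ J hJ).out hiJ heJ (⟨Fin.le_def.2 (by rw [ek]; exact hk'.1),
        Fin.le_def.2 (by rw [ek]; omega)⟩ : truncIdx hn k ∈ Set.Icc i e)
      exact_mod_cast this
    have h0 := intervalEnergy_le (fun k => φ (truncIdx hn k)) l p (φ i)
    have h1 : ∑ k ∈ Finset.Ico l p, (φ (truncIdx hn k) - φ i) ^ 2 = 0 :=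
      Finset.sum_eq_zero fun k hk => by rw [hconst k hk, sub_self]; norm_num
    linarith

lemma left_mem_cutPoints {m₀ : Finpartition (Finset.univ : Finset (Fin n))}
    (hm₀ : IsConsecutive m₀) {i j : Fin n} (hij : i ≤ j) (hI : Saturated m₀ (Finset.Icc i j)) :
    i.val ∈ cutPoints m₀ := by
  refine mem_cutPoints.2 ⟨i.isLt.le, fun J hJ a ha b hb hai => ?_⟩
  by_contra hbi
  have h1 : a < i := hai
  have h2 : i ≤ b := not_lt.1 hbi
  have hiJ : i ∈ J := by
    have := (hm₀ J hJ).out ha hb (⟨h1.le, h2⟩ : i ∈ Set.Icc a b)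
    exact_mod_cast this
  have := hI J hJ i hiJ (Finset.left_mem_Icc.2 hij) ha
  exact absurd (Finset.mem_Icc.1 this).1 (not_le.2 h1)

lemma right_succ_mem_cutPoints {m₀ : Finpartition (Finset.univ : Finset (Fin n))}
    (hm₀ : IsConsecutive m₀) {i j : Fin n} (hij : i ≤ j) (hI : Saturated m₀ (Finset.Icc i j)) :
    j.val + 1 ∈ cutPoints m₀ := by
  refine mem_cutPoints.2 ⟨j.isLt, fun J hJ a ha b hb haj => ?_⟩
  by_contra hbj
  have h1 : a ≤ j := Fin.le_def.2 (by omega)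
  have h2 : j < b := Fin.lt_def.2 (by omega)
  have hjJ : j ∈ J := by
    have := (hm₀ J hJ).out ha hb (⟨h1, h2.le⟩ : j ∈ Set.Icc a b)
    exact_mod_cast this
  have := hI J hJ j hjJ (Finset.right_mem_Icc.2 hij) hb
  exact absurd (Finset.mem_Icc.1 this).2 (not_le.2 h2)

lemma intervalMean_truncIdx (hn : 0 < n) (φ : Fin n → ℝ) (i j : Fin n) :
    intervalMean (fun k => φ (truncIdx hn k)) i.val (j.val + 1) =
      (∑ k ∈ Finset.Icc i j, φ k) / (Finset.Icc i j).card := by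
  rw [intervalMean, ← finIco_eq_Icc, card_finIco j.isLt, sum_finIco hn _ j.isLt]

lemma intervalEnergy_truncIdx (hn : 0 < n) (φ : Fin n → ℝ) (i j : Fin n) :
    intervalEnergy (fun k => φ (truncIdx hn k)) i.val (j.val + 1) =
      energy φ (Finset.Icc i j) := by
  rw [intervalEnergy, intervalMean_truncIdx, energy]
  simp only [dev]
  exact (sum_Icc_fin hn (fun k => (φ k - (∑ k ∈ Finset.Icc i j, φ k) / (Finset.Icc i j).card) ^ 2) i j).symm

lemma intervalSum_truncIdx {Ω : Type*} (hn : 0 < n) (φ : Fin n → ℝ) (η : Fin n → Ω → ℝ)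
    (i j : Fin n) (ω : Ω) :
    intervalSum η (truncIdx hn) (fun k => φ (truncIdx hn k)) (i.val, j.val + 1) ω =
      ∑ k ∈ Finset.Icc i j, dev φ (Finset.Icc i j) k * η k ω := by
  rw [intervalSum, intervalMean_truncIdx]
  simp only [dev]
  exact (sum_Icc_fin hn (fun k => (φ k - (∑ k ∈ Finset.Icc i j, φ k) / (Finset.Icc i j).card) * η k ω) i j).symm

lemma dev_smul (r : ℝ) (φ : EuclideanSpace ℝ (Fin n)) (I : Finset (Fin n)) (i : Fin n) :
    dev (r • φ : EuclideanSpace ℝ (Fin n)) I i = r * dev φ I i := by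
  simp only [dev, PiLp.smul_apply, smul_eq_mul]
  rw [← Finset.mul_sum]
  ring

lemma energy_smul (r : ℝ) (φ : EuclideanSpace ℝ (Fin n)) (I : Finset (Fin n)) :
    energy (r • φ : EuclideanSpace ℝ (Fin n)) I = r ^ 2 * energy φ I := by
  simp only [energy, dev_smul, mul_pow, Finset.mul_sum]

/-- The blocks of a partition as a family of integer intervals. -/
lemma exists_isIntervalPartition (hn : 0 < n)
    {m m₀ : Finpartition (Finset.univ : Finset (Fin n))}
    (hm : IsConsecutive m) (hm₀ : IsConsecutive m₀) (h : histSpace m ≤ histSpace m₀) :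
    ∃ u v : Finset (Fin n) → Fin n, (∀ I ∈ m.parts, I = Finset.Icc (u I) (v I)) ∧
      Set.InjOn (fun I => ((u I).val, (v I).val + 1)) (m.parts : Set (Finset (Fin n))) ∧
      IsIntervalPartition n (cutPoints m₀)
        (m.parts.image fun I => ((u I).val, (v I).val + 1)) := by
  have hex : ∀ I ∈ m.parts, ∃ i j : Fin n, i ≤ j ∧ I = Finset.Icc i j :=
    fun I hI => exists_eq_Icc hm hI
  have : Nonempty (Fin n) := ⟨⟨0, hn⟩⟩
  choose! u v huv hI using hex
  have hinj : Set.InjOn (fun I => ((u I).val, (v I).val + 1))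
      (m.parts : Set (Finset (Fin n))) := by
    intro I hIm J hJm hIJ
    simp only [Prod.mk.injEq, Nat.add_right_cancel_iff] at hIJ
    rw [hI I hIm, hI J hJm, Fin.ext hIJ.1, Fin.ext hIJ.2]
  refine ⟨u, v, hI, hinj, ?_, fun x hx => ?_, ?_⟩
  · intro r hr
    obtain ⟨I, hIm, rfl⟩ := Finset.mem_image.1 hr
    have hsat := saturated_of_mem h hIm
    rw [hI I hIm] at hsat
    exact ⟨left_mem_cutPoints hm₀ (huv I hIm) hsat,
      right_succ_mem_cutPoints hm₀ (huv I hIm) hsat, Nat.lt_succ_of_le (huv I hIm)⟩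
  · have hIm := m.part_mem.2 (Finset.mem_univ (⟨x, hx⟩ : Fin n))
    have hxI := m.mem_part (Finset.mem_univ (⟨x, hx⟩ : Fin n))
    refine ⟨_, Finset.mem_image_of_mem _ hIm, ?_⟩
    rw [hI _ hIm] at hxI
    have h1 := Finset.mem_Icc.1 hxI
    exact ⟨h1.1, Nat.lt_succ_of_le h1.2⟩
  · intro r hr s hs x h1 h2 h3 h4
    obtain ⟨I, hIm, rfl⟩ := Finset.mem_image.1 hr
    obtain ⟨J, hJm, rfl⟩ := Finset.mem_image.1 hs
    have hxn : x < n := by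
      have := (v I).isLt
      simp only at h2
      omega
    have e1 : (⟨x, hxn⟩ : Fin n) ∈ I := by
      rw [hI I hIm]
      exact Finset.mem_Icc.2 ⟨h1, Nat.lt_succ_iff.1 h2⟩
    have e2 : (⟨x, hxn⟩ : Fin n) ∈ J := by
      rw [hI J hJm]
      exact Finset.mem_Icc.2 ⟨h3, Nat.lt_succ_iff.1 h4⟩
    rw [m.eq_of_mem_parts hIm hJm e1 e2]

variable {Ω : Type*} [MeasurableSpace Ω] {μ : Measure Ω} [IsProbabilityMeasure μ]

/-- In the range `ℓ t² ≤ Λ²` one has `|t| c ≤ Λ c / √ℓ = β - σ`, hence `β (β - |t| c) ≥ σ²`, and the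
Bernstein exponent is at most `t² / 2`. -/
lemma BernsteinBound.locallySubgaussian {ξ : Fin n → Ω → ℝ} (hm : ∀ i, Measurable (ξ i))
    (hi : iIndepFun ξ μ) (h0 : ∀ i, ∫ ω, ξ i ω ∂μ = 0) {σ c ℓ : ℝ} (hσ : 0 < σ) (hc : 0 ≤ c)
    (hℓ : 0 < ℓ) (hb : ∀ i, BernsteinBound μ (ξ i) σ c) {Λ β : ℝ} (hΛ : 0 ≤ Λ)
    (hβ : β = σ + Λ * (c / √ℓ)) :
    LocallySubgaussian μ (fun i ω => β⁻¹ * ξ i ω) Λ ℓ := by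
  have hd : 0 ≤ Λ * (c / √ℓ) := by positivity
  have hβ0 : 0 < β := by rw [hβ]; positivity
  refine ⟨fun i => (hm i).const_mul _, hi.comp (fun _ x => β⁻¹ * x) fun _ => by fun_prop,
    fun i => ((hb i).integrable (hm i) hc).const_mul _, fun i => by
      rw [integral_const_mul, h0 i, mul_zero], fun i t ht => ?_⟩
  have hsq : 0 < √ℓ := Real.sqrt_pos.2 hℓ
  have ht1 : |t| * c ≤ Λ * (c / √ℓ) := by
    have h1 : |√ℓ * t| ≤ Λ := by
      refine abs_le_of_sq_le_sq ?_ hΛ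
      rw [mul_pow, Real.sq_sqrt hℓ.le]; exact ht
    rw [abs_mul, abs_of_pos hsq] at h1
    have h2 : |t| ≤ Λ / √ℓ := by rw [le_div_iff₀ hsq]; linarith
    calc |t| * c ≤ Λ / √ℓ * c := by gcongr
      _ = _ := by ring
  have hgap : σ ≤ β - |t| * c := by linarith
  have hlt : |t * β⁻¹| * c < 1 := by
    rw [abs_mul, abs_of_pos (inv_pos.2 hβ0), mul_right_comm, ← div_eq_mul_inv, div_lt_one hβ0]
    linarith
  have h := (hb i).lintegral_le hlt
  have e : ∀ ω, t * (β⁻¹ * ξ i ω) = t * β⁻¹ * ξ i ω := fun ω => by ring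
  simp_rw [e]
  refine h.trans (ENNReal.ofReal_le_ofReal (Real.exp_le_exp.2 ?_))
  have e1 : |t * β⁻¹| * c = |t| * c / β := by
    rw [abs_mul, abs_of_pos (inv_pos.2 hβ0)]; ring
  have e2 : (t * β⁻¹) ^ 2 * σ ^ 2 / (2 * (1 - |t * β⁻¹| * c)) =
      t ^ 2 / 2 * (σ ^ 2 / (β * (β - |t| * c))) := by
    rw [e1]
    have : β - |t| * c ≠ 0 := by linarith
    have : 1 - |t| * c / β ≠ 0 := by
      rw [one_sub_div hβ0.ne']; exact div_ne_zero this hβ0.ne'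
    field_simp
  rw [e2]
  have h3 : σ ^ 2 / (β * (β - |t| * c)) ≤ 1 := by
    rw [div_le_one (mul_pos hβ0 (hσ.trans_le hgap))]
    nlinarith
  nlinarith [sq_nonneg t]

/-- Linear terms are controlled by chaining over the scales of the signal. -/
theorem exists_bound_linear_of_multiscale {ξ : Fin n → Ω → ℝ} (hm : ∀ i, Measurable (ξ i))
    (hi : iIndepFun ξ μ) (h0 : ∀ i, ∫ ω, ξ i ω ∂μ = 0) {σ c ℓ : ℝ} (hσ : 0 < σ) (hc : 0 ≤ c)
    (hℓ : 0 < ℓ) (hb : ∀ i, BernsteinBound μ (ξ i) σ c) (hn : 0 < n)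
    (m₀ : Finpartition (Finset.univ : Finset (Fin n))) (hm₀ : IsConsecutive m₀)
    (hsize : ∀ I ∈ m₀.parts, ℓ ≤ (I.card : ℝ))
    (M : Finset (Finpartition (Finset.univ : Finset (Fin n))))
    (hM_cons : ∀ m ∈ M, IsConsecutive m)
    (hM_sub : ∀ m ∈ M, histSpace m ≤ histSpace m₀)
    (f : EuclideanSpace ℝ (Fin n)) {K F : ℝ} (hK : 0 < K)
    (hF : 302.4 * (σ + 8 / 3 * (c / √ℓ)) ^ 2 ≤ F) :
    ∃ Z : Ω → ℝ, Integrable Z μ ∧ ∫ ω, Z ω ∂μ ≤ 0 ∧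
      ∀ m ∈ M, ∀ ω, -(2 * ⟪resid m₀ m f, noise ξ ω⟫_ℝ) - 3.5 / K * ‖resid m₀ m f‖ ^ 2 -
        K * F * m.parts.card ≤ Z ω := by
  set β := σ + 8 / 3 * (c / √ℓ) with hβ
  have hβ0 : 0 < β := by positivity
  have hη := BernsteinBound.locallySubgaussian hm hi h0 hσ hc hℓ hb (by norm_num) hβ
  -- The signal is scaled by `(K β)⁻¹` and the noise by `β⁻¹`. Multiplying back by `K β²` turns the
  -- coefficients `3.5` and `302.4` into `3.5 / K` and `302.4 K β²`.
  set ψ := (K * β)⁻¹ • lsEst m₀ f with hψ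
  have hφ : ψ ∈ histSpace m₀ := Submodule.smul_mem _ _ (lsEst_mem m₀ f)
  have hk : Set.InjOn (truncIdx hn) (Set.Iio n) := by
    intro s hs t ht hst
    rw [← val_truncIdx hn (Set.mem_Iio.1 hs), ← val_truncIdx hn (Set.mem_Iio.1 ht), hst]
  obtain ⟨Z, hZ, hZ0, hZle⟩ :=
    (cutSignal_of_mem_histSpace hn hm₀ hsize hφ).exists_multiscale_bound hη hℓ hk
  refine ⟨fun ω => K * β ^ 2 * Z ω, hZ.const_mul _, ?_, fun m hmM ω => ?_⟩
  · rw [integral_const_mul]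
    exact mul_nonpos_of_nonneg_of_nonpos (by positivity) hZ0
  · obtain ⟨u, v, hI, hinj, hpart⟩ :=
      exists_isIntervalPartition hn (hM_cons m hmM) hm₀ (hM_sub m hmM)
    have h1 := hZle _ hpart ω
    rw [Finset.sum_image hinj] at h1
    refine le_trans ?_ (mul_le_mul_of_nonneg_left h1 (by positivity : 0 ≤ K * β ^ 2))
    rw [inner_resid_noise (hM_sub m hmM), norm_sq_resid (hM_sub m hmM), Finset.mul_sum,
      Finset.mul_sum, Finset.mul_sum]
    have h2 : ∀ I ∈ m.parts, -(2 * ∑ i ∈ I, dev (lsEst m₀ f) I i * ξ i ω) -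
        3.5 / K * energy (lsEst m₀ f) I - K * F ≤ K * β ^ 2 *
          (2 * |intervalSum (fun i ω => β⁻¹ * ξ i ω) (truncIdx hn)
            (fun k => ψ (truncIdx hn k)) ((u I).val, (v I).val + 1) ω| -
            3.5 * intervalEnergy (fun k => ψ (truncIdx hn k))
              (u I).val ((v I).val + 1) - 302.4) := by
      intro I hIm
      rw [intervalSum_truncIdx hn ψ,
        intervalEnergy_truncIdx hn ψ, ← hI I hIm, hψ, energy_smul]
      simp_rw [dev_smul]
      have e1 : ∑ k ∈ I, (K * β)⁻¹ * dev (lsEst m₀ f) I k * (β⁻¹ * ξ k ω) =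
          (K * β ^ 2)⁻¹ * ∑ k ∈ I, dev (lsEst m₀ f) I k * ξ k ω := by
        rw [Finset.mul_sum]
        refine Finset.sum_congr rfl fun k _ => ?_
        field_simp
      rw [e1, abs_mul, abs_of_pos (by positivity : 0 < (K * β ^ 2)⁻¹)]
      have e2 : K * β ^ 2 * (2 * ((K * β ^ 2)⁻¹ * |∑ k ∈ I, dev (lsEst m₀ f) I k * ξ k ω|) -
          3.5 * ((K * β)⁻¹ ^ 2 * energy (lsEst m₀ f) I) - 302.4) =
          2 * |∑ k ∈ I, dev (lsEst m₀ f) I k * ξ k ω| - 3.5 / K * energy (lsEst m₀ f) I -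
            K * (302.4 * β ^ 2) := by
        field_simp
      rw [e2]
      have h3 := neg_abs_le (∑ k ∈ I, dev (lsEst m₀ f) I k * ξ k ω)
      have h4 := mul_le_mul_of_nonneg_left hF hK.le
      linarith
    have h5 := Finset.sum_le_sum h2
    rw [Finset.sum_sub_distrib, Finset.sum_sub_distrib, Finset.sum_neg_distrib, Finset.sum_const,
      nsmul_eq_mul, ← Finset.mul_sum, ← Finset.mul_sum, ← Finset.mul_sum] at h5
    rw [← Finset.mul_sum, ← Finset.mul_sum, ← Finset.mul_sum]
    linarith

end Cuts

/-! ### Arithmetic of the constants and of the remainders. -/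

section Constants

lemma penFactor_eq (σ c a b : ℝ) :
    penFactor σ c a b = 36 * (9 * σ ^ 2 + c * ((σ + c) * (b + 2) / a)) := by
  rw [penFactor, kappa]
  rcases eq_or_ne a 0 with rfl | ha
  · simp; ring
  · field_simp; ring

lemma one_le_CK_mul {K : ℝ} (hK : 1 < K) : 1 ≤ CK K * (1 - 1 / K) := by
  have h : 0 < K - 1 := by linarith
  have e : CK K * (1 - 1 / K) = (K ^ 2 + K - 1) / (K - 1) ^ 2 := by
    rw [CK]; field_simp
  rw [e, one_le_div (by positivity)]
  nlinarith

lemma one_le_CK {K : ℝ} (hK : 1 < K) : 1 ≤ CK K := by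
  have h : 0 < K - 1 := by linarith
  rw [CK, one_le_div (by positivity)]
  nlinarith

/-- The claim amounts to `0.5 K² - 7.5 K + 4.5 ≥ 0`, which holds from `K = 15` on; this is the
threshold between the two treatments of the linear term. -/
lemma one_le_CK_mul_of_le {K : ℝ} (hK : 15 ≤ K) : 1 ≤ CK K * (1 - 3.5 / K) := by
  have h : 0 < K - 1 := by linarith
  have hK0 : K ≠ 0 := by linarith
  have e : CK K * (1 - 3.5 / K) = (K ^ 2 + K - 1) * (K - 3.5) / (K - 1) ^ 3 := by
    rw [CK]; field_simp
  rw [e, one_le_div (by positivity)]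
  nlinarith

lemma le_log_of_two_le {n : ℕ} (hn : 2 ≤ n) : 0.6931 ≤ Real.log n := by
  have h1 : Real.log 2 ≤ Real.log n := Real.log_le_log (by norm_num) (by exact_mod_cast hn)
  have := Real.log_two_gt_d9
  linarith

lemma exp_neg_mul_log {n : ℕ} (hn : 2 ≤ n) (b s : ℝ) :
    Real.exp (-((b + s) * Real.log n)) = Real.exp (-(s * Real.log n)) / (n : ℝ) ^ b := by
  have hn0 : (0 : ℝ) < n := by exact_mod_cast (by omega : 0 < n)
  rw [Real.rpow_def_of_pos hn0, ← Real.exp_sub]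
  congr 1; ring

lemma sq_mul_exp_neg_log {n : ℕ} (hn : 2 ≤ n) (s : ℝ) :
    (n : ℝ) ^ 2 * Real.exp (-((s + 2) * Real.log n)) = Real.exp (-(s * Real.log n)) := by
  have hn0 : (0 : ℝ) < n := by exact_mod_cast (by omega : 0 < n)
  have e : (n : ℝ) ^ 2 = Real.exp (2 * Real.log n) := by
    rw [two_mul, Real.exp_add, Real.exp_log hn0, sq]
  rw [e, ← Real.exp_add]
  congr 1; ring

lemma two_rpow_neg (k : ℕ) : Real.exp (-(k * Real.log 2)) = ((2 : ℝ) ^ k)⁻¹ := by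
  rw [Real.exp_neg, Real.exp_nat_mul, Real.exp_log (by norm_num)]

/-- The exceptional term of the quadratic part is negligible. -/
lemma remainder_quadratic_le {n : ℕ} (hn : 2 ≤ n) {b : ℝ} (hb : 0 < b) :
    160 * (n : ℝ) ^ 2 * Real.exp (-(4.5 * (b + 2) * Real.log n)) ≤
      160 * Real.exp (-(7 * Real.log n)) / (n : ℝ) ^ b := by
  have hL : 0 ≤ Real.log n := by linarith [le_log_of_two_le hn]
  have h1 : Real.exp (-(4.5 * (b + 2) * Real.log n)) ≤
      Real.exp (-((b + (7 + 2)) * Real.log n)) := by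
    refine Real.exp_le_exp.2 (neg_le_neg ?_)
    refine mul_le_mul_of_nonneg_right ?_ hL
    linarith
  calc 160 * (n : ℝ) ^ 2 * Real.exp (-(4.5 * (b + 2) * Real.log n))
      ≤ 160 * (n : ℝ) ^ 2 * Real.exp (-((b + (7 + 2)) * Real.log n)) := by gcongr
    _ = 160 * ((n : ℝ) ^ 2 * Real.exp (-((7 + 2) * Real.log n))) / (n : ℝ) ^ b := by
        rw [exp_neg_mul_log hn]; ring
    _ = _ := by rw [sq_mul_exp_neg_log hn]

lemma remainder_linear_le {n : ℕ} (hn : 2 ≤ n) {b : ℝ} (hb : 0 < b) :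
    588 * (n : ℝ) ^ 2 * Real.exp (-(3.15 * (b + 2) * Real.log n)) ≤
      588 * Real.exp (-(4.25 * Real.log n)) / (n : ℝ) ^ b := by
  have hL : 0 ≤ Real.log n := by linarith [le_log_of_two_le hn]
  have h1 : Real.exp (-(3.15 * (b + 2) * Real.log n)) ≤
      Real.exp (-((b + (4.25 + 2)) * Real.log n)) := by
    refine Real.exp_le_exp.2 (neg_le_neg ?_)
    refine mul_le_mul_of_nonneg_right ?_ hL
    linarith
  calc 588 * (n : ℝ) ^ 2 * Real.exp (-(3.15 * (b + 2) * Real.log n))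
      ≤ 588 * (n : ℝ) ^ 2 * Real.exp (-((b + (4.25 + 2)) * Real.log n)) := by gcongr
    _ = 588 * ((n : ℝ) ^ 2 * Real.exp (-((4.25 + 2) * Real.log n))) / (n : ℝ) ^ b := by
        rw [exp_neg_mul_log hn]; ring
    _ = _ := by rw [sq_mul_exp_neg_log hn]

lemma exp_neg_seven_log_le {n : ℕ} (hn : 2 ≤ n) : 160 * Real.exp (-(7 * Real.log n)) ≤ 2 := by
  have h1 : Real.log 2 ≤ Real.log n := Real.log_le_log (by norm_num) (by exact_mod_cast hn)
  have h2 : Real.exp (-(7 * Real.log n)) ≤ Real.exp (-((7 : ℕ) * Real.log 2)) :=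
    Real.exp_le_exp.2 (by push_cast; linarith)
  rw [two_rpow_neg] at h2
  norm_num at h2
  linarith

/-- The sum exceeds `2` when `n` is `2` or `3`, so those two values are treated separately. -/
lemma exp_neg_log_le_of_four_le {n : ℕ} (hn : 4 ≤ n) :
    160 * Real.exp (-(7 * Real.log n)) + 588 * Real.exp (-(4.25 * Real.log n)) ≤ 2 := by
  have h1 : Real.log 4 ≤ Real.log n := Real.log_le_log (by norm_num) (by exact_mod_cast hn)
  have h4 : Real.log 4 = 2 * Real.log 2 := by
    rw [show (4 : ℝ) = 2 ^ 2 by norm_num, Real.log_pow]; norm_num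
  have h2 : Real.exp (-(7 * Real.log n)) ≤ Real.exp (-((14 : ℕ) * Real.log 2)) :=
    Real.exp_le_exp.2 (by push_cast; linarith)
  have h3 : Real.exp (-(4.25 * Real.log n)) ^ 2 ≤ Real.exp (-((17 : ℕ) * Real.log 2)) := by
    rw [← Real.exp_nat_mul]
    exact Real.exp_le_exp.2 (by push_cast; linarith)
  rw [two_rpow_neg] at h2 h3
  have h5 : Real.exp (-(4.25 * Real.log n)) ≤ 1 / 360 := by
    refine le_of_sq_le_sq (h3.trans (by norm_num)) (by norm_num)
  norm_num at h2 h5 ⊢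
  linarith

/-- With `L = log n` this is how long blocks pay for a logarithm: `a L ≤ √ℓ` gives `L c / √ℓ ≤ c /
a`, and `b + 2 ≥ 2`. -/
lemma penalty_scale_le {σ c a b ℓ L : ℝ} (hσ : 0 < σ) (hc : 0 ≤ c) (ha : 0 < a) (hb : 0 < b)
    (hℓ : 1 ≤ √ℓ) (haL : a * L ≤ √ℓ) :
    324 * σ ^ 2 + 72 * L * ((c / √ℓ) * (σ + c / √ℓ)) ≤
      36 * (9 * σ ^ 2 + c * ((σ + c) * (b + 2) / a)) := by
  have h1 : c / √ℓ ≤ c := div_le_self hc hℓ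
  have h0 : 0 ≤ c / √ℓ := by positivity
  have h2 : L * (c / √ℓ) ≤ c / a := by
    rw [mul_div_assoc', div_le_div_iff₀ (by positivity) ha]
    nlinarith
  have h3 : L * (c / √ℓ) * (2 * (σ + c / √ℓ)) ≤ c / a * ((b + 2) * (σ + c)) := by
    refine mul_le_mul h2 ?_ (by positivity) (by positivity)
    refine mul_le_mul (by linarith) (by linarith) (by positivity) (by positivity)
  have e : c * ((σ + c) * (b + 2) / a) = c / a * ((b + 2) * (σ + c)) := by ring
  rw [e]
  linarith

end Constants

/-! ### The union bound with explicit constants. -/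

section Linear

open scoped InnerProductSpace

variable {Ω : Type*} [MeasurableSpace Ω] {μ : Measure Ω} [IsProbabilityMeasure μ] {n : ℕ}

/-- At most one or three intervals are involved, so the union bound fits in half of the penalty:
`0.35 + 0.15 = 1 / 2`. -/
lemma exists_bound_linear_of_lt_four {ξ : Fin n → Ω → ℝ} (hm : ∀ i, Measurable (ξ i))
    (hi : iIndepFun ξ μ) {σ c ℓ : ℝ} (hσ : 0 < σ) (hc : 0 ≤ c) (hℓ : 0 < ℓ)
    (hb : ∀ i, BernsteinBound μ (ξ i) σ c) (hn : 2 ≤ n) (hn4 : n < 4)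
    (m₀ : Finpartition (Finset.univ : Finset (Fin n)))
    (hsize : ∀ I ∈ m₀.parts, ℓ ≤ (I.card : ℝ))
    (M : Finset (Finpartition (Finset.univ : Finset (Fin n))))
    (hM_cons : ∀ m ∈ M, IsConsecutive m)
    (hM_sub : ∀ m ∈ M, histSpace m ≤ histSpace m₀)
    (f : EuclideanSpace ℝ (Fin n)) {K F : ℝ} (hK : 0 < K)
    (hF : 324 * σ ^ 2 + 72 * Real.log n * ((c / √ℓ) * (σ + c / √ℓ)) ≤ F) :
    ∃ Z : Ω → ℝ, Integrable Z μ ∧ ∫ ω, Z ω ∂μ ≤ 0 ∧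
      ∀ m ∈ M, ∀ ω, -(2 * ⟪resid m₀ m f, noise ξ ω⟫_ℝ) - 1 / K * ‖resid m₀ m f‖ ^ 2 -
        K * (1 / 2 * F) * m.parts.card ≤ Z ω := by
  set d := c / √ℓ with hd
  have hd0 : 0 ≤ d := by positivity
  have hL0 : 0 ≤ Real.log n := by linarith [le_log_of_two_le hn]
  have hF0 : 0 ≤ F := le_trans (by positivity) hF
  have hσd : 0 ≤ σ * d := by positivity
  have he := Real.exp_one_gt_d9
  have he2 : Real.exp 2 = Real.exp 1 * Real.exp 1 := by rw [← Real.exp_add]; norm_num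
  have hE2 : 7.38 ≤ Real.exp 2 := by rw [he2]; nlinarith
  obtain rfl | rfl : n = 2 ∨ n = 3 := by omega
  · have hL := le_log_of_two_le hn
    have h1 : Real.exp (1 / (2 * 0.8 ^ 2) - 3) ≤ 0.2 := by
      have h2 : Real.exp (1 / (2 * 0.8 ^ 2) - 3) ≤ Real.exp (-2) :=
        Real.exp_le_exp.2 (by norm_num)
      refine h2.trans ?_
      rw [Real.exp_neg, inv_le_comm₀ (Real.exp_pos _) (by norm_num)]
      refine le_trans (by norm_num) hE2
    refine exists_bound_linear_of_union (F' := 0.35 * F) (G := 0.15 * F) (p := 0.8) (q := 1.2)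
      (x := 3) hm hi hσ hc hℓ hb hn m₀ hsize M hM_cons hM_sub f hK one_pos (by norm_num)
      (by norm_num) (by norm_num) (by positivity) ?_ ?_ (by linarith)
    · have h2 : 72 * 0.6931 * (d * (σ + d)) ≤ 72 * Real.log (2 : ℕ) * (d * (σ + d)) := by gcongr
      have h3 : 324 * σ ^ 2 + 49.9 * (σ * d + d ^ 2) ≤ F := by
        refine le_trans ?_ ((add_le_add_right h2 _).trans hF)
        nlinarith
      rw [← hd]
      nlinarith
    · have h2 := mul_le_mul_of_nonneg_left h1 hF0
      push_cast
      nlinarith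
  · have hL : 1 ≤ Real.log (3 : ℕ) := by
      rw [Real.le_log_iff_exp_le (by norm_num)]
      have := Real.exp_one_lt_d9
      push_cast; linarith
    have h1 : Real.exp (1 / (2 * 0.8 ^ 2) - 3.5) ≤ 1 / 14 := by
      have h2 : Real.exp (1 / (2 * 0.8 ^ 2) - 3.5) ≤ Real.exp (-(2 + 0.7)) :=
        Real.exp_le_exp.2 (by norm_num)
      refine h2.trans ?_
      rw [Real.exp_neg, inv_le_comm₀ (Real.exp_pos _) (by norm_num), Real.exp_add]
      have h3 := Real.quadratic_le_exp_of_nonneg (x := 0.7) (by norm_num)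
      calc (1 / 14 : ℝ)⁻¹ ≤ 7.38 * (1 + 0.7 + 0.7 ^ 2 / 2) := by norm_num
        _ ≤ Real.exp 2 * Real.exp 0.7 := by gcongr
    refine exists_bound_linear_of_union (F' := 0.35 * F) (G := 0.15 * F) (p := 0.8) (q := 1.2)
      (x := 3.5) hm hi hσ hc hℓ hb hn m₀ hsize M hM_cons hM_sub f hK one_pos (by norm_num)
      (by norm_num) (by norm_num) (by positivity) ?_ ?_ (by linarith)
    · have h2 : 72 * 1 * (d * (σ + d)) ≤ 72 * Real.log (3 : ℕ) * (d * (σ + d)) := by gcongr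
      nlinarith [sq_nonneg d, sq_nonneg σ]
    · have h2 := mul_le_mul_of_nonneg_left h1 hF0
      push_cast
      nlinarith

/-- With `x = 2 log n + 5` the factor `exp (-2 log n)` cancels the number of intervals. The
threshold then grows like `(log n)²`, and the penalty can afford it only for bounded `log n`. -/
lemma exists_bound_linear_of_log_le {ξ : Fin n → Ω → ℝ} (hm : ∀ i, Measurable (ξ i))
    (hi : iIndepFun ξ μ) {σ c ℓ : ℝ} (hσ : 0 < σ) (hc : 0 ≤ c) (hℓ : 0 < ℓ)
    (hb : ∀ i, BernsteinBound μ (ξ i) σ c) (hn : 2 ≤ n) (hL32 : Real.log n ≤ 32)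
    (m₀ : Finpartition (Finset.univ : Finset (Fin n)))
    (hsize : ∀ I ∈ m₀.parts, ℓ ≤ (I.card : ℝ))
    (M : Finset (Finpartition (Finset.univ : Finset (Fin n))))
    (hM_cons : ∀ m ∈ M, IsConsecutive m)
    (hM_sub : ∀ m ∈ M, histSpace m ≤ histSpace m₀)
    (f : EuclideanSpace ℝ (Fin n)) {K F : ℝ} (hK : 0 < K)
    (hF : 324 * σ ^ 2 + 72 * Real.log n * ((c / √ℓ) * (σ + c / √ℓ)) ≤ F) :
    ∃ Z : Ω → ℝ, Integrable Z μ ∧ ∫ ω, Z ω ∂μ ≤ 0 ∧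
      ∀ m ∈ M, ∀ ω, -(2 * ⟪resid m₀ m f, noise ξ ω⟫_ℝ) - 3.5 / K * ‖resid m₀ m f‖ ^ 2 -
        K * (14 / 15 * F) * m.parts.card ≤ Z ω := by
  set d := c / √ℓ with hd
  have hd0 : 0 ≤ d := by positivity
  have hL := le_log_of_two_le hn
  set L := Real.log n with hLdef
  have hF0 : 0 ≤ F := le_trans (by positivity) hF
  have hn0 : (0 : ℝ) < n := by exact_mod_cast (by omega : 0 < n)
  refine exists_bound_linear_of_union (F' := 0.84 * F) (G := 0.09 * F) (p := 0.44) (q := 1.15)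
    (x := 2 * L + 5) hm hi hσ hc hℓ hb hn m₀ hsize M hM_cons hM_sub f hK (by norm_num)
    (by norm_num) (by norm_num) (by linarith) (by positivity) ?_ ?_ (by linarith)
  · have h1 : (2 * L + 5) ^ 2 * 0.1936 ≤ 3.5 * 0.84 * 324 := by nlinarith
    have h2 : (2 * L + 5) ^ 2 * 1.3225 ≤ 3.5 * 0.84 * (72 * L) := by nlinarith
    have h3 := mul_le_mul_of_nonneg_right h1 (sq_nonneg σ)
    have h4 := mul_le_mul_of_nonneg_right h2 (by positivity : 0 ≤ d * (σ + d))
    have h5 : 0 ≤ (2 * L + 5) ^ 2 * (σ * d) := by positivity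
    have e : ((2 * L + 5) * (0.44 * σ + 1.15 * d)) ^ 2 = (2 * L + 5) ^ 2 * 0.1936 * σ ^ 2 +
        (2 * L + 5) ^ 2 * 1.3225 * (d * (σ + d)) - 0.3105 * ((2 * L + 5) ^ 2 * (σ * d)) := by
      ring
    rw [e]
    linarith
  · have e2 : Real.exp (1 / (2 * 0.44 ^ 2) - (2 * L + 5)) ≤ ((n : ℝ) ^ 2)⁻¹ * (1 / 9.5) := by
      have h1 : Real.exp (1 / (2 * 0.44 ^ 2) - (2 * L + 5)) ≤
          Real.exp (-(2 * L)) * Real.exp (-(2 + 0.4)) := by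
        rw [← Real.exp_add]
        exact Real.exp_le_exp.2 (by norm_num; linarith)
      have h2 : Real.exp (-(2 * L)) = ((n : ℝ) ^ 2)⁻¹ := by
        rw [Real.exp_neg, two_mul, Real.exp_add, hLdef, Real.exp_log hn0, sq]
      have h3 : Real.exp (-(2 + 0.4)) ≤ 1 / 9.5 := by
        rw [Real.exp_neg, inv_le_comm₀ (Real.exp_pos _) (by norm_num), Real.exp_add]
        have he := Real.exp_one_gt_d9
        have he2 : Real.exp 2 = Real.exp 1 * Real.exp 1 := by rw [← Real.exp_add]; norm_num
        have hE2 : 7.38 ≤ Real.exp 2 := by rw [he2]; nlinarith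
        have h3 := Real.quadratic_le_exp_of_nonneg (x := 0.4) (by norm_num)
        calc (1 / 9.5 : ℝ)⁻¹ ≤ 7.38 * (1 + 0.4 + 0.4 ^ 2 / 2) := by norm_num
          _ ≤ Real.exp 2 * Real.exp 0.4 := by gcongr
      rw [h2] at h1
      refine h1.trans ?_
      gcongr
    have hn1 : (1 : ℝ) ≤ n := by exact_mod_cast (by omega : 1 ≤ n)
    calc (n * (n - 1) / 2 : ℝ) *
          (0.84 * F * (2 * Real.exp (1 / (2 * 0.44 ^ 2) - (2 * L + 5))))
        ≤ (n * n / 2 : ℝ) * (0.84 * F * (2 * (((n : ℝ) ^ 2)⁻¹ * (1 / 9.5)))) := by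
          gcongr
          linarith
      _ = 0.84 / 9.5 * F := by field_simp
      _ ≤ 0.09 * F := by
          refine mul_le_mul_of_nonneg_right ?_ hF0
          norm_num

end Linear

/-! ### Choice of the method for the linear term. -/

section Oracle

open scoped InnerProductSpace

variable {Ω : Type*} [MeasurableSpace Ω] {μ : Measure Ω} [IsProbabilityMeasure μ] {n : ℕ}

/-- Linear terms are absorbed by a fraction of the penalty and of the bias, in every range of the
parameters. -/
theorem exists_bound_linear {ξ : Fin n → Ω → ℝ} (hm : ∀ i, Measurable (ξ i))
    (hi : iIndepFun ξ μ) (h0 : ∀ i, ∫ ω, ξ i ω ∂μ = 0) {σ c : ℝ} (hσ : 0 < σ) (hc : 0 ≤ c)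
    (hb : ∀ i, BernsteinBound μ (ξ i) σ c) (hn : 2 ≤ n)
    (m₀ : Finpartition (Finset.univ : Finset (Fin n))) (hm₀ : IsConsecutive m₀) {a b : ℝ}
    (ha : 0 < a) (hb0 : 0 < b)
    (hsize : ∀ I ∈ m₀.parts, a ^ 2 * Real.log n ^ 2 ≤ (I.card : ℝ))
    (M : Finset (Finpartition (Finset.univ : Finset (Fin n))))
    (hM_cons : ∀ m ∈ M, IsConsecutive m) (hM_sub : ∀ m ∈ M, histSpace m ≤ histSpace m₀)
    (Δ : Finpartition (Finset.univ : Finset (Fin n)) → ℝ) (hΔ : ∀ m ∈ M, 0 ≤ Δ m)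
    (f : EuclideanSpace ℝ (Fin n)) {K u Q : ℝ} (hK : 1 < K) (hu : u = (σ + c) * (b + 2) / a)
    (hQ : Q = 9 * σ ^ 2 + c * u) :
    ∃ (θ A R : ℝ) (Z : Ω → ℝ), 0 ≤ θ ∧ θ < 1 ∧ 1 ≤ CK K * (1 - θ) ∧
      (2 - θ) * (18 * Q) + A ≤ 36 * K * Q ∧ Integrable Z μ ∧ ∫ ω, Z ω ∂μ ≤ R ∧
      R + 2 * (5.625 * Q * ∑ m ∈ M, Real.exp (-Δ m) +
        80 * n ^ 2 * Real.exp (-(4.5 * (b + 2) * Real.log n)) * u ^ 2) ≤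
        36 * Q * ∑ m ∈ M, Real.exp (-Δ m) + 2 * (u ^ 2 / (n : ℝ) ^ b) ∧
      ∀ m ∈ M, ∀ ω, -(2 * ⟪resid m₀ m f, noise ξ ω⟫_ℝ) - θ * ‖resid m₀ m f‖ ^ 2 -
        A * (m.parts.card + Δ m) ≤ Z ω := by
  have hu0 : 0 < u := by rw [hu]; positivity
  have hQ0 : 0 < Q := by rw [hQ]; positivity
  have hK0 : 0 < K := by linarith
  have hnb : 0 < (n : ℝ) ^ b := Real.rpow_pos_of_pos (by exact_mod_cast (by omega : 0 < n)) b
  set S := ∑ m ∈ M, Real.exp (-Δ m) with hS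
  have hS0 : 0 ≤ S := Finset.sum_nonneg fun m _ => (Real.exp_pos _).le
  have hQS : 0 ≤ Q * S := by positivity
  have hv : 0 ≤ u ^ 2 / (n : ℝ) ^ b := by positivity
  have hquad := mul_le_mul_of_nonneg_right (remainder_quadratic_le hn hb0) (sq_nonneg u)
  have hquad' : 160 * (n : ℝ) ^ 2 * Real.exp (-(4.5 * (b + 2) * Real.log n)) * u ^ 2 ≤
      160 * Real.exp (-(7 * Real.log n)) * (u ^ 2 / (n : ℝ) ^ b) :=
    hquad.trans_eq (by ring)
  have hzero : (0 : ℝ) + 2 * (5.625 * Q * S +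
        80 * n ^ 2 * Real.exp (-(4.5 * (b + 2) * Real.log n)) * u ^ 2) ≤
        36 * Q * S + 2 * (u ^ 2 / (n : ℝ) ^ b) := by
    have := mul_le_mul_of_nonneg_right (exp_neg_seven_log_le hn) hv
    linarith
  have hinv : 1 / K < 1 := (div_lt_one hK0).2 hK
  have hθ1 : (2 - 1 / K) * (18 * Q) + 18 * K * Q ≤ 36 * K * Q := by
    have h1 : 2 - 1 / K ≤ K := by
      rw [sub_le_iff_le_add, ← sub_nonneg]
      have e : K + 1 / K - 2 = (K - 1) ^ 2 / K := by field_simp; ring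
      rw [e]; positivity
    have := mul_le_mul_of_nonneg_right h1 (by positivity : 0 ≤ 18 * Q)
    linarith
  -- Blocks are nonempty, so `1` is also a lower bound for their size; it ensures `c / √ℓ ≤ c`.
  set ℓ := max 1 (a ^ 2 * Real.log n ^ 2) with hℓ
  have hℓ1 : 1 ≤ ℓ := le_max_left _ _
  have hℓ0 : 0 < ℓ := by linarith
  have hsize' : ∀ I ∈ m₀.parts, ℓ ≤ (I.card : ℝ) := fun I hI =>
    max_le (by exact_mod_cast Finset.card_pos.2 (m₀.nonempty_of_mem_parts hI)) (hsize I hI)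
  have hL := le_log_of_two_le hn
  have hF := penalty_scale_le hσ hc ha hb0 (L := Real.log n) (Real.one_le_sqrt.2 hℓ1)
    (Real.le_sqrt_of_sq_le (by rw [mul_pow]; exact le_max_right _ _))
  rw [← hu, ← hQ] at hF
  have hlin : ∀ κ s : ℝ, 0 ≤ s → (∃ Z : Ω → ℝ, Integrable Z μ ∧ ∫ ω, Z ω ∂μ ≤ 0 ∧
      ∀ m ∈ M, ∀ ω, -(2 * ⟪resid m₀ m f, noise ξ ω⟫_ℝ) - κ / K * ‖resid m₀ m f‖ ^ 2 -
        K * (s * (36 * Q)) * m.parts.card ≤ Z ω) →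
      ∃ Z : Ω → ℝ, Integrable Z μ ∧ ∫ ω, Z ω ∂μ ≤ 0 ∧
      ∀ m ∈ M, ∀ ω, -(2 * ⟪resid m₀ m f, noise ξ ω⟫_ℝ) - κ / K * ‖resid m₀ m f‖ ^ 2 -
        36 * s * K * Q * (m.parts.card + Δ m) ≤ Z ω := by
    rintro κ s hs ⟨Z, hZ, hZ0, hZle⟩
    refine ⟨Z, hZ, hZ0, fun m hmM ω => le_trans ?_ (hZle m hmM ω)⟩
    have : 0 ≤ 36 * s * K * Q * Δ m := mul_nonneg (by positivity) (hΔ m hmM)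
    linarith
  rcases le_total K 15 with hK15 | hK15
  · rcases lt_or_ge n 4 with hn4 | hn4
    · obtain ⟨Z, hZ, hZ0, hZle⟩ := hlin 1 (1 / 2) (by norm_num) <|
        exists_bound_linear_of_lt_four hm hi hσ hc hℓ0 hb hn hn4 m₀ hsize' M hM_cons hM_sub f hK0 hF
      refine ⟨1 / K, 36 * (1 / 2) * K * Q, 0, Z, by positivity, hinv, one_le_CK_mul hK, ?_, hZ,
        hZ0, hzero, hZle⟩
      linarith
    · obtain ⟨Z, hZ, hZ0, hZle⟩ := exists_bound_linear_of_le hm hi hσ hc hb hn m₀ ha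
        (by linarith : 2 ≤ b + 2) hsize M hM_sub Δ hΔ hu hQ hK0 hK15 f
      refine ⟨1 / K, 18 * K * Q, _, Z, by positivity, hinv, one_le_CK_mul hK, hθ1, hZ, hZ0, ?_,
        fun m hmM ω => ?_⟩
      -- The coefficients of `Q` times the sum of weights fit: `23.1 + 2 * 5.625 ≤ 36`.
      · have h1 := mul_le_mul_of_nonneg_right (remainder_linear_le hn hb0) (sq_nonneg u)
        have h2 : 588 * (n : ℝ) ^ 2 * Real.exp (-(3.15 * (b + 2) * Real.log n)) * u ^ 2 ≤
            588 * Real.exp (-(4.25 * Real.log n)) * (u ^ 2 / (n : ℝ) ^ b) :=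
          h1.trans_eq (by ring)
        have h3 := mul_le_mul_of_nonneg_right (exp_neg_log_le_of_four_le hn4) hv
        linarith
      · rw [one_div_mul_eq_div]
        exact hZle m hmM ω
  · have hθ : 3.5 / K < 1 := (div_lt_one hK0).2 (by linarith)
    have hA : (2 - 3.5 / K) * (18 * Q) + 36 * (14 / 15) * K * Q ≤ 36 * K * Q := by
      have h1 : 2 - 3.5 / K ≤ 2 := by
        have : 0 ≤ 3.5 / K := by positivity
        linarith
      have h2 := mul_le_mul_of_nonneg_right h1 (by positivity : 0 ≤ 18 * Q)
      have h3 := mul_le_mul_of_nonneg_right hK15 hQ0.le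
      linarith
    have hex : ∃ Z : Ω → ℝ, Integrable Z μ ∧ ∫ ω, Z ω ∂μ ≤ 0 ∧
        ∀ m ∈ M, ∀ ω, -(2 * ⟪resid m₀ m f, noise ξ ω⟫_ℝ) - 3.5 / K * ‖resid m₀ m f‖ ^ 2 -
          K * (14 / 15 * (36 * Q)) * m.parts.card ≤ Z ω := by
      rcases le_total (Real.log n) 32 with hL32 | hL32
      · exact exists_bound_linear_of_log_le hm hi hσ hc hℓ0 hb hn hL32 m₀ hsize' M hM_cons hM_sub f
          hK0 hF
      · refine exists_bound_linear_of_multiscale hm hi h0 hσ hc hℓ0 hb (by omega) m₀ hm₀ hsize' M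
          hM_cons hM_sub f hK0 ?_
        set d := c / √ℓ
        have hd0 : 0 ≤ d := by positivity
        -- The bound `32` is sharp here: `302.4 * (64 / 9) = (14 / 15) * 72 * 32`.
        have h1 : 72 * 32 * (d * (σ + d)) ≤ 72 * Real.log n * (d * (σ + d)) := by gcongr
        have h2 : 0 ≤ σ * d := by positivity
        linarith [sq_nonneg d, (by ring : (σ + 8 / 3 * d) ^ 2 =
          σ ^ 2 + 16 / 3 * (σ * d) + 64 / 9 * d ^ 2)]
    obtain ⟨Z, hZ, hZ0, hZle⟩ := hlin 3.5 (14 / 15) (by norm_num) hex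
    exact ⟨3.5 / K, 36 * (14 / 15) * K * Q, 0, Z, by positivity, hθ, one_le_CK_mul_of_le hK15, hA,
      hZ, hZ0, hzero, hZle⟩

end Oracle

end HistSel

end

/-! ### Assembly of the quadratic and linear bounds. -/

theorem mainTheorem5
    {Ω : Type*} [MeasurableSpace Ω] (μ : Measure Ω) [IsProbabilityMeasure μ]
    (n : ℕ) (hn : 2 ≤ n)
    -- the regression model `Y = f + ξ`
    (f : EuclideanSpace ℝ (Fin n)) (ξ : Fin n → Ω → ℝ)
    (hξ_meas : ∀ i, Measurable (ξ i))
    (hξ_indep : iIndepFun ξ μ)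
    (hξ_centered : ∀ i, ∫ ω, ξ i ω ∂μ = 0)
    (σ c : ℝ) (hσ : 0 ≤ σ) (hc : 0 ≤ c)
    (hξ_bern : ∀ i, HistSel.BernsteinBound μ (ξ i) σ c)
    -- the partition `m₀` and the collection `M` of partitions `m` with `S_m ⊆ S_{m₀}`
    (m₀ : Finpartition (Finset.univ : Finset (Fin n)))
    (hm₀ : HistSel.IsConsecutive m₀)
    (M : Finset (Finpartition (Finset.univ : Finset (Fin n)))) (hM : M.Nonempty)
    (hM_cons : ∀ m ∈ M, HistSel.IsConsecutive m)
    (hM_sub : ∀ m ∈ M, HistSel.histSpace m ≤ HistSel.histSpace m₀)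
    (a b : ℝ) (ha : 0 < a) (hb : 0 < b)
    (hsize : ∀ I ∈ m₀.parts, a ^ 2 * Real.log n ^ 2 ≤ (I.card : ℝ))
    -- the weights and the penalty
    (Δ : Finpartition (Finset.univ : Finset (Fin n)) → ℝ) (hΔ : ∀ m ∈ M, 0 ≤ Δ m)
    (pen : Finpartition (Finset.univ : Finset (Fin n)) → ℝ)
    (K : ℝ) (hK : 1 < K)
    (hpen : ∀ m ∈ M,
      K * HistSel.penFactor σ c a b * ((m.parts.card : ℝ) + Δ m) ≤ pen m)
    -- the selected partition: any (measurable) minimizer over `M` of the criterion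
    (mhat : Ω → Finpartition (Finset.univ : Finset (Fin n)))
    (hmhat_meas : ∀ m, MeasurableSet {ω | mhat ω = m})
    (hmhat_mem : ∀ ω, mhat ω ∈ M)
    (hmhat_min : ∀ ω, ∀ m ∈ M,
      HistSel.crit pen (HistSel.obs f ξ ω) (mhat ω) ≤ HistSel.crit pen (HistSel.obs f ξ ω) m) :
    (∀ m ∈ M, Integrable (fun ω => ‖f - HistSel.lsEst m (HistSel.obs f ξ ω)‖ ^ 2) μ) ∧
    Integrable (fun ω => ‖f - HistSel.lsEst (mhat ω) (HistSel.obs f ξ ω)‖ ^ 2) μ ∧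
    (∫ ω, ‖f - HistSel.lsEst (mhat ω) (HistSel.obs f ξ ω)‖ ^ 2 ∂μ) ≤
      HistSel.CK K *
        (M.inf' hM (fun m =>
            (∫ ω, ‖f - HistSel.lsEst m (HistSel.obs f ξ ω)‖ ^ 2 ∂μ) + pen m) +
          (HistSel.penFactor σ c a b * ∑ m ∈ M, Real.exp (-Δ m) +
            2 * ((c + σ) ^ 2 * (b + 2) ^ 2 / (a ^ 2 * (n : ℝ) ^ b)))) := by
  open HistSel in
  have hK0 : 0 < K := by linarith
  set u := (σ + c) * (b + 2) / a with hu
  set Q := 9 * σ ^ 2 + c * u with hQ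
  have hpF : penFactor σ c a b = 36 * Q := penFactor_eq σ c a b
  have hσc : 0 ≤ σ + c := by linarith
  have hu0 : 0 ≤ u := by positivity
  have hQ0 : 0 ≤ Q := by positivity
  have hnb : 0 < (n : ℝ) ^ b := Real.rpow_pos_of_pos (by exact_mod_cast (by omega : 0 < n)) b
  have hRu : (c + σ) ^ 2 * (b + 2) ^ 2 / (a ^ 2 * (n : ℝ) ^ b) = u ^ 2 / (n : ℝ) ^ b := by
    rw [hu]; field_simp; ring
  have hS0 : 0 ≤ ∑ m ∈ M, Real.exp (-Δ m) := Finset.sum_nonneg fun m _ => (Real.exp_pos _).le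
  have hpen' : ∀ m ∈ M, 36 * K * Q * ((m.parts.card : ℝ) + Δ m) ≤ pen m := fun m hm => by
    refine le_trans (le_of_eq ?_) (hpen m hm)
    rw [hpF]; ring
  have hD : ∀ m ∈ M, 0 ≤ (m.parts.card : ℝ) + Δ m := fun m hm => by
    have := hΔ m hm
    positivity
  have hpen0 : ∀ m ∈ M, 0 ≤ pen m := fun m hm =>
    (mul_nonneg (by positivity) (hD m hm)).trans (hpen' m hm)
  have h1 : ∀ i, Integrable (ξ i) μ := fun i => (hξ_bern i).integrable (hξ_meas i) hc
  have h2 : ∀ i, Integrable (fun ω => ξ i ω ^ 2) μ := fun i =>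
    (hξ_bern i).integrable_sq (hξ_meas i) hc
  rw [hpF, hRu]
  have hR0 : 0 ≤ 36 * Q * ∑ m ∈ M, Real.exp (-Δ m) + 2 * (u ^ 2 / (n : ℝ) ^ b) := by positivity
  -- The estimates above require `σ > 0`. If `σ = 0` the noise vanishes almost surely and every
  -- excess is nonpositive.
  rcases hσ.eq_or_lt with hσ0 | hσ0
  · have hz : ∀ᵐ ω ∂μ, ∀ i, ξ i ω = 0 := ae_all_iff.2 fun i => by
      have h := hξ_bern i
      rw [← hσ0] at h
      exact h.ae_eq_zero (hξ_meas i) hc (hξ_centered i)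
    refine oracle_of_excess_le f hξ_meas h1 hξ_centered h2 m₀ M hM hM_sub pen hpen0 mhat hmhat_meas
      hmhat_mem hmhat_min ((div_lt_one hK0).2 hK) (one_le_CK_mul hK) (one_le_CK hK) hR0 (fun _ => 0)
      (integrable_const 0) (by simpa using hR0) fun m hm => ?_
    filter_upwards [hz] with ω hω
    have hn0 : noise ξ ω = 0 := by
      ext i
      exact hω i
    have hl : lsEst m (0 : EuclideanSpace ℝ (Fin n)) = 0 := map_zero _
    rw [hn0, excess, hl, norm_zero, inner_zero_right]
    have h3 : 0 ≤ 1 / K * ‖resid m₀ m f‖ ^ 2 := by positivity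
    linarith [hpen0 m hm]
  · obtain ⟨Z1, hZ1, hZ1R, hZ1le⟩ := exists_bound_norm_lsEst_sq hξ_meas hξ_indep hσ0 hc hξ_bern hn m₀
      ha (by linarith : 2 ≤ b + 2) hsize M hM_sub Δ hΔ hu hQ
    obtain ⟨θ, A, R, Z2, hθ0, hθ1, hCθ, hA, hZ2, hZ2R, hR, hZ2le⟩ := exists_bound_linear hξ_meas
      hξ_indep hξ_centered hσ0 hc hξ_bern hn m₀ hm₀ ha hb hsize M hM_cons hM_sub Δ hΔ f hK hu hQ
    refine oracle_of_excess_le f hξ_meas h1 hξ_centered h2 m₀ M hM hM_sub pen hpen0 mhat hmhat_meas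
      hmhat_mem hmhat_min hθ1 hCθ (one_le_CK hK) hR0 (fun ω => (2 - θ) * Z1 ω + Z2 ω)
      ((hZ1.const_mul _).add hZ2) ?_ fun m hm => Filter.Eventually.of_forall fun ω => ?_
    · rw [integral_add (hZ1.const_mul _) hZ2, integral_const_mul]
      have h3 := mul_le_mul_of_nonneg_left hZ1R (by linarith : 0 ≤ 2 - θ)
      have h4 : (2 - θ) * (5.625 * Q * ∑ m ∈ M, Real.exp (-Δ m) +
          80 * n ^ 2 * Real.exp (-(4.5 * (b + 2) * Real.log n)) * u ^ 2) ≤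
          2 * (5.625 * Q * ∑ m ∈ M, Real.exp (-Δ m) +
          80 * n ^ 2 * Real.exp (-(4.5 * (b + 2) * Real.log n)) * u ^ 2) := by
        gcongr
        linarith
      linarith
    · rw [excess]
      have h3 := mul_le_mul_of_nonneg_left (hZ1le m hm ω) (by linarith : 0 ≤ 2 - θ)
      have h4 := hZ2le m hm ω
      have h5 := mul_le_mul_of_nonneg_right hA (hD m hm)
      have h6 := hpen' m hm
      linarith
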